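/- Let $X$ be a separable real Hilbert space, $T>0$, $\overline\Delta=\{(s,t):0\le s\le t\le T\}$. Let $\{U(t,s)\}_{(s,t)\in\overline\Delta}\subset\mathcal L(X)$ be a strongly continuous evolution operator: $(s,t)\mapsto U(t,s)x$ is continuous on $\overline\Delta$ for every $x\in X$, $U(t,t)=I$, and $U(t,s)U(s,r)=U(t,r)$ for $0\le r\le s\le t\le T$. Let $B:[0,T]\to\mathcal L(X)$ be bounded with $t\mapsto B(t)x$ measurable for every $x\in X$, and let $f:[0,T]\to X$ be bounded and measurable. For $0\le s\le t\le T$ put $$Q(t,s)x=\int_s^tU(t,r)B(r)B(r)^*U(t,r)^*x\,dr,\qquad m^x(t,s)=U(t,s)x+\int_s^tU(t,r)f(r)\,dr .$$ Assume: (H1) every $Q(t,s)$, $0\le s\le t\le T$, is symmetric, non-negative and of finite trace; (H2) $U(t,s)(X)\subseteq Q(t,s)^{1/2}(X)$ for $0\le s<t\le T$; (H3) there are $\theta>0$ and $c\in\mathbb R$ such that $\Lambda(t,s)=Q(t,s)^{-1/2}U(t,s)$, where $Q(t,s)^{-1/2}$ is the pseudo-inverse of $Q(t,s)^{1/2}$,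 satisfies $\|\Lambda(t,s)\|_{\mathcal L(X)}\le c\,(t-s)^{-\theta}$ for $0\le s<t\le T$. For bounded Borel $\varphi:X\to\mathbb R$ let $P_{s,t}\varphi(x)=\int_X\varphi(y)\,\mathcal N_{m^x(t,s),Q(t,s)}(dy)$, where $\mathcal N_{m,Q}$ is the Gaussian measure on $X$ with mean $m$ and covariance operator $Q$. For a non-integer $\beta>0$ with integer part $n$, $C^\beta_b(X)$ is the space of the bounded functions $g:X\to\mathbb R$ that are $n$ times continuously Fréchet differentiable with bounded derivatives up to order $n$ and with $D^ng$ Hölder continuous of exponent $\beta-n$, normed by $$\|g\|_{C^\beta_b(X)}=\|g\|_\infty+\sum_{k=1}^n\sup_x\|D^kg(x)\|+[D^ng]_{C^{\beta-n}}.$$ For $t\in[0,T]$, $C_b([0,t]\times X)$ is the space of bounded continuous functions with the sup norm, and $C^{0,\beta}_b([0,t]\times X)$ is the space of the bounded continuous $v:[0,t]\times X\to\mathbb R$ with $v(s,\cdot)\in C^\beta_b(X)$ for every $s\in[0,t]$, with $\|v\|_{C^{0,\beta}_b}=\sup_{s\in[0,t]}\|v(s,\cdot)\|_{C^\beta_b(X)}<\infty$,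 and such that for all $k\le n$ and $h_1,\dots,h_k\in X$ the partial derivative $\partial^kv/\partial h_1\cdots\partial h_k$ is continuous on $[0,t]\times X$. For $t\in[0,T]$ the mild solution with data $\varphi,\psi$ is $$u(s,x)=P_{s,t}\varphi(x)-\int_s^tP_{s,\sigma}\psi(\sigma,\cdot)(x)\,d\sigma,\qquad 0\le s\le t,\ x\in X.$$ **Theorem.** (i) If $1/\theta\notin\mathbb N$, there is $C>0$ such that for all $t\in[0,T]$, $\varphi\in C^{1/\theta}_b(X)$ and $\psi\in C_b([0,t]\times X)$: the integral defining $u$ is well defined (its integrand is integrable in $\sigma$ for all $s,x$), $u\in C^{0,1/\theta}_b([0,t]\times X)$, and $$\|u\|_{C^{0,1/\theta}_b([0,t]\times X)}\le C\big(\|\varphi\|_{C^{1/\theta}_b(X)}+\|\psi\|_\infty\big).$$ (ii) If $\alpha\in(0,1)$ and $\alpha+1/\theta\notin\mathbb N$, there is $C>0$ such that for all $t\in[0,T]$, $\varphi\in C^{\alpha+1/\theta}_b(X)$ and $\psi\in C^{0,\alpha}_b([0,t]\times X)$: the integral defining $u$ is well defined, $u\in C^{0,\alpha+1/\theta}_b([0,t]\times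 X)$, and $$\|u\|_{C^{0,\alpha+1/\theta}_b([0,t]\times X)}\le C\big(\|\varphi\|_{C^{\alpha+1/\theta}_b(X)}+\|\psi\|_{C^{0,\alpha}_b([0,t]\times X)}\big).$$ In both parts $C$ does not depend on $t$, $\varphi$ and $\psi$. -/

import Mathlib

open MeasureTheory ProbabilityTheory Set
open scoped ENNReal NNReal RealInnerProductSpace

noncomputable section

namespace OrnsteinUhlenbeck

section Operators

variable {X : Type*} [NormedAddCommGroup X] [InnerProductSpace ℝ X]

/-- The strong (pointwise) integral `x ↦ ∫_s^t F(r) x dr` of an operator valued function, as a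
bounded operator. It is determined by its values; if these do not form a bounded operator, the
value is `0`. -/
def strongIntegral (F : ℝ → X →L[ℝ] X) (s t : ℝ) : X →L[ℝ] X :=
  open Classical in
  if h : ∃ A : X →L[ℝ] X, ∀ x, A x = ∫ r in s..t, F r x then h.choose else 0

/-- A bounded and strongly integrable operator function has a strong integral. -/
theorem strongIntegral_apply {F : ℝ → X →L[ℝ] X} {s t K : ℝ}
    (hint : ∀ x, IntervalIntegrable (fun r => F r x) volume s t)
    (hK : ∀ r ∈ uIoc s t, ‖F r‖ ≤ K) (x : X) :
    strongIntegral F s t x = ∫ r in s..t, F r x := by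
  have h : ∃ A : X →L[ℝ] X, ∀ x, A x = ∫ r in s..t, F r x := by
    refine ⟨LinearMap.mkContinuous
      { toFun := fun x => ∫ r in s..t, F r x
        map_add' := fun x y => by
          simp only [map_add]
          exact intervalIntegral.integral_add (hint x) (hint y)
        map_smul' := fun c x => by
          simp only [map_smul, RingHom.id_apply]
          exact intervalIntegral.integral_smul c _ } (K * |t - s|) fun x => ?_, fun x => rfl⟩
    have := intervalIntegral.norm_integral_le_of_norm_le_const (a := s) (b := t)
      (f := fun r => F r x) (C := K * ‖x‖) fun r hr =>
        ((F r).le_opNorm x).trans (mul_le_mul_of_nonneg_right (hK r hr) (norm_nonneg x))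
    exact this.trans (le_of_eq (by ring))
  unfold strongIntegral
  rw [dif_pos h]
  exact h.choose_spec x

/-- The operators in `𝓛₁⁺(X)`: symmetric, non-negative, with finite trace. -/
def IsPositiveTraceClass (Q : X →L[ℝ] X) : Prop :=
  Q.IsPositive ∧
    ∃ (w : Set X) (b : HilbertBasis w ℝ X), Summable fun i => ⟪Q (b i), b i⟫

/-- The square root `Q^{1/2}` of a bounded symmetric non-negative operator `Q`: the (unique) bounded
symmetric non-negative operator `S` with `S² = Q`. -/
def opSqrt (Q : X →L[ℝ] X) : X →L[ℝ] X :=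
  open Classical in
  if h : ∃ S : X →L[ℝ] X, S.IsPositive ∧ S ∘L S = Q then h.choose else 0

/-- The pseudo-inverse of a bounded operator `S`: for `x` in the range of `S`, the unique
`y ∈ (ker S)ᗮ` with `S y = x` (that is, the preimage of `x` with the smallest norm); the value is
`0` outside the range of `S`. -/
def pseudoInverse (S : X →L[ℝ] X) (x : X) : X :=
  open Classical in
  if h : ∃ y, y ∈ (LinearMap.ker (S : X →ₗ[ℝ] X))ᗮ ∧ S y = x then h.choose else 0

end Operators

section Gaussian

variable {X : Type*} [NormedAddCommGroup X] [InnerProductSpace ℝ X] [MeasurableSpace X]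
  [BorelSpace X]

/-- `μ` is a Gaussian measure with mean `m` and covariance operator `Q`. -/
def IsGaussianLaw (m : X) (Q : X →L[ℝ] X) (μ : Measure X) : Prop :=
  IsGaussian μ ∧ ∫ y, y ∂μ = m ∧
    ∀ x y, covarianceBilin μ x y = ⟪Q x, y⟫

/-- The Gaussian measure `𝒩_{m,Q}` with mean `m` and covariance operator `Q ∈ 𝓛₁⁺(X)`. -/
def gaussianMeasure (m : X) (Q : X →L[ℝ] X) : Measure X :=
  open Classical in
  if h : ∃ μ : Measure X, IsGaussianLaw m Q μ then h.choose else 0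

end Gaussian

section EvolutionFamily

variable {X : Type*} [NormedAddCommGroup X] [InnerProductSpace ℝ X] [CompleteSpace X]

/-- `Q(t,s) = ∫_s^t U(t,r) B(r) B(r)* U(t,r)* dr`. -/
def covQ (U : ℝ → ℝ → X →L[ℝ] X) (B : ℝ → X →L[ℝ] X) (t s : ℝ) : X →L[ℝ] X :=
  strongIntegral (fun r => U t r ∘L B r ∘L ContinuousLinearMap.adjoint (B r) ∘L
    ContinuousLinearMap.adjoint (U t r)) s t

/-- `m^x(t,s) = U(t,s) x + g(t,s)`, with `g(t,s) = ∫_s^t U(t,r) f(r) dr`. -/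
def meanM (U : ℝ → ℝ → X →L[ℝ] X) (f : ℝ → X) (t s : ℝ) (x : X) : X :=
  U t s x + ∫ r in s..t, U t r (f r)

/-- `Λ(t,s) = Q(t,s)^{-1/2} U(t,s)`, with `Q(t,s)^{-1/2}` the pseudo-inverse of `Q(t,s)^{1/2}`. -/
def Lam (U : ℝ → ℝ → X →L[ℝ] X) (B : ℝ → X →L[ℝ] X) (t s : ℝ) (h : X) : X :=
  pseudoInverse (opSqrt (covQ U B t s)) (U t s h)

/-- `P_{s,t} φ (x) = ∫ φ(y) 𝒩_{m^x(t,s),Q(t,s)}(dy)`. -/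
def evolP [MeasurableSpace X] [BorelSpace X] (U : ℝ → ℝ → X →L[ℝ] X)
    (B : ℝ → X →L[ℝ] X) (f : ℝ → X)
    (s t : ℝ) (φ : X → ℝ) (x : X) : ℝ :=
  ∫ y, φ y ∂(gaussianMeasure (meanM U f t s x) (covQ U B t s))

/-- The mild solution `u(s,x) = P_{s,t} φ(x) - ∫_s^t P_{s,σ} ψ(σ,·)(x) dσ`. -/
def mildSolution [MeasurableSpace X] [BorelSpace X] (U : ℝ → ℝ → X →L[ℝ] X)
    (B : ℝ → X →L[ℝ] X) (f : ℝ → X)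
    (t : ℝ) (φ : X → ℝ) (ψ : ℝ → X → ℝ) (s : ℝ) (x : X) : ℝ :=
  evolP U B f s t φ x - ∫ σ in s..t, evolP U B f s σ (ψ σ) x

/-- `{U(t,s) : 0 ≤ s ≤ t ≤ T}` is a strongly continuous evolution operator. -/
structure IsEvolutionOperator (T : ℝ) (U : ℝ → ℝ → X →L[ℝ] X) : Prop where
  continuousOn : ∀ x, ContinuousOn (fun p : ℝ × ℝ => U p.2 p.1 x)
    {p | 0 ≤ p.1 ∧ p.1 ≤ p.2 ∧ p.2 ≤ T}
  self : ∀ t, 0 ≤ t → t ≤ T → U t t = ContinuousLinearMap.id ℝ X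
  comp : ∀ r s t, 0 ≤ r → r ≤ s → s ≤ t → t ≤ T → U t s ∘L U s r = U t r

/-- The assumptions on the data: `U` is a strongly continuous evolution operator, `B` and `f` are
bounded and (strongly) measurable, and every `Q(t,s)` belongs to `𝓛₁⁺(X)`. -/
structure IsOUData (T : ℝ) (U : ℝ → ℝ → X →L[ℝ] X) (B : ℝ → X →L[ℝ] X) (f : ℝ → X) : Prop where
  evolution : IsEvolutionOperator T U
  bounded_B : ∃ K : ℝ, ∀ r ∈ Icc 0 T, ‖B r‖ ≤ K
  measurable_B : ∀ x, AEStronglyMeasurable (fun r => B r x) (volume.restrict (Icc 0 T))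
  bounded_f : ∃ K : ℝ, ∀ r ∈ Icc 0 T, ‖f r‖ ≤ K
  measurable_f : AEStronglyMeasurable f (volume.restrict (Icc 0 T))
  traceClass : ∀ s t, 0 ≤ s → s ≤ t → t ≤ T → IsPositiveTraceClass (covQ U B t s)

/-- `U(t,s)(X) ⊆ Q(t,s)^{1/2}(X)` for all `0 ≤ s < t ≤ T`. -/
def RangeCondition (T : ℝ) (U : ℝ → ℝ → X →L[ℝ] X) (B : ℝ → X →L[ℝ] X) : Prop :=
  ∀ s t, 0 ≤ s → s < t → t ≤ T → range (U t s) ⊆ range (opSqrt (covQ U B t s))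

/-- `‖Λ(t,s)‖ ≤ C (t - s)^{-θ}` for all `0 ≤ s < t ≤ T`, for some constant `C`. -/
def PowerBlowUp (T θ : ℝ) (U : ℝ → ℝ → X →L[ℝ] X) (B : ℝ → X →L[ℝ] X) : Prop :=
  ∃ C : ℝ, ∀ s t, 0 ≤ s → s < t → t ≤ T → ∀ h, ‖Lam U B t s h‖ ≤ C * (t - s) ^ (-θ) * ‖h‖

end EvolutionFamily

section FunctionSpaces

variable {X : Type*} [NormedAddCommGroup X] [NormedSpace ℝ X]

/-- For `β > 0` not an integer and `n = ⌊β⌋`, the norm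
`‖f‖_∞ + ∑_{k=1}^n sup ‖D^k f‖ + [D^n f]_{C^{β-n}}` of `C^β_b(X)`, with values in `[0,∞]`. -/
def holderNorm (β : ℝ) (f : X → ℝ) : ℝ≥0∞ :=
  (⨆ x, ‖f x‖ₑ) + (∑ k ∈ Finset.Icc 1 ⌊β⌋₊, ⨆ x, ‖iteratedFDeriv ℝ k f x‖ₑ) +
    eHolderNorm (β - ⌊β⌋₊).toNNReal (iteratedFDeriv ℝ ⌊β⌋₊ f)

/-- `f ∈ C^β_b(X)`, for `β > 0` not an integer. -/
def MemHolderSpace (β : ℝ) (f : X → ℝ) : Prop :=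
  ContDiff ℝ (⌊β⌋₊ : ℕ) f ∧ holderNorm β f < ∞

/-- The sup norm on `[0,t] × X`. -/
def supNorm (t : ℝ) (ψ : ℝ → X → ℝ) : ℝ≥0∞ := ⨆ s ∈ Icc 0 t, ⨆ x, ‖ψ s x‖ₑ

/-- `ψ ∈ C_b([0,t] × X)`. -/
def MemCb (t : ℝ) (ψ : ℝ → X → ℝ) : Prop :=
  ContinuousOn (fun p : ℝ × X => ψ p.1 p.2) (Icc 0 t ×ˢ univ) ∧ supNorm t ψ < ∞

/-- The norm of `C^{0,β}_b([0,t] × X)`, with values in `[0,∞]`. -/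
def spaceHolderNorm (β t : ℝ) (ψ : ℝ → X → ℝ) : ℝ≥0∞ := ⨆ s ∈ Icc 0 t, holderNorm β (ψ s)

/-- `ψ ∈ C^{0,β}_b([0,t] × X)`, for `β > 0` not an integer: `ψ` is bounded and continuous on
`[0,t] × X`, `ψ(s,·) ∈ C^β_b(X)` with norm bounded uniformly in `s`, and the partial derivatives
`∂^k ψ/∂h₁…∂h_k` of order `k ≤ ⌊β⌋` are continuous on `[0,t] × X`. -/
def MemSpaceHolder (β t : ℝ) (ψ : ℝ → X → ℝ) : Prop :=
  MemCb t ψ ∧ (∀ s ∈ Icc 0 t, MemHolderSpace β (ψ s)) ∧ spaceHolderNorm β t ψ < ∞ ∧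
    ∀ k ≤ ⌊β⌋₊, ∀ h : Fin k → X,
      ContinuousOn (fun p : ℝ × X => iteratedFDeriv ℝ k (ψ p.1) p.2 h) (Icc 0 t ×ˢ univ)

end FunctionSpaces

end OrnsteinUhlenbeck

end

set_option linter.unusedSectionVars false

noncomputable section

namespace OrnsteinUhlenbeck

open Filter Topology

/-! ### Square roots of positive operators by a power series. -/

section SquareRoot

variable {X : Type*} [NormedAddCommGroup X] [InnerProductSpace ℝ X]

/-! Smoothing. By (H2) and (H3), `U(t,s)k = Q(t,s)^{1/2} w` with `‖w‖ ≤ c (t-s)^{-θ} ‖k‖`, so moving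
`x` shifts the Gaussian law along its Cameron-Martin space. In such a direction the law splits off
an independent one-dimensional Gaussian (`exists_gaussianMeasure_eq_map`), and the derivative
becomes a scalar Gaussian integration by parts. If `φ` has `α`-Hölder constant `A`, the derivative
is at most `2 A ‖w‖^{1-α} ‖Q^{1/2} w‖^α`, of order `A (t-s)^{-(1-α)θ}` for bounded `k`. Combining
this at midpoints with `D(P g) = (P Dg) ∘ U` gives `‖D^{j+1} P_{s,t} φ‖ ≤ C A (t-s)^{-(j+1-α)θ}`
(`IsOUData.smoothingBound`). The same commutation formula shows that `P_{s,t}` is bounded on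
`C^{n+γ}_b`, which settles the term with `φ` (`IsOUData.exists_holderBound_evolOp`).

Source term. Put `β = α + 1/θ` and `n = ⌊β⌋`. The singularity of the derivative of order `n+1` is
not integrable in `σ`, so the Hölder seminorm of `D^n` needs an interpolation. Here it is a dyadic
decomposition of `[s,t]` accumulating at `s`, in which every block is as long as its distance `l`
from `s`. By Chapman-Kolmogorov a block equals `P` over a time `l` applied to a function of size
`l`. With the scale `λ = l^θ`, its derivative of order `k`, for `1 ≤ k ≤ n+1`, is bounded by a
multiple of `λ^{β-k}`. In an increment of `D^n`, scales below `‖x-y‖` use oscillation and scales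
above it use `D^{n+1}`. Both sums are geometric because `β` is not an integer
(`exists_holderBound_tsum`, `IsOUData.exists_holderBound_integral`).

Joint continuity. The Gaussian laws depend weakly continuously on `(s,x)`, by Chapman-Kolmogorov and
the continuity of `s ↦ tr Q(t,s)` (`IsOUData.continuousOn_evolOp`). Derivatives of `u` are uniform
limits of difference quotients (`continuousOn_iteratedFDeriv`).

Measurability in `σ`. Gaussian integrals are limits of integrals over finite Gaussian sums built
from a square root of `Q`. That root is an explicit power series in `1 - Q` after scaling, hence
measurable in the parameter. -/

/-- The coefficients `Cₙ / 4ⁿ`, with `Cₙ` the Catalan numbers. -/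
def catalanCoeff (n : ℕ) : ℝ := catalan n / 4 ^ n

theorem catalanCoeff_nonneg (n : ℕ) : 0 ≤ catalanCoeff n := by
  unfold catalanCoeff; positivity

/-- The sum telescopes. The resulting bound `2` for the full series makes it converge absolutely up
to `‖R‖ = 1`, and is also the exact constant behind the positivity of the square root. -/
theorem sum_range_catalanCoeff (N : ℕ) :
    ∑ n ∈ Finset.range N, catalanCoeff n = 2 * (1 - (Nat.centralBinom N : ℝ) / 4 ^ N) := by
  induction N with
  | zero => simp
  | succ N ih =>
    have h1 : ((N : ℝ) + 1) * catalan N = Nat.centralBinom N := by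
      exact_mod_cast succ_mul_catalan_eq_centralBinom N
    have h2 : ((N : ℝ) + 1) * Nat.centralBinom (N + 1) = 2 * (2 * N + 1) * Nat.centralBinom N := by
      exact_mod_cast Nat.succ_mul_centralBinom_succ N
    have h3 : (Nat.centralBinom (N + 1) : ℝ) = 2 * (2 * N + 1) * catalan N := by
      have : (N : ℝ) + 1 ≠ 0 := by positivity
      rw [← h1] at h2
      apply mul_left_cancel₀ this
      rw [h2]; ring
    rw [Finset.sum_range_succ, ih, h3, ← h1, catalanCoeff, pow_succ]
    field_simp
    ring

theorem summable_catalanCoeff : Summable catalanCoeff := by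
  refine summable_of_sum_range_le (c := 2) catalanCoeff_nonneg fun N => ?_
  rw [sum_range_catalanCoeff]
  have : (0 : ℝ) ≤ (Nat.centralBinom N : ℝ) / 4 ^ N := by positivity
  linarith

theorem tsum_catalanCoeff_le : ∑' n, catalanCoeff n ≤ 2 := by
  refine Real.tsum_le_of_sum_range_le catalanCoeff_nonneg fun N => ?_
  rw [sum_range_catalanCoeff]
  have : (0 : ℝ) ≤ (Nat.centralBinom N : ℝ) / 4 ^ N := by positivity
  linarith

/-- This is the Catalan convolution recursion rescaled by powers of `4`; it becomes the quadratic
equation for the series. -/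
theorem sum_antidiagonal_catalanCoeff (n : ℕ) :
    ∑ kl ∈ Finset.HasAntidiagonal.antidiagonal n, catalanCoeff kl.1 * catalanCoeff kl.2 =
      4 * catalanCoeff (n + 1) := by
  have h : ∀ kl ∈ Finset.HasAntidiagonal.antidiagonal n, catalanCoeff kl.1 * catalanCoeff kl.2 =
      (catalan kl.1 * catalan kl.2 : ℕ) / (4 : ℝ) ^ n := by
    intro kl hkl
    rw [Finset.HasAntidiagonal.mem_antidiagonal] at hkl
    rw [catalanCoeff, catalanCoeff, ← hkl, pow_add]
    push_cast
    field_simp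
  rw [Finset.sum_congr rfl h, ← Finset.sum_div, ← Nat.cast_sum, ← catalan_succ', catalanCoeff,
    pow_succ]
  field_simp

variable {A : Type*} [NormedRing A] [NormedAlgebra ℝ A] [NormOneClass A]

theorem norm_catalanCoeff_smul_pow_le {R : A} (hR : ‖R‖ ≤ 1) (n : ℕ) :
    ‖catalanCoeff n • R ^ n‖ ≤ catalanCoeff n := by
  rw [norm_smul, Real.norm_of_nonneg (catalanCoeff_nonneg n)]
  have : ‖R ^ n‖ ≤ 1 := (norm_pow_le R n).trans (pow_le_one₀ (norm_nonneg _) hR)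
  nlinarith [catalanCoeff_nonneg n]

/-- The sum of the Catalan series satisfies `Z = 1 + R Z² / 4`. -/
theorem catalanSeries_identity [CompleteSpace A] {R : A} (hR : ‖R‖ ≤ 1) :
    R * ((∑' n, catalanCoeff n • R ^ n) * ∑' n, catalanCoeff n • R ^ n) =
      (4 : ℝ) • ((∑' n, catalanCoeff n • R ^ n) - 1) := by
  have hs : Summable fun n => ‖catalanCoeff n • R ^ n‖ :=
    summable_catalanCoeff.of_nonneg_of_le (fun _ => norm_nonneg _)
      (norm_catalanCoeff_smul_pow_le hR)
  rw [tsum_mul_tsum_eq_tsum_sum_antidiagonal_of_summable_norm hs hs]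
  have h : ∀ n, ∑ kl ∈ Finset.HasAntidiagonal.antidiagonal n,
      (catalanCoeff kl.1 • R ^ kl.1) * (catalanCoeff kl.2 • R ^ kl.2) =
      (4 * catalanCoeff (n + 1)) • R ^ n := by
    intro n
    rw [← sum_antidiagonal_catalanCoeff, Finset.sum_smul]
    refine Finset.sum_congr rfl fun kl hkl => ?_
    rw [Finset.HasAntidiagonal.mem_antidiagonal] at hkl
    rw [smul_mul_smul_comm, ← pow_add, hkl]
  simp_rw [h]
  have hsum : Summable fun n => catalanCoeff n • R ^ n := hs.of_norm
  rw [hsum.tsum_eq_zero_add]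
  have hs' : Summable fun n => (4 * catalanCoeff (n + 1)) • R ^ n := by
    refine Summable.of_norm_bounded
      (((summable_nat_add_iff 1).2 summable_catalanCoeff).mul_left 4) fun n => ?_
    rw [norm_smul, Real.norm_of_nonneg (by have := catalanCoeff_nonneg (n + 1); positivity)]
    have : ‖R ^ n‖ ≤ 1 := (norm_pow_le R n).trans (pow_le_one₀ (norm_nonneg _) hR)
    nlinarith [catalanCoeff_nonneg (n + 1)]
  rw [← hs'.tsum_mul_left]
  have h0 : catalanCoeff 0 • R ^ 0 = 1 := by simp [catalanCoeff]
  rw [h0, add_sub_cancel_left, ← Summable.tsum_const_smul _ ((summable_nat_add_iff 1).2 hsum)]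
  refine tsum_congr fun n => ?_
  rw [mul_smul_comm, smul_smul, pow_succ']

/-- Positivity tested on `x - Qx`, with `‖Q‖ ≤ 1`, gives `‖Qx‖² ≤ ⟪Qx, x⟫`. Expanding `‖x - Qx‖²`
then finishes. -/
theorem norm_one_sub_le_one {Q : X →L[ℝ] X} (hQ : Q.IsPositive) (h : ‖Q‖ ≤ 1) :
    ‖1 - Q‖ ≤ 1 := by
  refine ContinuousLinearMap.opNorm_le_bound _ zero_le_one fun x => ?_
  rw [one_mul]
  have h1 : 0 ≤ ⟪Q (x - Q x), x - Q x⟫ := hQ.inner_nonneg_left _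
  have h2 : ⟪Q (Q x), Q x⟫ ≤ ‖Q x‖ ^ 2 := by
    refine (real_inner_le_norm _ _).trans ?_
    have := (Q.le_opNorm (Q x)).trans (mul_le_mul_of_nonneg_right h (norm_nonneg _))
    nlinarith [norm_nonneg (Q x)]
  have h3 : ⟪Q (Q x), x⟫ = ‖Q x‖ ^ 2 := by
    rw [hQ.inner_left_eq_inner_right, real_inner_self_eq_norm_sq]
  have h4 : ⟪Q x, Q x⟫ = ‖Q x‖ ^ 2 := real_inner_self_eq_norm_sq _
  rw [map_sub, inner_sub_left, inner_sub_right, inner_sub_right, h3, h4] at h1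
  have h5 : ‖x - Q x‖ ^ 2 = ‖x‖ ^ 2 - 2 * ⟪Q x, x⟫ + ‖Q x‖ ^ 2 := by
    rw [norm_sub_sq_real, real_inner_comm]
  have : ‖x - Q x‖ ≤ ‖x‖ := by
    apply le_of_sq_le_sq _ (norm_nonneg _)
    nlinarith [hQ.inner_nonneg_left x]
  simpa using this

/-- The square root of a positive operator of norm at most `1`, as a power series in `1 - Q`. -/
def sqrtSeries (Q : X →L[ℝ] X) : X →L[ℝ] X :=
  1 - (1 / 2 : ℝ) • ((1 - Q) * ∑' n, catalanCoeff n • (1 - Q) ^ n)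

theorem summable_norm_catalan_pow {Q : X →L[ℝ] X} (hQ : Q.IsPositive) (h : ‖Q‖ ≤ 1) :
    Summable fun n => ‖catalanCoeff n • (1 - Q) ^ n‖ := by
  have hR := norm_one_sub_le_one hQ h
  refine summable_catalanCoeff.of_nonneg_of_le (fun _ => norm_nonneg _) fun n => ?_
  -- On the zero space `‖1‖ = 0`, so `NormOneClass` fails and the case is separate.
  rcases subsingleton_or_nontrivial X with hX | hX
  · rw [Subsingleton.elim (catalanCoeff n • (1 - Q) ^ n) 0, norm_zero]
    exact catalanCoeff_nonneg n
  · exact norm_catalanCoeff_smul_pow_le hR n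

variable [CompleteSpace X]

theorem sqrtSeries_mul_self {Q : X →L[ℝ] X} (hQ : Q.IsPositive) (h : ‖Q‖ ≤ 1) :
    sqrtSeries Q * sqrtSeries Q = Q := by
  rcases subsingleton_or_nontrivial X with hX | hX
  · exact Subsingleton.elim _ _
  have hid := catalanSeries_identity (norm_one_sub_le_one hQ h)
  unfold sqrtSeries
  set R := 1 - Q with hRdef
  set Z := ∑' n, catalanCoeff n • R ^ n with hZ
  have hcomm : Z * R = R * Z := by
    have hs : Summable fun n => catalanCoeff n • R ^ n := (summable_norm_catalan_pow hQ h).of_norm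
    rw [hZ, ← hs.tsum_mul_left, ← hs.tsum_mul_right]
    refine tsum_congr fun n => ?_
    rw [smul_mul_assoc, mul_smul_comm, ← pow_succ, ← pow_succ']
  -- With `W = R Z` this reads `W² = 4(W - R)`, whence `(1 - W/2)² = 1 - R = Q`.
  have h2 : R * Z * (R * Z) = (4 : ℝ) • (R * Z - R) := by
    calc R * Z * (R * Z) = R * (Z * R) * Z := by noncomm_ring
      _ = R * (R * (Z * Z)) := by rw [hcomm]; noncomm_ring
      _ = _ := by rw [hid, mul_smul_comm, mul_sub, mul_one]
  have hQR : Q = 1 - R := by rw [hRdef]; abel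
  rw [hQR, sub_mul, mul_sub, mul_sub, smul_mul_smul_comm, h2]
  simp only [one_mul, mul_one, smul_smul, smul_sub]
  norm_num
  module

theorem isPositive_sqrtSeries {Q : X →L[ℝ] X} (hQ : Q.IsPositive) (h : ‖Q‖ ≤ 1) :
    (sqrtSeries Q).IsPositive := by
  have hR := norm_one_sub_le_one hQ h
  have hs := (summable_norm_catalan_pow hQ h)
  unfold sqrtSeries
  set R := 1 - Q with hRdef
  have hsa : IsSelfAdjoint R := (IsSelfAdjoint.one _).sub hQ.isSelfAdjoint
  have hZeq : R * ∑' n, catalanCoeff n • R ^ n = ∑' n, catalanCoeff n • R ^ (n + 1) := by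
    rw [← hs.of_norm.tsum_mul_left]
    refine tsum_congr fun n => ?_
    rw [mul_smul_comm, pow_succ']
  rw [hZeq]
  have hs' : Summable fun n => catalanCoeff n • R ^ (n + 1) := by
    refine (hs.of_norm.mul_left R).congr fun n => ?_
    rw [mul_smul_comm, pow_succ']
  rw [ContinuousLinearMap.isPositive_def']
  constructor
  · refine (IsSelfAdjoint.one _).sub (IsSelfAdjoint.smul (by simp [IsSelfAdjoint]) ?_)
    rw [IsSelfAdjoint, tsum_star]
    refine tsum_congr fun n => ?_
    rw [star_smul, star_pow, hsa.star_eq, star_trivial]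
  · intro x
    rw [ContinuousLinearMap.reApplyInnerSelf_apply]
    have h1 : (∑' n, catalanCoeff n • R ^ (n + 1)) x = ∑' n, catalanCoeff n • (R ^ (n + 1)) x := by
      exact ((ContinuousLinearMap.apply ℝ X x).map_tsum hs')
    -- The constant `2` cancels the factor `1/2`, so `⟪x - W x / 2, x⟫ ≥ 0`.
    have h3 : ‖∑' n, catalanCoeff n • (R ^ (n + 1)) x‖ ≤ 2 * ‖x‖ := by
      have hb : ∀ n, ‖catalanCoeff n • (R ^ (n + 1)) x‖ ≤ catalanCoeff n * ‖x‖ := by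
        intro n
        rw [norm_smul, Real.norm_of_nonneg (catalanCoeff_nonneg n)]
        refine mul_le_mul_of_nonneg_left ?_ (catalanCoeff_nonneg n)
        have hle : ‖R ^ (n + 1)‖ ≤ 1 :=
          (norm_pow_le' R n.succ_pos).trans (pow_le_one₀ (norm_nonneg _) hR)
        simpa using ((R ^ (n + 1)).le_opNorm x).trans
          (mul_le_mul_of_nonneg_right hle (norm_nonneg x))
      have hsx := summable_catalanCoeff.mul_right ‖x‖
      refine (tsum_of_norm_bounded hsx.hasSum hb).trans ?_
      rw [tsum_mul_right]
      exact mul_le_mul_of_nonneg_right tsum_catalanCoeff_le (norm_nonneg _)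
    have h4 := real_inner_le_norm (∑' n, catalanCoeff n • (R ^ (n + 1)) x) x
    simp only [sub_apply, one_apply_eq_self,
      smul_apply, h1, inner_sub_left, inner_smul_left,
      real_inner_self_eq_norm_sq]
    simp only [one_div, map_inv₀, Real.ringHom_apply, RCLike.re_to_real]
    nlinarith [norm_nonneg x]

theorem exists_sqrt {Q : X →L[ℝ] X} (hQ : Q.IsPositive) :
    ∃ S : X →L[ℝ] X, S.IsPositive ∧ S ∘L S = Q := by
  set c : ℝ := ‖Q‖ + 1
  have hc : 0 < c := by positivity
  have hQ' : (c⁻¹ • Q).IsPositive := hQ.smul_of_nonneg (by positivity)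
  have hn : ‖c⁻¹ • Q‖ ≤ 1 := by
    rw [norm_smul, Real.norm_of_nonneg (by positivity), inv_mul_le_iff₀ hc]
    simp [c]
  refine ⟨√c • sqrtSeries (c⁻¹ • Q), (isPositive_sqrtSeries hQ' hn).smul_of_nonneg
    (Real.sqrt_nonneg _), ?_⟩
  have := sqrtSeries_mul_self hQ' hn
  change (√c • sqrtSeries (c⁻¹ • Q)) * (√c • sqrtSeries (c⁻¹ • Q)) = Q
  rw [smul_mul_smul_comm, this, Real.mul_self_sqrt hc.le, smul_inv_smul₀ hc.ne']

/-- Uniqueness of the root is never needed: later arguments use only positivity and `S² = Q`. -/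
theorem opSqrt_spec {Q : X →L[ℝ] X} (hQ : Q.IsPositive) :
    (opSqrt Q).IsPositive ∧ opSqrt Q ∘L opSqrt Q = Q := by
  have h := exists_sqrt hQ
  unfold opSqrt
  rw [dif_pos h]
  exact h.choose_spec

theorem inner_opSqrt {Q : X →L[ℝ] X} (hQ : Q.IsPositive) (x y : X) :
    ⟪opSqrt Q x, opSqrt Q y⟫ = ⟪Q x, y⟫ := by
  obtain ⟨h1, h2⟩ := opSqrt_spec hQ
  rw [← h1.inner_left_eq_inner_right, ← ContinuousLinearMap.comp_apply, h2]

end SquareRoot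

end OrnsteinUhlenbeck

end

noncomputable section

namespace OrnsteinUhlenbeck

open Filter Topology

/-! ### Strong measurability of vector and operator functions. -/

section Measurability

variable {X : Type*} [NormedAddCommGroup X] [InnerProductSpace ℝ X]

/-- Distinct basis vectors lie at distance `√2`, so balls of radius `1/2` around them are disjoint
open sets in a separable space. -/
theorem countable_of_hilbertBasis [TopologicalSpace.SeparableSpace X] {ι : Type*}
    (b : HilbertBasis ι ℝ X) : Countable ι := by
  have hd : (univ : Set ι).PairwiseDisjoint fun i => Metric.ball (b i) (1 / 2) := by
    intro i _ j _ hij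
    refine Metric.ball_disjoint_ball ?_
    have h : ‖b i - b j‖ ^ 2 = 2 := by
      rw [norm_sub_sq_real, b.orthonormal.1 i, b.orthonormal.1 j, b.orthonormal.2 hij]
      norm_num
    rw [dist_eq_norm]
    nlinarith [norm_nonneg (b i - b j)]
  have := hd.countable_of_isOpen (fun i _ => Metric.isOpen_ball)
    (fun i _ => ⟨b i, Metric.mem_ball_self (by norm_num)⟩)
  exact countable_univ_iff.1 this

variable [CompleteSpace X] [TopologicalSpace.SeparableSpace X]
  {Z : Type*} [MeasurableSpace Z] {μ : Measure Z}

/-- A Pettis-type criterion: the expansion in a countable Hilbert basis is a limit of measurable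
finite sums. -/
theorem aestronglyMeasurable_of_inner {z : Z → X}
    (h : ∀ x, AEStronglyMeasurable (fun a => ⟪x, z a⟫) μ) : AEStronglyMeasurable z μ := by
  obtain ⟨w, b, -⟩ := exists_hilbertBasis ℝ X
  have := countable_of_hilbertBasis b
  refine aestronglyMeasurable_of_tendsto_ae (u := (atTop : Filter (Finset w)))
    (f := fun F a => ∑ i ∈ F, ⟪b i, z a⟫ • b i) (fun F => ?_) (ae_of_all _ fun a => ?_)
  · exact Finset.aestronglyMeasurable_fun_sum _ fun i _ => (h (b i)).smul_const _
  · have := b.hasSum_repr (z a)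
    simpa only [b.repr_apply_apply] using! this

theorem aestronglyMeasurable_adjoint_apply {A : Z → X →L[ℝ] X}
    (hA : ∀ x, AEStronglyMeasurable (fun a => A a x) μ) (x : X) :
    AEStronglyMeasurable (fun a => ContinuousLinearMap.adjoint (A a) x) μ := by
  refine aestronglyMeasurable_of_inner fun y => ?_
  simp_rw [ContinuousLinearMap.adjoint_inner_right]
  exact (hA y).inner aestronglyMeasurable_const

/-- Measurability of `A` is only pointwise on vectors. Passing `A` to the other side of the inner
product leaves a pairing of two measurable vector functions. -/
theorem aestronglyMeasurable_operator_apply {A : Z → X →L[ℝ] X}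
    (hA : ∀ x, AEStronglyMeasurable (fun a => A a x) μ) {z : Z → X}
    (hz : AEStronglyMeasurable z μ) : AEStronglyMeasurable (fun a => A a (z a)) μ := by
  refine aestronglyMeasurable_of_inner fun y => ?_
  simp_rw [← ContinuousLinearMap.adjoint_inner_left]
  exact (aestronglyMeasurable_adjoint_apply hA y).inner hz

/-- Partial sums are polynomials in `Q a`, so measurability passes to the limit. This is what the
explicit series provides beyond mere existence of a root. -/
theorem aestronglyMeasurable_sqrtSeries {Q : Z → X →L[ℝ] X}
    (hQ : ∀ᵐ a ∂μ, (Q a).IsPositive ∧ ‖Q a‖ ≤ 1)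
    (hm : ∀ x, AEStronglyMeasurable (fun a => Q a x) μ) (x : X) :
    AEStronglyMeasurable (fun a => sqrtSeries (Q a) x) μ := by
  have hR : ∀ x, AEStronglyMeasurable (fun a => (1 - Q a) x) μ := fun x =>
    (aestronglyMeasurable_const (b := x)).sub (hm x)
  have hpow : ∀ (n : ℕ) x, AEStronglyMeasurable (fun a => ((1 - Q a) ^ n) x) μ := by
    intro n
    induction n with
    | zero => intro x; simpa using aestronglyMeasurable_const
    | succ n ih =>
      intro x
      simp_rw [pow_succ']
      exact aestronglyMeasurable_operator_apply hR (ih x)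
  have hZ : AEStronglyMeasurable (fun a => (∑' n, catalanCoeff n • (1 - Q a) ^ n) x) μ := by
    refine aestronglyMeasurable_of_tendsto_ae (u := atTop)
      (f := fun N a => ∑ n ∈ Finset.range N, catalanCoeff n • ((1 - Q a) ^ n) x)
      (fun N => Finset.aestronglyMeasurable_fun_sum _ fun n _ => (hpow n x).const_smul _) ?_
    filter_upwards [hQ] with a ha
    have hs := (summable_norm_catalan_pow ha.1 ha.2).of_norm.hasSum.tendsto_sum_nat
    have := ((ContinuousLinearMap.apply ℝ X x).continuous.tendsto _).comp hs
    refine this.congr fun N => ?_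
    simp
  unfold sqrtSeries
  simp only [sub_apply, one_apply_eq_self, smul_apply]
  exact aestronglyMeasurable_const.sub
    ((aestronglyMeasurable_operator_apply hR hZ).const_smul _)

end Measurability

/-! ### Characteristic functions and existence of Gaussian measures. -/

section GaussianLaws

variable {X : Type*} [NormedAddCommGroup X] [InnerProductSpace ℝ X] [CompleteSpace X]
  [TopologicalSpace.SeparableSpace X] [MeasurableSpace X] [BorelSpace X]

local instance secondCountable_of_separableSpace : SecondCountableTopology X :=
  UniformSpace.secondCountable_of_separable X

theorem isGaussianLaw_of_charFun {m : X} {Q : X →L[ℝ] X} (hQ : Q.IsPositive) {μ : Measure X}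
    [IsFiniteMeasure μ]
    (h : ∀ k, charFun μ k = Complex.exp (⟪k, m⟫ * Complex.I - ⟪Q k, k⟫ / 2)) :
    IsGaussianLaw m Q μ := by
  set f : X →L[ℝ] X →L[ℝ] ℝ := (innerSL ℝ).comp Q with hfdef
  have hf : f.toBilinForm.IsPosSemidef := by
    refine ⟨⟨fun x y => ?_⟩, ⟨fun x => ?_⟩⟩
    · simp only [hfdef, ContinuousLinearMap.toBilinForm_apply, ContinuousLinearMap.comp_apply,
        innerSL_apply_apply]
      rw [hQ.inner_left_eq_inner_right, real_inner_comm]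
    · simpa [hfdef] using! hQ.inner_nonneg_left x
  have h' : ∀ k, charFun μ k = Complex.exp (⟪k, m⟫ * Complex.I - f k k / 2) := by
    intro k; rw [h k]; rfl
  have hg : IsGaussian μ := isGaussian_iff_gaussian_charFun.2 ⟨m, f, hf, h'⟩
  obtain ⟨h1, h2⟩ := gaussian_charFun_congr m f hf h'
  exact ⟨hg, h1.symm, fun x y => by rw [← h2]; rfl⟩

theorem IsGaussianLaw.charFun_eq {m : X} {Q : X →L[ℝ] X} {μ : Measure X}
    (h : IsGaussianLaw m Q μ) (k : X) :
    charFun μ k = Complex.exp (⟪k, m⟫ * Complex.I - ⟪Q k, k⟫ / 2) := by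
  obtain ⟨hg, hm, hc⟩ := h
  rw [IsGaussian.charFun_eq', hc]
  simp [hm]

/-- Identities between Gaussian measures below reduce to this: it is enough to match mean and
covariance. -/
theorem IsGaussianLaw.unique {m : X} {Q : X →L[ℝ] X} {μ ν : Measure X}
    (h : IsGaussianLaw m Q μ) (h' : IsGaussianLaw m Q ν) : μ = ν := by
  have := h.1
  have := h'.1
  refine Measure.ext_of_charFun ?_
  ext k
  rw [h.charFun_eq, h'.charFun_eq]

/-- The law of a sequence of independent standard Gaussian variables. -/
def stdGaussianSeq (ι : Type*) : Measure (ι → ℝ) :=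
  Measure.infinitePi fun _ => gaussianReal 0 1

instance (ι : Type*) : IsProbabilityMeasure (stdGaussianSeq ι) := by
  unfold stdGaussianSeq; infer_instance

theorem measurePreserving_eval_stdGaussianSeq {ι : Type*} (i : ι) :
    MeasurePreserving (fun ω : ι → ℝ => ω i) (stdGaussianSeq ι) (gaussianReal 0 1) :=
  measurePreserving_eval_infinitePi (fun _ : ι => gaussianReal 0 1) i

theorem integral_eval_stdGaussianSeq {ι E : Type*} [NormedAddCommGroup E] [NormedSpace ℝ E]
    (i : ι) {f : ℝ → E} (hf : Continuous f) :
    ∫ ω : ι → ℝ, f (ω i) ∂(stdGaussianSeq ι) = ∫ x, f x ∂(gaussianReal 0 1) := by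
  have hp := measurePreserving_eval_stdGaussianSeq i
  rw [← hp.map_eq, integral_map hp.measurable.aemeasurable hf.aestronglyMeasurable]

theorem iIndepFun_stdGaussianSeq (ι : Type*) :
    iIndepFun (fun (i : ι) (ω : ι → ℝ) => ω i) (stdGaussianSeq ι) :=
  iIndepFun_infinitePi (P := fun _ : ι => gaussianReal 0 1)
    (X := fun _ x => x) (fun _ => measurable_id)

theorem memLp_eval_smul_stdGaussianSeq {ι : Type*} (i : ι) (x : X) :
    MemLp (fun ω : ι → ℝ => ω i • x) 2 (stdGaussianSeq ι) := by
  have h : MemLp (fun ω : ι → ℝ => ω i) 2 (stdGaussianSeq ι) :=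
    (memLp_id_gaussianReal 2).comp_measurePreserving (measurePreserving_eval_stdGaussianSeq i)
  refine h.of_le_mul (c := ‖x‖) (h.1.smul_const x) (ae_of_all _ fun ω => ?_)
  rw [norm_smul, mul_comm]

theorem integral_eval_sq_stdGaussianSeq {ι : Type*} (i : ι) :
    ∫ ω : ι → ℝ, ω i * ω i ∂(stdGaussianSeq ι) = 1 := by
  rw [integral_eval_stdGaussianSeq i (f := fun x => x * x) (by fun_prop)]
  have h3 := variance_eq_integral (μ := gaussianReal 0 1) (X := id) aemeasurable_id
  rw [variance_id_gaussianReal] at h3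
  simp only [id, integral_id_gaussianReal, sub_zero] at h3
  simp_rw [← sq]
  rw [← h3]; simp

theorem integral_eval_mul_eval_stdGaussianSeq {ι : Type*} {i j : ι} (hij : i ≠ j) :
    ∫ ω : ι → ℝ, ω i * ω j ∂(stdGaussianSeq ι) = 0 := by
  rw [((iIndepFun_stdGaussianSeq ι).indepFun hij).integral_fun_mul_eq_mul_integral
    (measurable_pi_apply i).aestronglyMeasurable (measurable_pi_apply j).aestronglyMeasurable,
    integral_eval_stdGaussianSeq i (f := fun x => x) continuous_id, integral_id_gaussianReal,
    zero_mul]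

theorem charFun_gaussianSum {ι : Type*} (F : Finset ι) (a : ι → X) (k : X) :
    ∫ ω : ι → ℝ, Complex.exp (⟪∑ i ∈ F, ω i • a i, k⟫ * Complex.I) ∂(stdGaussianSeq ι) =
      Complex.exp (-(∑ i ∈ F, ⟪a i, k⟫ ^ 2 : ℝ) / 2) := by
  have h' : iIndepFun (fun (i : F) (ω : ι → ℝ) => ω i) (stdGaussianSeq ι) :=
    (iIndepFun_stdGaussianSeq ι).precomp (g := ((↑) : F → ι)) Subtype.val_injective
  have h1 := h'.integral_fun_prod_comp
    (f := fun (i : F) x => Complex.exp ((⟪a i, k⟫ * x : ℝ) * Complex.I))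
    (fun i => (measurable_pi_apply i.1).aemeasurable)
    (fun i => Continuous.aestronglyMeasurable (by fun_prop))
  have h2 : ∀ ω : ι → ℝ, Complex.exp (⟪∑ i ∈ F, ω i • a i, k⟫ * Complex.I) =
      ∏ i : F, Complex.exp ((⟪a i, k⟫ * ω i : ℝ) * Complex.I) := by
    intro ω
    rw [← Complex.exp_sum, sum_inner, ← Finset.sum_coe_sort]
    push_cast
    rw [Finset.sum_mul]
    simp only [inner_smul_left]
    congr 1
    refine Finset.sum_congr rfl fun i _ => ?_
    simp [mul_comm]
  simp_rw [h2]
  rw [h1]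
  have h3 : ∀ i : F, ∫ ω : ι → ℝ, Complex.exp ((⟪a i, k⟫ * ω i : ℝ) * Complex.I)
      ∂(stdGaussianSeq ι) = Complex.exp (-(⟪a i, k⟫ ^ 2 : ℝ) / 2) := by
    intro i
    rw [integral_eval_stdGaussianSeq i.1
      (f := fun x : ℝ => Complex.exp ((⟪a i, k⟫ * x : ℝ) * Complex.I)) (by fun_prop)]
    have := charFun_gaussianReal (μ := 0) (v := 1) ⟪a i, k⟫
    rw [charFun_apply_real] at this
    simp only [Complex.ofReal_mul]
    rw [this]
    push_cast
    congr 1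
    ring
  rw [Finset.prod_congr rfl fun i _ => h3 i, ← Complex.exp_sum, ← Finset.sum_coe_sort F]
  congr 1
  push_cast
  rw [← Finset.sum_neg_distrib, Finset.sum_div]

/-- The isometry `x ↦ ξᵢ x` of `X` into `L²`, with `ξᵢ` the `i`-th standard Gaussian variable. -/
def gaussianCoord {ι : Type*} (i : ι) : X →ₗᵢ[ℝ] Lp X 2 (stdGaussianSeq ι) where
  toFun x := (memLp_eval_smul_stdGaussianSeq i x).toLp
  map_add' x y := by
    rw [← MemLp.toLp_add]
    congr 1
    ext ω
    simp
  map_smul' c x := by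
    rw [RingHom.id_apply, ← MemLp.toLp_const_smul]
    congr 1
    ext ω
    exact smul_comm _ _ _
  norm_map' x := by
    simp only [LinearMap.coe_mk, AddHom.coe_mk]
    rw [← sq_eq_sq₀ (norm_nonneg _) (norm_nonneg _), ← real_inner_self_eq_norm_sq, L2.inner_def]
    have : ∀ᵐ ω ∂(stdGaussianSeq ι),
        ⟪(memLp_eval_smul_stdGaussianSeq i x).toLp _ ω,
          (memLp_eval_smul_stdGaussianSeq i x).toLp _ ω⟫ = (ω i * ω i) * ‖x‖ ^ 2 := by
      filter_upwards [MemLp.coeFn_toLp (memLp_eval_smul_stdGaussianSeq i x)] with ω hω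
      rw [hω, inner_smul_left, inner_smul_right, real_inner_self_eq_norm_sq]
      simp [mul_assoc]
    rw [integral_congr_ae this, integral_mul_const, integral_eval_sq_stdGaussianSeq, one_mul]

theorem gaussianCoord_ae {ι : Type*} (i : ι) (x : X) :
    (gaussianCoord i x : (ι → ℝ) → X) =ᵐ[stdGaussianSeq ι] fun ω => ω i • x :=
  MemLp.coeFn_toLp (memLp_eval_smul_stdGaussianSeq i x)

theorem orthogonalFamily_gaussianCoord (ι : Type*) :
    OrthogonalFamily ℝ (fun _ : ι => X) fun i => gaussianCoord (X := X) i := by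
  intro i j hij x y
  rw [L2.inner_def]
  have : ∀ᵐ ω ∂(stdGaussianSeq ι), ⟪gaussianCoord i x ω, gaussianCoord j y ω⟫ =
      (ω i * ω j) * ⟪x, y⟫ := by
    filter_upwards [gaussianCoord_ae i x, gaussianCoord_ae j y] with ω h1 h2
    rw [h1, h2, inner_smul_left, inner_smul_right]
    simp [mul_assoc]
  rw [integral_congr_ae this, integral_mul_const, integral_eval_mul_eval_stdGaussianSeq hij,
    zero_mul]

/-- Gaussian measures exist, as limits of the laws of finite sums `∑ ξᵢ S bᵢ` with `S² = Q`. -/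
theorem exists_isGaussianLaw_tendsto {ι : Type*} [Countable ι] (b : HilbertBasis ι ℝ X)
    {Q S : X →L[ℝ] X} (hS : S.IsPositive) (hSQ : S ∘L S = Q)
    (htr : Summable fun i => ⟪Q (b i), b i⟫) :
    ∃ μ : Measure X, IsGaussianLaw 0 Q μ ∧ ∀ φ : BoundedContinuousFunction X ℝ,
      Tendsto (fun F : Finset ι => ∫ ω, φ (∑ i ∈ F, ω i • S (b i)) ∂(stdGaussianSeq ι)) atTop
        (𝓝 (∫ y, φ y ∂μ)) := by
  have hSS : ∀ x y, ⟪S x, S y⟫ = ⟪Q x, y⟫ := fun x y => by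
    rw [← hS.inner_left_eq_inner_right, ← hSQ, ContinuousLinearMap.comp_apply]
  have hQ : Q.IsPositive := by
    refine ContinuousLinearMap.isPositive_def'.2 ⟨?_, fun x => ?_⟩
    · rw [← hSQ]
      exact (hS.isSelfAdjoint.commute_iff hS.isSelfAdjoint).1 (Commute.refl S)
    · rw [ContinuousLinearMap.reApplyInnerSelf_apply, ← hSS]
      exact real_inner_self_nonneg
  -- In `L²` the terms are orthogonal, with squared norms `‖S bᵢ‖² = ⟪Q bᵢ, bᵢ⟫`; finite trace is
  -- exactly summability.
  have hsum : Summable fun i => gaussianCoord (X := X) i (S (b i)) := by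
    rw [(orthogonalFamily_gaussianCoord ι).summable_iff_norm_sq_summable]
    refine htr.congr fun i => ?_
    rw [← hSS, real_inner_self_eq_norm_sq]
  set Y : Lp X 2 (stdGaussianSeq ι) := ∑' i, gaussianCoord (X := X) i (S (b i)) with hY
  have hYm : AEMeasurable (Y : (ι → ℝ) → X) (stdGaussianSeq ι) :=
    (Lp.aestronglyMeasurable Y).aemeasurable
  have htend : Tendsto (fun F : Finset ι => ∑ i ∈ F, gaussianCoord (X := X) i (S (b i))) atTop
      (𝓝 Y) := hsum.hasSum
  have hpart : ∀ F : Finset ι,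
      ((∑ i ∈ F, gaussianCoord (X := X) i (S (b i)) : Lp X 2 (stdGaussianSeq ι)) : (ι → ℝ) → X)
        =ᵐ[stdGaussianSeq ι] fun ω => ∑ i ∈ F, ω i • S (b i) := by
    intro F
    refine (Lp.coeFn_finsetSum _ _).trans ?_
    filter_upwards [(ae_ball_iff F.countable_toSet).2 fun i (_ : i ∈ (F : Set ι)) =>
      gaussianCoord_ae i (S (b i))] with ω hω
    rw [Finset.sum_apply]
    exact Finset.sum_congr rfl fun i hi => hω i hi
  -- Convergence in `L²` gives convergence in distribution, which yields both the characteristic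
  -- function of the limit and the convergence of integrals.
  have hd := (tendstoInMeasure_of_tendsto_Lp htend).tendstoInDistribution
    fun F => (Lp.aestronglyMeasurable _).aemeasurable
  have hlim := ProbabilityMeasure.tendsto_iff_forall_integral_rclike_tendsto ℂ |>.1 hd.tendsto
  have hlimR := ProbabilityMeasure.tendsto_iff_forall_integral_tendsto.1 hd.tendsto
  refine ⟨(stdGaussianSeq ι).map Y, ?_, fun φ => ?_⟩
  · have hprob : IsProbabilityMeasure ((stdGaussianSeq ι).map Y) :=
      Measure.isProbabilityMeasure_map hYm
    refine isGaussianLaw_of_charFun hQ fun k => ?_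
    have h1 := hlim (BoundedContinuousFunction.innerProbChar k)
    simp only [ProbabilityMeasure.coe_mk] at h1
    have h2 : charFun ((stdGaussianSeq ι).map Y) k =
        ∫ y, BoundedContinuousFunction.innerProbChar k y ∂((stdGaussianSeq ι).map Y) :=
      charFun_eq_integral_innerProbChar
    rw [h2]
    refine tendsto_nhds_unique h1 ?_
    have h3 : ∀ F : Finset ι, ∫ y, BoundedContinuousFunction.innerProbChar k y
        ∂((stdGaussianSeq ι).map
          (∑ i ∈ F, gaussianCoord (X := X) i (S (b i)) : Lp X 2 (stdGaussianSeq ι))) =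
        Complex.exp (-(∑ i ∈ F, ⟪S (b i), k⟫ ^ 2 : ℝ) / 2) := by
      intro F
      rw [integral_map (Lp.aestronglyMeasurable _).aemeasurable
        (Continuous.aestronglyMeasurable (by fun_prop)), ← charFun_gaussianSum]
      refine integral_congr_ae ?_
      filter_upwards [hpart F] with ω hω
      rw [hω, BoundedContinuousFunction.innerProbChar_apply]
    simp_rw [h3]
    -- Parseval for `S k`, with `‖S k‖² = ⟪Q k, k⟫`.
    have h4 : HasSum (fun i => ⟪S (b i), k⟫ ^ 2) ⟪Q k, k⟫ := by
      have := b.hasSum_inner_mul_inner (S k) (S k)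
      rw [hSS] at this
      refine this.congr_fun fun i => ?_
      rw [hS.inner_left_eq_inner_right, real_inner_comm (S k) (b i), sq]
    have hc : Continuous fun r : ℝ => Complex.exp (-(r : ℂ) / 2) := by fun_prop
    have h5 := (hc.tendsto ⟪Q k, k⟫).comp h4
    convert! h5 using 2
    simp only [inner_zero_right]
    push_cast
    ring_nf
  · have h1 := hlimR φ
    refine h1.congr fun F => ?_
    simp only [ProbabilityMeasure.coe_mk]
    rw [integral_map (Lp.aestronglyMeasurable _).aemeasurable
        (Continuous.aestronglyMeasurable (by fun_prop))]
    refine integral_congr_ae ?_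
    filter_upwards [hpart F] with ω hω
    rw [hω]

end GaussianLaws

end OrnsteinUhlenbeck

end

noncomputable section

namespace OrnsteinUhlenbeck

open Filter Topology

/-! ### Traces, second moments and images of Gaussian measures. -/

section TraceClass

variable {X : Type*} [NormedAddCommGroup X] [InnerProductSpace ℝ X]

theorem IsPositiveTraceClass.of_le {Q Q' : X →L[ℝ] X} (hQ : IsPositiveTraceClass Q)
    (hQ' : Q'.IsPositive) (h : ∀ x, ⟪Q' x, x⟫ ≤ ⟪Q x, x⟫) : IsPositiveTraceClass Q' := by
  obtain ⟨-, w, b, hb⟩ := hQ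
  exact ⟨hQ', w, b, hb.of_nonneg_of_le (fun i => hQ'.inner_nonneg_left _) fun i => h _⟩

end TraceClass

section GaussianLaws

variable {X : Type*} [NormedAddCommGroup X] [InnerProductSpace ℝ X] [CompleteSpace X]
  [TopologicalSpace.SeparableSpace X] [MeasurableSpace X] [BorelSpace X]

theorem IsGaussianLaw.isProbabilityMeasure {m : X} {Q : X →L[ℝ] X} {μ : Measure X}
    (h : IsGaussianLaw m Q μ) : IsProbabilityMeasure μ := by
  have := h.1
  infer_instance

theorem IsGaussianLaw.memLp_sub {m : X} {Q : X →L[ℝ] X} {μ : Measure X}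
    (h : IsGaussianLaw m Q μ) : MemLp (fun y => y - m) 2 μ := by
  have := h.1
  exact IsGaussian.memLp_two_id.sub (memLp_const m)

theorem IsGaussianLaw.integral_inner_sq {m : X} {Q : X →L[ℝ] X} {μ : Measure X}
    (h : IsGaussianLaw m Q μ) (x : X) : ∫ y, ⟪x, y - m⟫ ^ 2 ∂μ = ⟪Q x, x⟫ := by
  have := h.1
  rw [← h.2.2, covarianceBilin_apply IsGaussian.memLp_two_id]
  have : μ[id] = m := h.2.1
  simp_rw [this, ← sq]

/-- Parseval for `L (y - m)` integrated termwise: the second moment is the trace of `L Q L*`, in any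
basis. It later measures how far a Gaussian law spreads over a short time. -/
theorem IsGaussianLaw.hasSum_integral_norm_sq {m : X} {Q : X →L[ℝ] X} {μ : Measure X}
    (h : IsGaussianLaw m Q μ) (L : X →L[ℝ] X) {ι : Type*} (b : HilbertBasis ι ℝ X) :
    HasSum (fun i => ⟪Q (ContinuousLinearMap.adjoint L (b i)), ContinuousLinearMap.adjoint L (b i)⟫)
      (∫ y, ‖L (y - m)‖ ^ 2 ∂μ) := by
  have := h.isProbabilityMeasure
  have := countable_of_hilbertBasis b
  have hmem : MemLp (fun y => L (y - m)) 2 μ := L.comp_memLp' h.memLp_sub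
  have hint : ∀ i, Integrable (fun y => ⟪b i, L (y - m)⟫ ^ 2) μ := fun i =>
    (hmem.const_inner (b i)).integrable_sq
  have hnorm : Integrable (fun y => ‖L (y - m)‖ ^ 2) μ := hmem.norm.integrable_sq
  have hsum : Summable fun i => ∫ y, ⟪b i, L (y - m)⟫ ^ 2 ∂μ := by
    refine summable_of_sum_le (c := ∫ y, ‖L (y - m)‖ ^ 2 ∂μ)
      (fun i => integral_nonneg fun y => sq_nonneg _) fun F => ?_
    rw [← integral_finsetSum _ fun i _ => hint i]
    refine integral_mono (integrable_finsetSum _ fun i _ => hint i) hnorm fun y => ?_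
    have := b.orthonormal.sum_inner_products_le (L (y - m)) (s := F)
    simpa using this
  have h1 := hasSum_integral_of_summable_integral_norm hint (by simpa using hsum)
  have h3 : ∀ i, ∫ y, ⟪b i, L (y - m)⟫ ^ 2 ∂μ =
      ⟪Q (ContinuousLinearMap.adjoint L (b i)), ContinuousLinearMap.adjoint L (b i)⟫ := by
    intro i
    rw [← h.integral_inner_sq]
    simp_rw [ContinuousLinearMap.adjoint_inner_left]
  simp_rw [h3] at h1
  convert! h1 using 1
  refine integral_congr_ae (ae_of_all _ fun y => ?_)
  have h2 := b.hasSum_inner_mul_inner (L (y - m)) (L (y - m))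
  rw [real_inner_self_eq_norm_sq] at h2
  dsimp only
  rw [← h2.tsum_eq]
  refine tsum_congr fun i => ?_
  rw [real_inner_comm (b i) (L (y - m)), sq]

theorem IsGaussianLaw.map_const_add {m : X} {Q : X →L[ℝ] X} {μ : Measure X}
    (h : IsGaussianLaw m Q μ) (a : X) : IsGaussianLaw (a + m) Q (μ.map (a + ·)) := by
  have := h.1
  refine ⟨inferInstance, ?_, ?_⟩
  · rw [integral_map (by fun_prop) (by fun_prop)]
    have hi : Integrable (fun x : X => x) μ := IsGaussian.integrable_id
    rw [integral_add (integrable_const _) hi]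
    simp [h.2.1]
  · rw [covarianceBilin_map_const_add]
    exact h.2.2

theorem exists_isGaussianLaw (m : X) {Q : X →L[ℝ] X} (hQ : IsPositiveTraceClass Q) :
    ∃ μ : Measure X, IsGaussianLaw m Q μ := by
  obtain ⟨hQ, w, b, hb⟩ := hQ
  have := countable_of_hilbertBasis b
  obtain ⟨hS, hSQ⟩ := opSqrt_spec hQ
  obtain ⟨μ, hμ, -⟩ := exists_isGaussianLaw_tendsto b hS hSQ hb
  exact ⟨_, by simpa using hμ.map_const_add m⟩

theorem gaussianMeasure_spec (m : X) {Q : X →L[ℝ] X} (hQ : IsPositiveTraceClass Q) :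
    IsGaussianLaw m Q (gaussianMeasure m Q) := by
  have h := exists_isGaussianLaw m hQ
  unfold gaussianMeasure
  rw [dif_pos h]
  exact h.choose_spec

theorem gaussianMeasure_eq_map (m : X) {Q : X →L[ℝ] X} (hQ : IsPositiveTraceClass Q) :
    gaussianMeasure m Q = (gaussianMeasure 0 Q).map (m + ·) := by
  refine (gaussianMeasure_spec m hQ).unique ?_
  simpa using (gaussianMeasure_spec 0 hQ).map_const_add m

/-- The definition supplies a single basis. The Gaussian second moment is finite and equals the
diagonal sum in every basis. -/
theorem IsPositiveTraceClass.summable {Q : X →L[ℝ] X} (hQ : IsPositiveTraceClass Q)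
    {ι : Type*} (b : HilbertBasis ι ℝ X) : Summable fun i => ⟪Q (b i), b i⟫ :=
  have h := ((gaussianMeasure_spec 0 hQ).hasSum_integral_norm_sq
    (ContinuousLinearMap.id ℝ X) b).summable
  by simpa only [ContinuousLinearMap.adjoint_id, ContinuousLinearMap.id_apply] using h

/-- Characteristic functions of independent summands multiply. This is the probabilistic content of
Chapman-Kolmogorov. -/
theorem IsGaussianLaw.isGaussianLaw_map_add {m₁ m₂ : X} {Q₁ Q₂ : X →L[ℝ] X} {μ₁ μ₂ : Measure X}
    (h₁ : IsGaussianLaw m₁ Q₁ μ₁) (h₂ : IsGaussianLaw m₂ Q₂ μ₂) (hQ₁ : Q₁.IsPositive)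
    (hQ₂ : Q₂.IsPositive) (L : X →L[ℝ] X) :
    IsGaussianLaw (L m₁ + m₂) (L ∘L Q₁ ∘L ContinuousLinearMap.adjoint L + Q₂)
      ((μ₁.prod μ₂).map fun p => L p.1 + p.2) := by
  have := h₁.isProbabilityMeasure
  have := h₂.isProbabilityMeasure
  have hm : Measurable fun p : X × X => L p.1 + p.2 := by fun_prop
  have : IsProbabilityMeasure ((μ₁.prod μ₂).map fun p => L p.1 + p.2) :=
    Measure.isProbabilityMeasure_map hm.aemeasurable
  refine isGaussianLaw_of_charFun ((hQ₁.conj_adjoint L).add hQ₂) fun k => ?_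
  rw [charFun_apply, integral_map hm.aemeasurable
    (Continuous.aestronglyMeasurable (by fun_prop))]
  have h : ∀ p : X × X, Complex.exp (⟪L p.1 + p.2, k⟫ * Complex.I) =
      Complex.exp (⟪p.1, ContinuousLinearMap.adjoint L k⟫ * Complex.I) *
        Complex.exp (⟪p.2, k⟫ * Complex.I) := by
    intro p
    rw [← Complex.exp_add, inner_add_left, ContinuousLinearMap.adjoint_inner_right]
    push_cast
    ring_nf
  simp_rw [h]
  rw [integral_prod_mul (f := fun y => Complex.exp (⟪y, ContinuousLinearMap.adjoint L k⟫ *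
    Complex.I)) (g := fun y => Complex.exp (⟪y, k⟫ * Complex.I)), ← charFun_apply,
    ← charFun_apply, h₁.charFun_eq, h₂.charFun_eq, ← Complex.exp_add]
  congr 1
  simp only [ContinuousLinearMap.adjoint_inner_left, inner_add_right, inner_add_left, add_apply,
    ContinuousLinearMap.comp_apply, ← ContinuousLinearMap.adjoint_inner_right L]
  push_cast
  ring

/-- Only quadratic forms enter the characteristic function, so a rank-one change of covariance is an
independent scalar Gaussian along `v`. It serves to split off a direction. -/
theorem IsGaussianLaw.isGaussianLaw_map_add_smul {m : X} {Q Q' : X →L[ℝ] X} {μ : Measure X}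
    (h : IsGaussianLaw m Q μ) (hQ' : Q'.IsPositive) (v : X)
    (hQ : ∀ x, ⟪Q' x, x⟫ = ⟪Q x, x⟫ + ⟪v, x⟫ ^ 2) :
    IsGaussianLaw m Q' ((μ.prod (gaussianReal 0 1)).map fun p => p.1 + p.2 • v) := by
  have := h.isProbabilityMeasure
  have hm : Measurable fun p : X × ℝ => p.1 + p.2 • v := by fun_prop
  have : IsProbabilityMeasure ((μ.prod (gaussianReal 0 1)).map fun p => p.1 + p.2 • v) :=
    Measure.isProbabilityMeasure_map hm.aemeasurable
  refine isGaussianLaw_of_charFun hQ' fun k => ?_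
  rw [charFun_apply, integral_map hm.aemeasurable
    (Continuous.aestronglyMeasurable (by fun_prop))]
  have h' : ∀ p : X × ℝ, Complex.exp (⟪p.1 + p.2 • v, k⟫ * Complex.I) =
      Complex.exp (⟪p.1, k⟫ * Complex.I) *
        Complex.exp (⟪v, k⟫ * p.2 * Complex.I) := by
    intro p
    rw [← Complex.exp_add, inner_add_left, inner_smul_left]
    push_cast
    congr 1
    simp
    ring
  simp_rw [h']
  rw [integral_prod_mul (f := fun y => Complex.exp (⟪y, k⟫ *
    Complex.I)) (g := fun y : ℝ => Complex.exp (⟪v, k⟫ * y * Complex.I)), ← charFun_apply,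
    ← charFun_apply_real, h.charFun_eq, charFun_gaussianReal, ← Complex.exp_add, hQ]
  congr 1
  push_cast
  ring

/-- Integrals against Gaussian measures depend measurably on the mean and the covariance. -/
theorem aestronglyMeasurable_integral_gaussianMeasure {Z : Type*} [MeasurableSpace Z]
    {μ : Measure Z} [SFinite μ] {Ψ : ℝ × X → ℝ} (hΨ : Continuous Ψ) {K : ℝ} (hK : ∀ p, |Ψ p| ≤ K)
    {c : Z → ℝ} (hc : AEStronglyMeasurable c μ) {a : Z → X} (ha : AEStronglyMeasurable a μ)
    {Q : Z → X →L[ℝ] X} (hQm : ∀ x, AEStronglyMeasurable (fun z => Q z x) μ) {M : ℝ}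
    (hQ : ∀ᵐ z ∂μ, IsPositiveTraceClass (Q z) ∧ ‖Q z‖ ≤ M) :
    AEStronglyMeasurable (fun z => ∫ y, Ψ (c z, y) ∂(gaussianMeasure (a z) (Q z))) μ := by
  obtain ⟨w, b, -⟩ := exists_hilbertBasis ℝ X
  have := countable_of_hilbertBasis b
  -- A single scaling puts almost every `Q z` in the unit ball, where the series converges; the root
  -- `S z` need not be the chosen `opSqrt (Q z)`.
  set κ : ℝ := |M| + 1
  have hκ : 0 < κ := by positivity
  have hQ' : ∀ᵐ z ∂μ, (κ⁻¹ • Q z).IsPositive ∧ ‖κ⁻¹ • Q z‖ ≤ 1 := by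
    filter_upwards [hQ] with z hz
    refine ⟨hz.1.1.smul_of_nonneg (by positivity), ?_⟩
    rw [norm_smul, Real.norm_of_nonneg (by positivity), inv_mul_le_iff₀ hκ]
    linarith [le_abs_self M, hz.2]
  set S : Z → X →L[ℝ] X := fun z => √κ • sqrtSeries (κ⁻¹ • Q z) with hSdef
  have hSm : ∀ x, AEStronglyMeasurable (fun z => S z x) μ := fun x =>
    (aestronglyMeasurable_sqrtSeries hQ' (fun x => (hQm x).const_smul _) x).const_smul _
  have hS : ∀ᵐ z ∂μ, (S z).IsPositive ∧ S z ∘L S z = Q z := by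
    filter_upwards [hQ'] with z hz
    refine ⟨(isPositive_sqrtSeries hz.1 hz.2).smul_of_nonneg (Real.sqrt_nonneg _), ?_⟩
    have := sqrtSeries_mul_self hz.1 hz.2
    change (√κ • sqrtSeries (κ⁻¹ • Q z)) * (√κ • sqrtSeries (κ⁻¹ • Q z)) = Q z
    rw [smul_mul_smul_comm, this, Real.mul_self_sqrt hκ.le, smul_inv_smul₀ hκ.ne']
  refine aestronglyMeasurable_of_tendsto_ae (u := (atTop : Filter (Finset w)))
    (f := fun F z => ∫ ω, Ψ (c z, a z + ∑ i ∈ F, ω i • S z (b i)) ∂(stdGaussianSeq w))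
    (fun F => ?_) ?_
  · refine AEStronglyMeasurable.integral_prod_right'
      (f := fun p : Z × (w → ℝ) => Ψ (c p.1, a p.1 + ∑ i ∈ F, p.2 i • S p.1 (b i))) ?_
    refine hΨ.comp_aestronglyMeasurable (hc.comp_fst.prodMk (ha.comp_fst.add ?_))
    refine Finset.aestronglyMeasurable_fun_sum _ fun i _ => ?_
    exact ((measurable_pi_apply i).comp measurable_snd).aestronglyMeasurable.smul
      (hSm (b i)).comp_fst
  · filter_upwards [hQ, hS] with z hz hSz
    -- The limit law built from `S z` coincides with the chosen Gaussian measure, because the law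
    -- depends on `Q z` alone.
    obtain ⟨ν, hν, hlim⟩ := exists_isGaussianLaw_tendsto b hSz.1 hSz.2 (hz.1.summable b)
    have h1 : gaussianMeasure (a z) (Q z) = ν.map (a z + ·) :=
      (gaussianMeasure_spec _ hz.1).unique (by simpa using hν.map_const_add (a z))
    have hcont : Continuous fun y => Ψ (c z, a z + y) := by fun_prop
    have h2 := hlim (BoundedContinuousFunction.ofNormedAddCommGroup _ hcont K fun y => hK _)
    rw [h1, integral_map (by fun_prop) (Continuous.aestronglyMeasurable (by fun_prop))]
    exact h2

end GaussianLaws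

end OrnsteinUhlenbeck

end

noncomputable section

namespace OrnsteinUhlenbeck

open Filter Topology

/-! ### Integration by parts for the standard Gaussian on the line. -/

section OneDimensional

variable {E : Type*} [NormedAddCommGroup E] [NormedSpace ℝ E]

/-- Translating the density moves `r` from `k`, which need not be differentiable, to a smooth
weight. -/
theorem integral_gaussianReal_comp_add (k : ℝ → E) (r : ℝ) :
    ∫ τ, k (τ + r) ∂(gaussianReal 0 1) =
      ∫ τ, Real.exp (r * τ - r ^ 2 / 2) • k τ ∂(gaussianReal 0 1) := by
  rw [integral_gaussianReal_eq_integral_smul one_ne_zero,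
    integral_gaussianReal_eq_integral_smul one_ne_zero,
    ← integral_sub_right_eq_self (fun τ => gaussianPDFReal 0 1 τ • k (τ + r)) r]
  refine integral_congr_ae (ae_of_all _ fun τ => ?_)
  simp only [sub_add_cancel, smul_smul, gaussianPDFReal_def]
  congr 1
  rw [mul_assoc (√_)⁻¹, ← Real.exp_add]
  congr 2
  simp only [NNReal.coe_one]
  ring

theorem hasDerivAt_integral_gaussianReal {k : ℝ → E} (hk : Continuous k) {K : ℝ}
    (hK : ∀ τ, ‖k τ‖ ≤ K) :
    HasDerivAt (fun r => ∫ τ, k (τ + r) ∂(gaussianReal 0 1))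
      (∫ τ, τ • k τ ∂(gaussianReal 0 1)) 0 := by
  have hK0 : 0 ≤ K := (norm_nonneg _).trans (hK 0)
  simp_rw [integral_gaussianReal_comp_add k]
  have hexp : ∀ c : ℝ, Integrable (fun τ => Real.exp (c * τ)) (gaussianReal 0 1) :=
    fun c => integrable_exp_mul_gaussianReal c
  have h := hasDerivAt_integral_of_dominated_loc_of_deriv_le (μ := gaussianReal 0 1)
    (F := fun (r : ℝ) τ => Real.exp (r * τ - r ^ 2 / 2) • k τ)
    (F' := fun r τ => (Real.exp (r * τ - r ^ 2 / 2) * (τ - r)) • k τ) (x₀ := (0 : ℝ))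
    (s := Metric.ball 0 1) (bound := fun τ => K * (Real.exp (2 * τ) + Real.exp (-2 * τ)))
    (Metric.ball_mem_nhds _ one_pos)
    (Eventually.of_forall fun r => Continuous.aestronglyMeasurable (by fun_prop))
    ?_ (Continuous.aestronglyMeasurable (by fun_prop)) ?_
    (((hexp 2).add (hexp (-2))).const_mul K) ?_
  · simpa using h.2
  · refine (integrable_const K).mono' (Continuous.aestronglyMeasurable (by fun_prop))
      (ae_of_all _ fun τ => ?_)
    simpa using hK τ
  -- For `|r| < 1` the weight and `|τ - r|` are each at most `exp |τ|`, and `exp (2|τ|)` is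
  -- dominated by the sum of the two exponentials.
  · refine ae_of_all _ fun τ r hr => ?_
    rw [mem_ball_zero_iff, Real.norm_eq_abs] at hr
    rw [norm_smul, norm_mul, Real.norm_eq_abs, Real.norm_eq_abs, abs_of_pos (Real.exp_pos _),
      mul_comm K]
    refine mul_le_mul ?_ (hK τ) (norm_nonneg _) (by positivity)
    have h1 : Real.exp (r * τ - r ^ 2 / 2) ≤ Real.exp |τ| := by
      refine Real.exp_le_exp.2 ?_
      have h2 : r * τ ≤ |τ| := by
        calc r * τ ≤ |r * τ| := le_abs_self _
          _ = |r| * |τ| := abs_mul _ _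
          _ ≤ 1 * |τ| := by gcongr
          _ = |τ| := one_mul _
      nlinarith [sq_nonneg r]
    have h2 : |τ - r| ≤ Real.exp |τ| := by
      have := Real.add_one_le_exp |τ|
      have := abs_sub τ r
      linarith
    calc Real.exp (r * τ - r ^ 2 / 2) * |τ - r| ≤ Real.exp |τ| * Real.exp |τ| := by gcongr
      _ = Real.exp (2 * |τ|) := by rw [← Real.exp_add]; ring_nf
      _ ≤ _ := by
        rcases abs_cases τ with ⟨h, _⟩ | ⟨h, _⟩ <;> rw [h]
        · linarith [Real.exp_pos (-2 * τ)]
        · have : 2 * -τ = -2 * τ := by ring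
          rw [this]
          linarith [Real.exp_pos (2 * τ)]
  · refine ae_of_all _ fun τ r _ => ?_
    have h1 : HasDerivAt (fun r : ℝ => r * τ - r ^ 2 / 2) (τ - r) r := by
      have := ((hasDerivAt_id r).mul_const τ).sub ((hasDerivAt_pow 2 r).div_const 2)
      convert! this using 1
      simp
    exact h1.exp.smul_const (k τ)

theorem integrable_sq_gaussianReal : Integrable (fun τ : ℝ => τ ^ 2) (gaussianReal 0 1) :=
  (memLp_id_gaussianReal 2).integrable_sq

theorem integral_sq_gaussianReal : ∫ τ : ℝ, τ ^ 2 ∂(gaussianReal 0 1) = 1 := by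
  have h3 := variance_eq_integral (μ := gaussianReal 0 1) (X := id) aemeasurable_id
  rw [variance_id_gaussianReal] at h3
  simp only [id, integral_id_gaussianReal, sub_zero] at h3
  rw [← h3]; simp

/-- Only the oscillation of `k` matters for the Gaussian derivative. -/
theorem norm_integral_smul_gaussianReal_le [CompleteSpace E] {k : ℝ → E} (hk : Continuous k)
    {α D : ℝ} (hα : 0 ≤ α) (hα1 : α ≤ 1) (hD : 0 ≤ D)
    (hosc : ∀ τ, ‖k τ - k 0‖ ≤ D * |τ| ^ α) :
    ‖∫ τ, τ • k τ ∂(gaussianReal 0 1)‖ ≤ 2 * D := by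
  have hb : ∀ τ : ℝ, ‖τ • (k τ - k 0)‖ ≤ D * (1 + τ ^ 2) := by
    intro τ
    rw [norm_smul, Real.norm_eq_abs]
    have h1 : |τ| * |τ| ^ α ≤ 1 + τ ^ 2 := by
      rcases le_total |τ| 1 with h | h
      · have : |τ| ^ α ≤ 1 := Real.rpow_le_one (abs_nonneg _) h hα
        nlinarith [abs_nonneg τ, sq_nonneg τ]
      · have : |τ| ^ α ≤ |τ| := by
          simpa using Real.rpow_le_rpow_of_exponent_le h hα1
        nlinarith [abs_nonneg τ, sq_abs τ]
    calc |τ| * ‖k τ - k 0‖ ≤ |τ| * (D * |τ| ^ α) := by gcongr; exact hosc τ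
      _ = D * (|τ| * |τ| ^ α) := by ring
      _ ≤ _ := by gcongr
  have hint : Integrable (fun τ : ℝ => D * (1 + τ ^ 2)) (gaussianReal 0 1) :=
    ((integrable_const 1).add integrable_sq_gaussianReal).const_mul D
  have hi1 : Integrable (fun τ : ℝ => τ • (k τ - k 0)) (gaussianReal 0 1) :=
    hint.mono' (Continuous.aestronglyMeasurable (by fun_prop)) (ae_of_all _ hb)
  have hi2 : Integrable (fun τ : ℝ => τ) (gaussianReal 0 1) :=
    (memLp_id_gaussianReal 1).integrable le_rfl
  -- The mean of `τ` is zero, so the constant `k 0` may be subtracted. The final factor `2` is the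
  -- integral of `1 + τ²`.
  have h0 : ∫ τ, τ • k τ ∂(gaussianReal 0 1) = ∫ τ, τ • (k τ - k 0) ∂(gaussianReal 0 1) := by
    have : ∀ τ : ℝ, τ • k τ = τ • (k τ - k 0) + τ • k 0 := fun τ => by
      rw [smul_sub, sub_add_cancel]
    simp_rw [this]
    rw [integral_add hi1 (hi2.smul_const _), integral_smul_const, integral_id_gaussianReal,
      zero_smul, add_zero]
  rw [h0]
  refine (norm_integral_le_of_norm_le hint (ae_of_all _ hb)).trans (le_of_eq ?_)
  rw [integral_const_mul, integral_add (integrable_const 1) integrable_sq_gaussianReal,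
    integral_sq_gaussianReal]
  simp
  ring

end OneDimensional

/-! ### Differentiation along the Cameron-Martin space. -/

section Directional

variable {X : Type*} [NormedAddCommGroup X] [InnerProductSpace ℝ X] [CompleteSpace X]
  [TopologicalSpace.SeparableSpace X] [MeasurableSpace X] [BorelSpace X]
  {E : Type*} [NormedAddCommGroup E] [NormedSpace ℝ E] [CompleteSpace E]

/-- A Gaussian measure splits off an independent one-dimensional Gaussian component in each
direction of its Cameron-Martin space. -/
theorem exists_gaussianMeasure_eq_map {Q : X →L[ℝ] X} (hQ : IsPositiveTraceClass Q) {w : X}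
    (hw : ‖w‖ = 1) : ∃ ν : Measure X, IsProbabilityMeasure ν ∧
      gaussianMeasure 0 Q =
        (ν.prod (gaussianReal 0 1)).map fun p => p.1 + p.2 • opSqrt Q w := by
  obtain ⟨hS, hSQ⟩ := opSqrt_spec hQ.1
  set v := opSqrt Q w with hv
  -- Removing the rank-one part keeps positivity: `⟪v, x⟫² = ⟪w, Q^{1/2} x⟫² ≤ ⟪Q x, x⟫` since `‖w‖
  -- = 1`.
  set Q' : X →L[ℝ] X := Q - (innerSL ℝ v).smulRight v with hQ'
  have happ : ∀ x, ⟪Q' x, x⟫ = ⟪Q x, x⟫ - ⟪v, x⟫ ^ 2 := by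
    intro x
    rw [hQ', sub_apply, inner_sub_left, ContinuousLinearMap.smulRight_apply, inner_smul_left,
      innerSL_apply_apply, sq]
    simp
  have hpos : Q'.IsPositive := by
    refine ContinuousLinearMap.isPositive_def.2 ⟨fun x y => ?_, fun x => ?_⟩
    · have h1 : ⟪Q x, y⟫ = ⟪x, Q y⟫ := hQ.1.inner_left_eq_inner_right x y
      simp only [hQ', ContinuousLinearMap.coe_coe, sub_apply, ContinuousLinearMap.smulRight_apply,
        inner_sub_left, inner_sub_right, inner_smul_left, inner_smul_right, h1,
        innerSL_apply_apply, real_inner_comm v]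
      simp only [Real.ringHom_apply]
      ring
    · rw [ContinuousLinearMap.reApplyInnerSelf_apply, RCLike.re_to_real, happ,
        ← inner_opSqrt hQ.1, real_inner_self_eq_norm_sq, hv, hS.inner_left_eq_inner_right]
      have h1 := abs_real_inner_le_norm w (opSqrt Q x)
      rw [hw, one_mul] at h1
      have := sq_le_sq' (by linarith [neg_abs_le ⟪w, opSqrt Q x⟫])
        ((le_abs_self _).trans h1)
      linarith
  have htr : IsPositiveTraceClass Q' := hQ.of_le hpos fun x => by
    rw [happ]; nlinarith [sq_nonneg ⟪v, x⟫]
  refine ⟨gaussianMeasure 0 Q', (gaussianMeasure_spec 0 htr).isProbabilityMeasure, ?_⟩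
  refine (gaussianMeasure_spec 0 hQ).unique ?_
  exact (gaussianMeasure_spec 0 htr).isGaussianLaw_map_add_smul hQ.1 v fun x => by
    rw [happ]; ring

theorem continuous_integral_comp_add {Y : Type*} [TopologicalSpace Y] [FirstCountableTopology Y]
    (ν : Measure X) [IsProbabilityMeasure ν] {φ : X → E} (hφ : Continuous φ) {K : ℝ}
    (hK : ∀ x, ‖φ x‖ ≤ K) {g : Y → X} (hg : Continuous g) :
    Continuous fun z => ∫ y, φ (g z + y) ∂ν := by
  refine continuous_of_dominated (bound := fun _ => K) (fun z => ?_)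
    (fun z => ae_of_all _ fun y => hK _) (integrable_const K) (ae_of_all _ fun y => by fun_prop)
  exact Continuous.aestronglyMeasurable (by fun_prop)

/-- Convolution with a Gaussian measure is differentiable along the Cameron-Martin space. -/
theorem exists_hasDerivAt_integral_gaussianMeasure {Q : X →L[ℝ] X} (hQ : IsPositiveTraceClass Q)
    (w : X) {φ : X → E} (hφ : Continuous φ) {K : ℝ} (hK : ∀ x, ‖φ x‖ ≤ K) {α A : ℝ}
    (hα : 0 ≤ α) (hα1 : α < 1) (hA : 0 ≤ A) (hosc : ∀ x y, ‖φ x - φ y‖ ≤ A * ‖x - y‖ ^ α) :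
    ∃ d : E, HasDerivAt (fun r : ℝ => ∫ y, φ (r • opSqrt Q w + y) ∂(gaussianMeasure 0 Q)) d 0 ∧
      ‖d‖ ≤ 2 * A * (‖w‖ ^ (1 - α) * ‖opSqrt Q w‖ ^ α) := by
  rcases eq_or_ne w 0 with rfl | hw
  · refine ⟨0, ?_, by simp; positivity⟩
    simpa using hasDerivAt_const (0 : ℝ) (∫ y, φ y ∂(gaussianMeasure 0 Q))
  have hw0 : 0 < ‖w‖ := norm_pos_iff.2 hw
  set w' := ‖w‖⁻¹ • w with hw'
  have hw1 : ‖w'‖ = 1 := by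
    rw [hw', norm_smul, norm_inv, norm_norm, inv_mul_cancel₀ hw0.ne']
  set v := opSqrt Q w' with hv
  have hwv : opSqrt Q w = ‖w‖ • v := by
    rw [hv, hw', map_smul, smul_inv_smul₀ hw0.ne']
  obtain ⟨ν, hν, hμ⟩ := exists_gaussianMeasure_eq_map hQ hw1
  rw [← hv] at hμ
  -- Integrating out `ν` leaves a function of the scalar component, and the shift by `r Q^{1/2} w`
  -- becomes the scalar shift `r ‖w‖`.
  set k : ℝ → E := fun τ => ∫ y, φ (τ • v + y) ∂ν with hk
  have hkc : Continuous k :=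
    continuous_integral_comp_add ν hφ hK (g := fun τ : ℝ => τ • v) (by fun_prop)
  have hkK : ∀ τ, ‖k τ‖ ≤ K := fun τ => by
    simpa using norm_integral_le_of_norm_le_const (μ := ν) (ae_of_all _ fun y => hK (τ • v + y))
  have hrepr : ∀ r : ℝ, ∫ y, φ (r • opSqrt Q w + y) ∂(gaussianMeasure 0 Q) =
      ∫ τ, k (τ + r * ‖w‖) ∂(gaussianReal 0 1) := by
    intro r
    rw [hμ, integral_map (by fun_prop) (Continuous.aestronglyMeasurable (by fun_prop)),
      integral_prod_symm]
    · refine integral_congr_ae (ae_of_all _ fun τ => ?_)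
      refine integral_congr_ae (ae_of_all _ fun y => ?_)
      simp only [hwv]
      congr 1
      module
    · refine (integrable_const K).mono' (Continuous.aestronglyMeasurable (by fun_prop))
        (ae_of_all _ fun y => hK _)
  simp_rw [hrepr]
  have h1 := hasDerivAt_integral_gaussianReal hkc hkK
  have h2 : HasDerivAt (fun r : ℝ => r * ‖w‖) ‖w‖ 0 := by
    simpa using (hasDerivAt_id (0 : ℝ)).mul_const ‖w‖
  have h1' : HasDerivAt (fun r => ∫ τ, k (τ + r) ∂(gaussianReal 0 1))
      (∫ τ, τ • k τ ∂(gaussianReal 0 1)) (0 * ‖w‖) := by rwa [zero_mul]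
  refine ⟨_, HasDerivAt.scomp (h := fun r : ℝ => r * ‖w‖) (0 : ℝ) h1' h2, ?_⟩
  -- Along `v` the Hölder constant is `A ‖v‖^α`. Multiplied by `‖w‖` it gives `‖w‖^{1-α} ‖Q^{1/2}
  -- w‖^α`, an interpolation between the two sizes.
  have hbound := norm_integral_smul_gaussianReal_le hkc hα hα1.le (D := A * ‖v‖ ^ α)
    (by positivity) fun τ => by
      have hi : ∀ τ : ℝ, Integrable (fun y => φ (τ • v + y)) ν := fun τ =>
        (integrable_const K).mono' (Continuous.aestronglyMeasurable (by fun_prop))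
          (ae_of_all _ fun y => hK _)
      rw [hk]
      dsimp only
      rw [← integral_sub (hi τ) (hi 0)]
      have := norm_integral_le_of_norm_le_const (μ := ν)
        (f := fun y => φ (τ • v + y) - φ ((0 : ℝ) • v + y)) (C := A * ‖v‖ ^ α * |τ| ^ α)
        (ae_of_all _ fun y => by
          refine (hosc _ _).trans (le_of_eq ?_)
          have : τ • v + y - ((0 : ℝ) • v + y) = τ • v := by simp
          rw [this, norm_smul, Real.norm_eq_abs, Real.mul_rpow (abs_nonneg _) (norm_nonneg _)]
          ring)
      simpa using this
  rw [norm_smul, norm_norm]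
  have hnorm : ‖opSqrt Q w‖ ^ α = ‖w‖ ^ α * ‖v‖ ^ α := by
    rw [hwv, norm_smul, norm_norm, Real.mul_rpow (norm_nonneg _) (norm_nonneg _)]
  have hww : ‖w‖ ^ (1 - α) * ‖w‖ ^ α = ‖w‖ := by
    rw [← Real.rpow_add hw0]; simp
  calc ‖w‖ * ‖∫ τ, τ • k τ ∂(gaussianReal 0 1)‖ ≤ ‖w‖ * (2 * (A * ‖v‖ ^ α)) := by gcongr
    _ = 2 * A * ((‖w‖ ^ (1 - α) * ‖w‖ ^ α) * ‖v‖ ^ α) := by rw [hww]; ring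
    _ = _ := by rw [hnorm]; ring

end Directional

/-! ### From line derivatives to Fréchet derivatives. -/

section LineDerivatives

variable {X : Type*} [NormedAddCommGroup X] [NormedSpace ℝ X]
  {E : Type*} [NormedAddCommGroup E] [NormedSpace ℝ E]

/-- Mean value inequality for `t ↦ f (x + t h) - t d x h` on `[0,1]`. -/
theorem norm_sub_sub_le_of_hasLineDerivAt {f : X → E} {d : X → X → E} {L : ℝ} (hL : 0 ≤ L)
    (hd : ∀ x h, HasLineDerivAt ℝ f (d x h) x h)
    (hlip : ∀ x y h, ‖d x h - d y h‖ ≤ L * ‖x - y‖ * ‖h‖) (x h : X) :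
    ‖f (x + h) - f x - d x h‖ ≤ L * ‖h‖ ^ 2 := by
  have hderiv : ∀ t : ℝ, HasDerivAt (fun t : ℝ => f (x + t • h) - t • d x h)
      (d (x + t • h) h - d x h) t := by
    intro t
    have h1 : HasDerivAt (fun r : ℝ => f (x + t • h + (r - t) • h)) (d (x + t • h) h) t := by
      have h0 := hd (x + t • h) h
      unfold HasLineDerivAt at h0
      have h2 : HasDerivAt (fun r : ℝ => r - t) 1 t := (hasDerivAt_id t).sub_const t
      rw [← sub_self t] at h0
      simpa using! HasDerivAt.scomp (h := fun r : ℝ => r - t) t h0 h2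
    have h1' : HasDerivAt (fun r : ℝ => f (x + r • h)) (d (x + t • h) h) t := by
      refine h1.congr_of_eventuallyEq (Eventually.of_forall fun r => ?_)
      dsimp only
      congr 1
      module
    simpa using! h1'.sub ((hasDerivAt_id t).smul_const (d x h))
  have := norm_image_sub_le_of_norm_deriv_le_segment_01' (C := L * ‖h‖ ^ 2)
    (fun t _ => (hderiv t).hasDerivWithinAt) (fun t ht => by
      refine (hlip _ _ _).trans ?_
      rw [add_sub_cancel_left, norm_smul, Real.norm_of_nonneg ht.1, sq, mul_assoc]
      gcongr
      nlinarith [norm_nonneg h, ht.2])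
  simpa [sub_sub, add_comm] using this

/-- At scale `t` all remainders are `O(t²)` while the additivity defect is linear in `t`; divide by
`t` and let it tend to `0`. -/
theorem lineDeriv_add_of_lipschitz {f : X → E} {d : X → X → E} {L : ℝ} (hL : 0 ≤ L)
    (hd : ∀ x h, HasLineDerivAt ℝ f (d x h) x h)
    (hlip : ∀ x y h, ‖d x h - d y h‖ ≤ L * ‖x - y‖ * ‖h‖) (x h k : X) :
    d x (h + k) = d x h + d x k := by
  have hsmul : ∀ (t : ℝ) x h, d x (t • h) = t • d x h := fun t x h =>
    (hd x (t • h)).unique ((hd x h).smul t)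
  set C := L * ‖h + k‖ ^ 2 + L * ‖h‖ ^ 2 + L * ‖k‖ ^ 2 + L * ‖h‖ * ‖k‖ with hC
  have key : ∀ t : ℝ, 0 < t → ‖d x (h + k) - d x h - d x k‖ ≤ C * t := by
    intro t ht
    have e1 := norm_sub_sub_le_of_hasLineDerivAt hL hd hlip x (t • (h + k))
    have e2 := norm_sub_sub_le_of_hasLineDerivAt hL hd hlip x (t • h)
    have e3 := norm_sub_sub_le_of_hasLineDerivAt hL hd hlip (x + t • h) (t • k)
    have e4 := hlip (x + t • h) x (t • k)
    simp only [hsmul] at e1 e2 e3 e4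
    have hx : x + t • h + t • k = x + t • (h + k) := by module
    rw [hx] at e3
    rw [add_sub_cancel_left] at e4
    have id1 : t • (d x (h + k) - d x h - d x k) =
        -(f (x + t • (h + k)) - f x - t • d x (h + k)) + (f (x + t • h) - f x - t • d x h) +
        (f (x + t • (h + k)) - f (x + t • h) - t • d (x + t • h) k) +
        (t • d (x + t • h) k - t • d x k) := by module
    have h5 : ‖t • (d x (h + k) - d x h - d x k)‖ ≤ C * t * t := by
      rw [id1]
      refine (norm_add_le _ _).trans ((add_le_add_left ((norm_add_le _ _).trans
        (add_le_add_left (norm_add_le _ _) _)) _).trans ?_)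
      rw [norm_neg]
      simp only [norm_smul, Real.norm_of_nonneg ht.le] at e1 e2 e3 e4
      rw [hC]
      nlinarith
    rw [norm_smul, Real.norm_of_nonneg ht.le, mul_comm] at h5
    exact le_of_mul_le_mul_right h5 ht
  have : ‖d x (h + k) - d x h - d x k‖ ≤ 0 := by
    refine le_of_tendsto_of_tendsto (f := fun _ : ℝ => _) (b := 𝓝[>] (0 : ℝ))
      tendsto_const_nhds (g := fun t => C * t) ?_
      (eventually_mem_nhdsWithin.mono fun t ht => key t ht)
    have : Tendsto (fun t : ℝ => C * t) (𝓝 0) (𝓝 (C * 0)) := tendsto_id.const_mul C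
    rw [mul_zero] at this
    exact this.mono_left nhdsWithin_le_nhds
  have h0 := norm_le_zero_iff.1 this
  rw [sub_sub, sub_eq_zero] at h0
  exact h0

/-- A function whose line derivatives exist and depend on the point in a Lipschitz way is
continuously differentiable. -/
theorem contDiff_one_of_hasLineDerivAt {f : X → E} {d : X → X → E} {L C : ℝ} (hL : 0 ≤ L)
    (hd : ∀ x h, HasLineDerivAt ℝ f (d x h) x h)
    (hlip : ∀ x y h, ‖d x h - d y h‖ ≤ L * ‖x - y‖ * ‖h‖) (hC : ∀ x h, ‖d x h‖ ≤ C * ‖h‖) :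
    ContDiff ℝ 1 f := by
  have hsmul : ∀ (t : ℝ) x h, d x (t • h) = t • d x h := fun t x h =>
    (hd x (t • h)).unique ((hd x h).smul t)
  set D : X → X →L[ℝ] E := fun x => LinearMap.mkContinuous
    { toFun := d x
      map_add' := lineDeriv_add_of_lipschitz hL hd hlip x
      map_smul' := fun t h => hsmul t x h } C (hC x) with hD
  have hDapp : ∀ x h, D x h = d x h := fun _ _ => rfl
  have hfd : ∀ x, HasFDerivAt f (D x) x := by
    intro x
    rw [hasFDerivAt_iff_isLittleO_nhds_zero]
    have h1 : (fun h => f (x + h) - f x - D x h) =O[𝓝 0] fun h => ‖h‖ ^ 2 :=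
      Asymptotics.IsBigO.of_bound L (Eventually.of_forall fun h => by
        rw [hDapp, Real.norm_of_nonneg (by positivity)]
        exact norm_sub_sub_le_of_hasLineDerivAt hL hd hlip x h)
    have h2 : (fun h : X => ‖h‖ ^ 2) =o[𝓝 0] fun h => h :=
      Asymptotics.isLittleO_norm_pow_id one_lt_two
    exact h1.trans_isLittleO h2
  rw [contDiff_one_iff_fderiv]
  refine ⟨fun x => (hfd x).differentiableAt, ?_⟩
  have : fderiv ℝ f = D := funext fun x => (hfd x).fderiv
  rw [this]
  refine (LipschitzWith.of_dist_le_mul (K := L.toNNReal) fun x y => ?_).continuous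
  rw [dist_eq_norm, dist_eq_norm, Real.coe_toNNReal _ hL]
  refine ContinuousLinearMap.opNorm_le_bound _ (by positivity) fun h => ?_
  rw [sub_apply, hDapp, hDapp]
  exact hlip x y h

end LineDerivatives

end OrnsteinUhlenbeck

end

noncomputable section

namespace OrnsteinUhlenbeck

open Filter Topology

/-! ### Uniform bounds and joint continuity of the evolution operator. -/

section Evolution

variable {X : Type*} [NormedAddCommGroup X] [InnerProductSpace ℝ X] [CompleteSpace X]
  {T : ℝ} {U : ℝ → ℝ → X →L[ℝ] X}

theorem isCompact_timeTriangle (T : ℝ) :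
    IsCompact {p : ℝ × ℝ | 0 ≤ p.1 ∧ p.1 ≤ p.2 ∧ p.2 ≤ T} := by
  refine (isCompact_Icc.prod isCompact_Icc : IsCompact (Icc 0 T ×ˢ Icc 0 T)).of_isClosed_subset
    ?_ fun p hp => ⟨⟨hp.1, hp.2.1.trans hp.2.2⟩, ⟨hp.1.trans hp.2.1, hp.2.2⟩⟩
  exact (isClosed_le continuous_const continuous_fst).inter
    ((isClosed_le continuous_fst continuous_snd).inter (isClosed_le continuous_snd continuous_const))

/-- Orbits are bounded on the compact time triangle, so Banach-Steinhaus applies. The requirement `1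
≤ M` lets later estimates absorb `M^α` into `M`. -/
theorem IsEvolutionOperator.exists_bound (hU : IsEvolutionOperator T U) :
    ∃ M : ℝ, 1 ≤ M ∧ ∀ s t, 0 ≤ s → s ≤ t → t ≤ T → ‖U t s‖ ≤ M := by
  obtain ⟨M, hM⟩ := banach_steinhaus
    (ι := {p : ℝ × ℝ | 0 ≤ p.1 ∧ p.1 ≤ p.2 ∧ p.2 ≤ T}) (g := fun p => U p.1.2 p.1.1) fun x => by
      obtain ⟨C, hC⟩ := (isCompact_timeTriangle T).exists_bound_of_continuousOn (hU.continuousOn x)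
      exact ⟨C, fun p => hC p.1 p.2⟩
  exact ⟨max 1 M, le_max_left _ _, fun s t h1 h2 h3 => (hM ⟨(s, t), h1, h2, h3⟩).trans
    (le_max_right _ _)⟩

/-- The truncation of a time to `[0,T]`. -/
def clampTime (T r : ℝ) : ℝ := max 0 (min r T)

theorem clampTime_of_mem {T r : ℝ} (hr : r ∈ Icc 0 T) : clampTime T r = r := by
  rw [clampTime, min_eq_left hr.2, max_eq_right hr.1]

theorem clampTime_mem {T : ℝ} (hT : 0 ≤ T) (r : ℝ) : clampTime T r ∈ Icc 0 T :=
  ⟨le_max_left _ _, max_le hT (min_le_right _ _)⟩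

theorem continuous_clampTime (T : ℝ) : Continuous (clampTime T) := by
  unfold clampTime; fun_prop

/-- An extension of `U` to all pairs of times. -/
def extendU (T : ℝ) (U : ℝ → ℝ → X →L[ℝ] X) (t s : ℝ) : X →L[ℝ] X :=
  U (max (clampTime T s) (clampTime T t)) (clampTime T s)

theorem extendU_of_le {s t : ℝ} (hs : 0 ≤ s) (hst : s ≤ t) (ht : t ≤ T) :
    extendU T U t s = U t s := by
  rw [extendU, clampTime_of_mem ⟨hs, hst.trans ht⟩, clampTime_of_mem ⟨hs.trans hst, ht⟩,
    max_eq_right hst]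

theorem IsEvolutionOperator.continuous_extendU (hU : IsEvolutionOperator T U) (hT : 0 ≤ T) :
    Continuous fun p : (ℝ × ℝ) × X => extendU T U p.1.1 p.1.2 p.2 := by
  obtain ⟨M, hM1, hM⟩ := hU.exists_bound
  have htri : ∀ p : ℝ × ℝ, (clampTime T p.2, max (clampTime T p.2) (clampTime T p.1)) ∈
      {p : ℝ × ℝ | 0 ≤ p.1 ∧ p.1 ≤ p.2 ∧ p.2 ≤ T} := fun p =>
    ⟨(clampTime_mem hT _).1, le_max_left _ _, max_le (clampTime_mem hT _).2 (clampTime_mem hT _).2⟩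
  refine continuous_prod_of_continuous_lipschitzWith'
    (fun p : (ℝ × ℝ) × X => extendU T U p.1.1 p.1.2 p.2) M.toNNReal (fun p => ?_) fun x => ?_
  · refine LipschitzWith.of_dist_le_mul fun x y => ?_
    rw [dist_eq_norm, dist_eq_norm, ← map_sub, Real.coe_toNNReal _ (by linarith)]
    exact ((extendU T U p.1 p.2).le_opNorm _).trans (mul_le_mul_of_nonneg_right
      (hM _ _ (htri p).1 (htri p).2.1 (htri p).2.2) (norm_nonneg _))
  · have hc : Continuous fun p : ℝ × ℝ =>
        (clampTime T p.2, max (clampTime T p.2) (clampTime T p.1)) := by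
      have := continuous_clampTime T
      fun_prop
    exact (hU.continuousOn x).comp_continuous hc htri

end Evolution

/-! ### Covariances and means: splitting in time, continuity, measurability. -/

section Data

variable {X : Type*} [NormedAddCommGroup X] [InnerProductSpace ℝ X] [CompleteSpace X]
  [TopologicalSpace.SeparableSpace X]
  {T : ℝ} {U : ℝ → ℝ → X →L[ℝ] X} {B : ℝ → X →L[ℝ] X} {f : ℝ → X}

/-- The integrand `V B B* V*` of the covariance operators. -/
def covIntegrand (V B : X →L[ℝ] X) : X →L[ℝ] X :=
  V ∘L B ∘L ContinuousLinearMap.adjoint B ∘L ContinuousLinearMap.adjoint V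

theorem covIntegrand_comp (W V B : X →L[ℝ] X) :
    covIntegrand (W ∘L V) B = W ∘L covIntegrand V B ∘L ContinuousLinearMap.adjoint W := by
  ext x
  simp only [covIntegrand, ContinuousLinearMap.comp_apply]
  rw [ContinuousLinearMap.adjoint_comp, ContinuousLinearMap.comp_apply]

theorem norm_covIntegrand_le {V B : X →L[ℝ] X} {M K : ℝ} (hV : ‖V‖ ≤ M) (hB : ‖B‖ ≤ K) :
    ‖covIntegrand V B‖ ≤ M * (K * (K * M)) := by
  have hM : 0 ≤ M := (norm_nonneg _).trans hV
  have hK : 0 ≤ K := (norm_nonneg _).trans hB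
  unfold covIntegrand
  refine (ContinuousLinearMap.opNorm_comp_le _ _).trans (mul_le_mul hV ?_ (norm_nonneg _) hM)
  refine (ContinuousLinearMap.opNorm_comp_le _ _).trans (mul_le_mul hB ?_ (norm_nonneg _) hK)
  refine (ContinuousLinearMap.opNorm_comp_le _ _).trans (mul_le_mul ?_ ?_ (norm_nonneg _) hK)
  · rwa [LinearIsometryEquiv.norm_map]
  · rwa [LinearIsometryEquiv.norm_map]

theorem aestronglyMeasurable_covIntegrand {Z : Type*} [MeasurableSpace Z] {μ : Measure Z}
    {V B : Z → X →L[ℝ] X} (hV : ∀ x, AEStronglyMeasurable (fun a => V a x) μ)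
    (hB : ∀ x, AEStronglyMeasurable (fun a => B a x) μ) (x : X) :
    AEStronglyMeasurable (fun a => covIntegrand (V a) (B a) x) μ :=
  aestronglyMeasurable_operator_apply hV (aestronglyMeasurable_operator_apply hB
    (aestronglyMeasurable_operator_apply (aestronglyMeasurable_adjoint_apply hB)
      (aestronglyMeasurable_adjoint_apply hV x)))

theorem IsEvolutionOperator.aestronglyMeasurable_extendU (hU : IsEvolutionOperator T U)
    (hT : 0 ≤ T) {Z : Type*} [MeasurableSpace Z] {μ : Measure Z} {σ ρ : Z → ℝ}
    (hσ : AEStronglyMeasurable σ μ) (hρ : AEStronglyMeasurable ρ μ) {z : Z → X}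
    (hz : AEStronglyMeasurable z μ) :
    AEStronglyMeasurable (fun a => extendU T U (σ a) (ρ a) (z a)) μ :=
  (hU.continuous_extendU hT).comp_aestronglyMeasurable ((hσ.prodMk hρ).prodMk hz)

theorem IsOUData.integrable_covIntegrand (h : IsOUData T U B f) {t : ℝ} (ht : 0 ≤ t) (htT : t ≤ T)
    (x : X) : IntegrableOn (fun r => covIntegrand (U t r) (B r) x) (Icc 0 t) := by
  obtain ⟨M, -, hM⟩ := h.evolution.exists_bound
  obtain ⟨K, hK⟩ := h.bounded_B
  have hm : AEStronglyMeasurable (fun r => covIntegrand (extendU T U t r) (B r) x)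
      (volume.restrict (Icc 0 T)) :=
    aestronglyMeasurable_covIntegrand (fun x => h.evolution.aestronglyMeasurable_extendU
      (ht.trans htT) aestronglyMeasurable_const aestronglyMeasurable_id aestronglyMeasurable_const)
      h.measurable_B x
  have hm' : AEStronglyMeasurable (fun r => covIntegrand (U t r) (B r) x)
      (volume.restrict (Icc 0 t)) := by
    refine (hm.mono_measure (Measure.restrict_mono (Icc_subset_Icc_right htT) le_rfl)).congr ?_
    filter_upwards [ae_restrict_mem measurableSet_Icc] with r hr
    rw [extendU_of_le hr.1 hr.2 htT]
  refine (integrableOn_const (C := M * (K * (K * M)) * ‖x‖) (by simp)).mono' hm' ?_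
  filter_upwards [ae_restrict_mem measurableSet_Icc] with r hr
  exact ((covIntegrand (U t r) (B r)).le_opNorm x).trans (mul_le_mul_of_nonneg_right
    (norm_covIntegrand_le (hM r t hr.1 hr.2 htT) (hK r ⟨hr.1, hr.2.trans htT⟩)) (norm_nonneg _))

theorem intervalIntegrable_of_integrableOn_Icc {E : Type*} [NormedAddCommGroup E] {g : ℝ → E}
    {a b s t : ℝ} (h : IntegrableOn g (Icc a b)) (hs : s ∈ Icc a b) (ht : t ∈ Icc a b) :
    IntervalIntegrable g volume s t :=
  (h.mono_set (Set.ordConnected_Icc.uIcc_subset hs ht)).intervalIntegrable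

theorem IsOUData.covQ_apply (h : IsOUData T U B f) {s t : ℝ} (hs : 0 ≤ s) (hst : s ≤ t)
    (ht : t ≤ T) (x : X) : covQ U B t s x = ∫ r in s..t, covIntegrand (U t r) (B r) x := by
  obtain ⟨M, -, hM⟩ := h.evolution.exists_bound
  obtain ⟨K, hK⟩ := h.bounded_B
  refine strongIntegral_apply (K := M * (K * (K * M))) (fun x =>
    intervalIntegrable_of_integrableOn_Icc (h.integrable_covIntegrand (hs.trans hst) ht x)
      ⟨hs, hst⟩ ⟨hs.trans hst, le_rfl⟩) (fun r hr => ?_) x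
  rw [uIoc_of_le hst] at hr
  exact norm_covIntegrand_le (hM r t (hs.trans hr.1.le) hr.2 ht)
    (hK r ⟨hs.trans hr.1.le, hr.2.trans ht⟩)

theorem IsOUData.exists_covQ_bound (h : IsOUData T U B f) :
    ∃ M : ℝ, ∀ s t, 0 ≤ s → s ≤ t → t ≤ T → ‖covQ U B t s‖ ≤ M := by
  obtain ⟨M, hM1, hM⟩ := h.evolution.exists_bound
  obtain ⟨K, hK⟩ := h.bounded_B
  refine ⟨M * (|K| * (|K| * M)) * |T|, fun s t hs hst ht => ?_⟩
  refine ContinuousLinearMap.opNorm_le_bound _ (by positivity) fun x => ?_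
  rw [h.covQ_apply hs hst ht]
  refine (intervalIntegral.norm_integral_le_of_norm_le_const
    (C := M * (|K| * (|K| * M)) * ‖x‖) fun r hr => ?_).trans ?_
  · rw [uIoc_of_le hst] at hr
    exact ((covIntegrand (U t r) (B r)).le_opNorm x).trans (mul_le_mul_of_nonneg_right
      (norm_covIntegrand_le (hM r t (hs.trans hr.1.le) hr.2 ht)
        ((hK r ⟨hs.trans hr.1.le, hr.2.trans ht⟩).trans (le_abs_self K))) (norm_nonneg _))
  · have : |t - s| ≤ |T| := by
      rw [abs_of_nonneg (by linarith), abs_of_nonneg (by linarith)]; linarith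
    calc M * (|K| * (|K| * M)) * ‖x‖ * |t - s| ≤ M * (|K| * (|K| * M)) * ‖x‖ * |T| := by gcongr
      _ = _ := by ring

/-- For `ρ ≤ r` the integrand factors through `U(t,ρ) = U(t,r) U(r,ρ)`. Besides Chapman-Kolmogorov
this yields the monotonicity `Q(t,r) ≤ Q(t,s)`. -/
theorem IsOUData.covQ_eq_add (h : IsOUData T U B f) {s r t : ℝ} (hs : 0 ≤ s) (hsr : s ≤ r)
    (hrt : r ≤ t) (ht : t ≤ T) :
    covQ U B t s = U t r ∘L covQ U B r s ∘L ContinuousLinearMap.adjoint (U t r) + covQ U B t r := by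
  have hr : 0 ≤ r := hs.trans hsr
  have ht0 : 0 ≤ t := hr.trans hrt
  ext x
  have hi := h.integrable_covIntegrand ht0 ht x
  rw [add_apply, ContinuousLinearMap.comp_apply, ContinuousLinearMap.comp_apply,
    h.covQ_apply hs (hsr.trans hrt) ht, h.covQ_apply hs hsr (hrt.trans ht), h.covQ_apply hr hrt ht,
    ← intervalIntegral.integral_add_adjacent_intervals
      (intervalIntegrable_of_integrableOn_Icc hi ⟨hs, hsr.trans hrt⟩ ⟨hr, hrt⟩)
      (intervalIntegrable_of_integrableOn_Icc hi ⟨hr, hrt⟩ ⟨ht0, le_rfl⟩),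
    ← ContinuousLinearMap.intervalIntegral_comp_comm _
      (intervalIntegrable_of_integrableOn_Icc (h.integrable_covIntegrand hr (hrt.trans ht) _)
        ⟨hs, hsr⟩ ⟨hr, le_rfl⟩)]
  congr 1
  refine intervalIntegral.integral_congr fun ρ hρ => ?_
  rw [uIcc_of_le hsr] at hρ
  rw [← h.evolution.comp ρ r t (hs.trans hρ.1) hρ.2 hrt ht, covIntegrand_comp]
  rfl

theorem IsOUData.integrable_meanIntegrand (h : IsOUData T U B f) {t : ℝ} (ht : 0 ≤ t)
    (htT : t ≤ T) : IntegrableOn (fun r => U t r (f r)) (Icc 0 t) := by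
  obtain ⟨M, hM1, hM⟩ := h.evolution.exists_bound
  obtain ⟨K, hK⟩ := h.bounded_f
  have hm : AEStronglyMeasurable (fun r => extendU T U t r (f r)) (volume.restrict (Icc 0 T)) :=
    h.evolution.aestronglyMeasurable_extendU (ht.trans htT) aestronglyMeasurable_const
      aestronglyMeasurable_id h.measurable_f
  have hm' : AEStronglyMeasurable (fun r => U t r (f r)) (volume.restrict (Icc 0 t)) := by
    refine (hm.mono_measure (Measure.restrict_mono (Icc_subset_Icc_right htT) le_rfl)).congr ?_
    filter_upwards [ae_restrict_mem measurableSet_Icc] with r hr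
    rw [extendU_of_le hr.1 hr.2 htT]
  refine (integrableOn_const (C := M * K) (by simp)).mono' hm' ?_
  filter_upwards [ae_restrict_mem measurableSet_Icc] with r hr
  exact ((U t r).le_opNorm _).trans (mul_le_mul (hM r t hr.1 hr.2 htT)
    (hK r ⟨hr.1, hr.2.trans htT⟩) (norm_nonneg _) (by linarith))

theorem IsOUData.meanM_eq (h : IsOUData T U B f) {s r t : ℝ} (hs : 0 ≤ s) (hsr : s ≤ r)
    (hrt : r ≤ t) (ht : t ≤ T) (x : X) :
    meanM U f t s x = U t r (meanM U f r s x) + meanM U f t r 0 := by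
  have hr : 0 ≤ r := hs.trans hsr
  have ht0 : 0 ≤ t := hr.trans hrt
  have hi := h.integrable_meanIntegrand ht0 ht
  unfold meanM
  rw [map_add, map_zero, zero_add, ← ContinuousLinearMap.intervalIntegral_comp_comm _
    (intervalIntegrable_of_integrableOn_Icc (h.integrable_meanIntegrand hr (hrt.trans ht))
      ⟨hs, hsr⟩ ⟨hr, le_rfl⟩), ← ContinuousLinearMap.comp_apply,
    h.evolution.comp s r t hs hsr hrt ht, add_assoc,
    ← intervalIntegral.integral_add_adjacent_intervals
      (intervalIntegrable_of_integrableOn_Icc hi ⟨hs, hsr.trans hrt⟩ ⟨hr, hrt⟩)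
      (intervalIntegrable_of_integrableOn_Icc hi ⟨hr, hrt⟩ ⟨ht0, le_rfl⟩)]
  congr 2
  refine intervalIntegral.integral_congr fun ρ hρ => ?_
  rw [uIcc_of_le hsr] at hρ
  rw [← ContinuousLinearMap.comp_apply, h.evolution.comp ρ r t (hs.trans hρ.1) hρ.2 hrt ht]

theorem meanM_eq_add (U : ℝ → ℝ → X →L[ℝ] X) (f : ℝ → X) (t s : ℝ) (x : X) :
    meanM U f t s x = U t s x + meanM U f t s 0 := by
  simp [meanM]

theorem continuousOn_integral_left {E : Type*} [NormedAddCommGroup E] [NormedSpace ℝ E]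
    {g : ℝ → E} {t : ℝ} (h : IntegrableOn g (Icc 0 t)) :
    ContinuousOn (fun s => ∫ r in s..t, g r) (Icc 0 t) := by
  rcases lt_or_ge t 0 with ht | ht
  · rw [Icc_eq_empty (not_le.2 ht)]; exact continuousOn_empty _
  have h1 := intervalIntegral.continuousOn_primitive_interval_left (a := 0) (b := t)
    (f := g) (μ := volume) (by rwa [uIcc_of_le ht])
  rwa [uIcc_of_le ht] at h1

theorem IsOUData.continuousOn_meanM (h : IsOUData T U B f) {t : ℝ} (ht : 0 ≤ t) (htT : t ≤ T) :
    ContinuousOn (fun p : ℝ × X => meanM U f t p.1 p.2) (Icc 0 t ×ˢ univ) := by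
  have h1 : Continuous fun p : ℝ × X => extendU T U t p.1 p.2 :=
    (h.evolution.continuous_extendU (ht.trans htT)).comp
      (by fun_prop : Continuous fun p : ℝ × X => ((t, p.1), p.2))
  have h2 := continuousOn_integral_left (h.integrable_meanIntegrand ht htT)
  have h3 : ContinuousOn (fun p : ℝ × X => ∫ r in p.1..t, U t r (f r)) (Icc 0 t ×ˢ univ) :=
    h2.comp continuous_fst.continuousOn fun p hp => hp.1
  refine (h1.continuousOn.add h3).congr fun p hp => ?_
  rw [meanM, ← extendU_of_le (T := T) (U := U) hp.1.1 hp.1.2 htT]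
  rfl

/-- By monotonicity the diagonal entries of `Q(t,s)` are dominated by those of `Q(t,0)`, which are
summable; the Weierstrass test applies. -/
theorem IsOUData.continuousOn_trace (h : IsOUData T U B f) {t : ℝ} (ht : 0 ≤ t) (htT : t ≤ T)
    [MeasurableSpace X] [BorelSpace X] {ι : Type*} (b : HilbertBasis ι ℝ X) :
    ContinuousOn (fun s => ∑' i, ⟪covQ U B t s (b i), b i⟫) (Icc 0 t) := by
  refine continuousOn_tsum (fun i => ?_) ((h.traceClass 0 t le_rfl ht htT).summable b)
    fun i s hs => ?_
  · have h1 : ContinuousOn (fun s => covQ U B t s (b i)) (Icc 0 t) :=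
      (continuousOn_integral_left (h.integrable_covIntegrand ht htT (b i))).congr
        fun s hs => h.covQ_apply hs.1 hs.2 htT (b i)
    exact h1.inner continuousOn_const
  · have hpos := (h.traceClass s t hs.1 hs.2 htT).1
    rw [Real.norm_of_nonneg (hpos.inner_nonneg_left _), h.covQ_eq_add le_rfl hs.1 hs.2 htT,
      add_apply, inner_add_left]
    have := ((h.traceClass 0 s le_rfl hs.1 (hs.2.trans htT)).1.conj_adjoint (U t s)).inner_nonneg_left
      (b i)
    linarith

/-- Integrals up to a moving end point depend measurably on it. -/
theorem aestronglyMeasurable_integral_moving {E : Type*} [NormedAddCommGroup E] [NormedSpace ℝ E]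
    {r t : ℝ} {G : ℝ × ℝ → E}
    (hG : AEStronglyMeasurable G ((volume.restrict (Ioc r t)).prod (volume.restrict (Ioc r t)))) :
    AEStronglyMeasurable (fun σ => ∫ ρ in r..σ, G (σ, ρ)) (volume.restrict (Ioc r t)) := by
  have hs : MeasurableSet {p : ℝ × ℝ | p.2 ≤ p.1} := measurableSet_le measurable_snd measurable_fst
  -- The indicator of `ρ ≤ σ` turns the moving end point into a fixed domain.
  have h1 := (hG.indicator hs).integral_prod_right'
  refine h1.congr ?_
  filter_upwards [ae_restrict_mem measurableSet_Ioc] with σ hσ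
  have h2 : (fun ρ => {p : ℝ × ℝ | p.2 ≤ p.1}.indicator G (σ, ρ)) =
      (Iic σ).indicator fun ρ => G (σ, ρ) := by
    ext ρ
    simp only [indicator, mem_ofPred_eq, mem_Iic]
  rw [h2, integral_indicator measurableSet_Iic, Measure.restrict_restrict measurableSet_Iic,
    intervalIntegral.integral_of_le hσ.1.le, inter_comm, Ioc_inter_Iic, min_eq_right hσ.2]

theorem IsOUData.aestronglyMeasurable_covQ (h : IsOUData T U B f) {r t : ℝ} (hr : 0 ≤ r)
    (ht : t ≤ T) (x : X) :
    AEStronglyMeasurable (fun σ => covQ U B σ r x) (volume.restrict (Ioc r t)) := by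
  rcases lt_or_ge t r with hrt | hrt
  · rw [Ioc_eq_empty (by simpa using hrt.le)]; simp
  have hsub : Ioc r t ⊆ Icc 0 T := fun σ hσ => ⟨hr.trans hσ.1.le, hσ.2.trans ht⟩
  have hT : 0 ≤ T := hr.trans (hrt.trans ht)
  have h1 := aestronglyMeasurable_integral_moving (r := r) (t := t)
    (G := fun p => covIntegrand (extendU T U p.1 p.2) (B p.2) x)
    (aestronglyMeasurable_covIntegrand (fun x => h.evolution.aestronglyMeasurable_extendU hT
      measurable_fst.aestronglyMeasurable measurable_snd.aestronglyMeasurable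
      aestronglyMeasurable_const)
      (fun x => ((h.measurable_B x).mono_measure (Measure.restrict_mono hsub le_rfl)).comp_snd) x)
  refine h1.congr ?_
  filter_upwards [ae_restrict_mem measurableSet_Ioc] with σ hσ
  rw [h.covQ_apply hr hσ.1.le (hσ.2.trans ht)]
  refine intervalIntegral.integral_congr fun ρ hρ => ?_
  rw [uIcc_of_le hσ.1.le] at hρ
  rw [extendU_of_le (hr.trans hρ.1) hρ.2 (hσ.2.trans ht)]

theorem IsOUData.aestronglyMeasurable_meanM (h : IsOUData T U B f) {r t : ℝ} (hr : 0 ≤ r)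
    (ht : t ≤ T) [MeasurableSpace X] [BorelSpace X] (ν : Measure X) [SFinite ν] :
    AEStronglyMeasurable (fun p : ℝ × X => meanM U f p.1 r p.2)
      ((volume.restrict (Ioc r t)).prod ν) := by
  rcases lt_or_ge t r with hrt | hrt
  · rw [Ioc_eq_empty (by simpa using hrt.le)]; simp
  have hsub : Ioc r t ⊆ Icc 0 T := fun σ hσ => ⟨hr.trans hσ.1.le, hσ.2.trans ht⟩
  have hT : 0 ≤ T := hr.trans (hrt.trans ht)
  have h1 := aestronglyMeasurable_integral_moving (r := r) (t := t)
    (G := fun p => extendU T U p.1 p.2 (f p.2))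
    (h.evolution.aestronglyMeasurable_extendU hT
      measurable_fst.aestronglyMeasurable measurable_snd.aestronglyMeasurable
      (h.measurable_f.mono_measure (Measure.restrict_mono hsub le_rfl)).comp_snd)
  have h2 : AEStronglyMeasurable (fun p : ℝ × X => extendU T U p.1 r p.2)
      ((volume.restrict (Ioc r t)).prod ν) :=
    h.evolution.aestronglyMeasurable_extendU hT measurable_fst.aestronglyMeasurable
      aestronglyMeasurable_const measurable_snd.aestronglyMeasurable
  refine (h2.add h1.comp_fst).congr ?_
  have hmem : ∀ᵐ p ∂((volume.restrict (Ioc r t)).prod ν), p.1 ∈ Ioc r t :=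
    Measure.quasiMeasurePreserving_fst.ae (ae_restrict_mem measurableSet_Ioc)
  filter_upwards [hmem] with p hσ
  simp only [Pi.add_apply, meanM]
  rw [extendU_of_le hr hσ.1.le (hσ.2.trans ht)]
  congr 1
  refine intervalIntegral.integral_congr fun ρ hρ => ?_
  rw [uIcc_of_le hσ.1.le] at hρ
  rw [extendU_of_le (hr.trans hρ.1) hρ.2 (hσ.2.trans ht)]

end Data

end OrnsteinUhlenbeck

end

noncomputable section

namespace OrnsteinUhlenbeck

open Filter Topology

/-! ### The operators `P_{s,t}`: Chapman-Kolmogorov and joint continuity. -/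

section EvolutionOperators

variable {X : Type*} [NormedAddCommGroup X] [InnerProductSpace ℝ X] [CompleteSpace X]
  [TopologicalSpace.SeparableSpace X] [MeasurableSpace X] [BorelSpace X]
  {T : ℝ} {U : ℝ → ℝ → X →L[ℝ] X} {B : ℝ → X →L[ℝ] X} {f : ℝ → X}
  {E : Type*} [NormedAddCommGroup E] [NormedSpace ℝ E] [CompleteSpace E]

/-- The operator `P_{s,t}` on functions with values in a normed space. -/
def evolOp (U : ℝ → ℝ → X →L[ℝ] X) (B : ℝ → X →L[ℝ] X) (f : ℝ → X) (s t : ℝ) (φ : X → E) (x : X) :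
    E :=
  ∫ y, φ y ∂(gaussianMeasure (meanM U f t s x) (covQ U B t s))

/-- The law of the noise added between the times `s` and `t`. -/
def noiseLaw (U : ℝ → ℝ → X →L[ℝ] X) (B : ℝ → X →L[ℝ] X) (f : ℝ → X) (s t : ℝ) : Measure X :=
  gaussianMeasure (meanM U f t s 0) (covQ U B t s)

section

variable (h : IsOUData T U B f) {s t : ℝ} (hs : 0 ≤ s) (hst : s ≤ t) (ht : t ≤ T)
include h hs hst ht

theorem IsOUData.isGaussianLaw (x : X) : IsGaussianLaw (meanM U f t s x) (covQ U B t s)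
    (gaussianMeasure (meanM U f t s x) (covQ U B t s)) :=
  gaussianMeasure_spec _ (h.traceClass s t hs hst ht)

theorem IsOUData.isProbabilityMeasure_noiseLaw : IsProbabilityMeasure (noiseLaw U B f s t) :=
  (h.isGaussianLaw hs hst ht 0).isProbabilityMeasure

/-- The noise law does not depend on `x`, which enters only as the translation `U(t,s) x`. -/
theorem IsOUData.evolOp_eq {φ : X → E} (hφ : Continuous φ) (x : X) :
    evolOp U B f s t φ x = ∫ y, φ (U t s x + y) ∂(noiseLaw U B f s t) := by
  have h1 : gaussianMeasure (meanM U f t s x) (covQ U B t s) =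
      (noiseLaw U B f s t).map (U t s x + ·) := by
    refine (h.isGaussianLaw hs hst ht x).unique ?_
    rw [meanM_eq_add]
    exact (h.isGaussianLaw hs hst ht 0).map_const_add _
  rw [evolOp, h1, integral_map (by fun_prop) (Continuous.aestronglyMeasurable (by fun_prop))]

theorem IsOUData.evolOp_eq_centered {φ : X → E} (hφ : Continuous φ) (x : X) :
    evolOp U B f s t φ x =
      ∫ y, φ (meanM U f t s x + y) ∂(gaussianMeasure 0 (covQ U B t s)) := by
  rw [evolOp, gaussianMeasure_eq_map _ (h.traceClass s t hs hst ht),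
    integral_map (by fun_prop) (Continuous.aestronglyMeasurable (by fun_prop))]

theorem IsOUData.norm_evolOp_le {φ : X → E} {K : ℝ} (hK : ∀ x, ‖φ x‖ ≤ K) (x : X) :
    ‖evolOp U B f s t φ x‖ ≤ K := by
  have := (h.isGaussianLaw hs hst ht x).isProbabilityMeasure
  simpa using! norm_integral_le_of_norm_le_const (μ := gaussianMeasure (meanM U f t s x)
    (covQ U B t s)) (ae_of_all _ hK)

theorem IsOUData.integrable_noiseLaw {φ : X → E} (hφ : Continuous φ) {K : ℝ}
    (hK : ∀ x, ‖φ x‖ ≤ K) (x : X) : Integrable (fun y => φ (x + y)) (noiseLaw U B f s t) := by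
  have := h.isProbabilityMeasure_noiseLaw hs hst ht
  exact (integrable_const K).mono' (Continuous.aestronglyMeasurable (by fun_prop))
    (ae_of_all _ fun y => hK _)

theorem IsOUData.continuous_evolOp {φ : X → E} (hφ : Continuous φ) {K : ℝ}
    (hK : ∀ x, ‖φ x‖ ≤ K) : Continuous (evolOp U B f s t φ) := by
  have := h.isProbabilityMeasure_noiseLaw hs hst ht
  have h1 := continuous_integral_comp_add (noiseLaw U B f s t) hφ hK (g := fun x => U t s x)
    (by fun_prop)
  exact h1.congr fun x => (h.evolOp_eq hs hst ht hφ x).symm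

theorem IsOUData.evolOp_sub {φ ψ : X → E} (hφ : Continuous φ) (hψ : Continuous ψ) {K K' : ℝ}
    (hK : ∀ x, ‖φ x‖ ≤ K) (hK' : ∀ x, ‖ψ x‖ ≤ K') (x : X) :
    evolOp U B f s t (fun x => φ x - ψ x) x = evolOp U B f s t φ x - evolOp U B f s t ψ x := by
  have := (h.isGaussianLaw hs hst ht x).isProbabilityMeasure
  refine integral_sub ?_ ?_
  · exact (integrable_const K).mono' (Continuous.aestronglyMeasurable (by fun_prop))
      (ae_of_all _ fun y => hK _)
  · exact (integrable_const K').mono' (Continuous.aestronglyMeasurable (by fun_prop))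
      (ae_of_all _ fun y => hK' _)

/-- Because of this covariance, increments of `P φ` are values of `P` on increments of `φ`, so
bounds for `P` turn into moduli of continuity. -/
theorem IsOUData.evolOp_comp_add {φ : X → E} (hφ : Continuous φ) (x k : X) :
    evolOp U B f s t φ (x + k) = evolOp U B f s t (fun y => φ (U t s k + y)) x := by
  rw [h.evolOp_eq hs hst ht hφ, h.evolOp_eq hs hst ht (φ := fun y => φ (U t s k + y)) (by fun_prop)]
  refine integral_congr_ae (ae_of_all _ fun y => ?_)
  simp only [map_add]
  congr 1
  abel

theorem IsOUData.norm_evolOp_sub_le {φ : X → E} (hφ : Continuous φ) {K : ℝ}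
    (hK : ∀ x, ‖φ x‖ ≤ K) {A α : ℝ}
    (hosc : ∀ x y, ‖φ x - φ y‖ ≤ A * ‖x - y‖ ^ α) (x y : X) :
    ‖evolOp U B f s t φ x - evolOp U B f s t φ y‖ ≤ A * ‖U t s (x - y)‖ ^ α := by
  have hx : x = y + (x - y) := by abel
  rw [hx, h.evolOp_comp_add hs hst ht hφ, ← hx, ← h.evolOp_sub hs hst ht (by fun_prop) hφ
    (fun x => hK _) hK]
  refine h.norm_evolOp_le hs hst ht (fun z => ?_) y
  refine (hosc _ _).trans (le_of_eq ?_)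
  rw [add_sub_cancel_right]

end

/-- The Chapman-Kolmogorov equation. -/
theorem IsOUData.evolOp_evolOp (h : IsOUData T U B f) {s r t : ℝ} (hs : 0 ≤ s) (hsr : s ≤ r)
    (hrt : r ≤ t) (ht : t ≤ T) {φ : X → E} (hφ : Continuous φ) {K : ℝ} (hK : ∀ x, ‖φ x‖ ≤ K) :
    evolOp U B f s r (evolOp U B f r t φ) = evolOp U B f s t φ := by
  ext x
  have hr : 0 ≤ r := hs.trans hsr
  have h1 := h.isGaussianLaw hs hsr (hrt.trans ht) x
  have h2 := h.isGaussianLaw hr hrt ht 0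
  have := h1.isProbabilityMeasure
  have := h2.isProbabilityMeasure
  have h3 := h1.isGaussianLaw_map_add h2 (h.traceClass s r hs hsr (hrt.trans ht)).1
    (h.traceClass r t hr hrt ht).1 (U t r)
  rw [← h.meanM_eq hs hsr hrt ht, ← h.covQ_eq_add hs hsr hrt ht] at h3
  -- The image of the first law under `U(t,r)` plus independent noise has the mean and covariance of
  -- the law from `s` to `t`.
  have h4 := (h.isGaussianLaw hs (hsr.trans hrt) ht x).unique h3
  have h5 : ∀ z, evolOp U B f r t φ z = ∫ y, φ (U t r z + y) ∂(noiseLaw U B f r t) :=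
    h.evolOp_eq hr hrt ht hφ
  conv_rhs => rw [evolOp, h4]
  rw [integral_map (by fun_prop) (Continuous.aestronglyMeasurable (by fun_prop)), integral_prod]
  · rw [evolOp]
    simp_rw [h5]
    rfl
  · exact (integrable_const K).mono' (Continuous.aestronglyMeasurable (by fun_prop))
      (ae_of_all _ fun y => hK _)

theorem integral_norm_le_sqrt {μ : Measure X} [IsProbabilityMeasure μ] {g : X → X}
    (hg : MemLp g 2 μ) : ∫ y, ‖g y‖ ∂μ ≤ √(∫ y, ‖g y‖ ^ 2 ∂μ) := by
  refine Real.le_sqrt_of_sq_le ?_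
  have h1 := variance_nonneg (fun y => ‖g y‖) μ
  rw [variance_eq_sub hg.norm] at h1
  have : ∫ y, ((fun y => ‖g y‖) ^ 2) y ∂μ = ∫ y, ‖g y‖ ^ 2 ∂μ := rfl
  linarith

/-- Chapman-Kolmogorov writes the difference as an average over the law from `s'` to `s` of
increments of `P_{s,t} φ`. The spread of that law, seen through `U(t,s)`, has second moment `tr
Q(t,s') - tr Q(t,s)`. -/
theorem IsOUData.abs_evolOp_sub_le (h : IsOUData T U B f) {s' s t : ℝ} (hs' : 0 ≤ s') (hs : s' ≤ s)
    (hst : s ≤ t) (ht : t ≤ T) {ι : Type*} (b : HilbertBasis ι ℝ X) {φ : X → ℝ} {L : ℝ≥0}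
    (hφ : LipschitzWith L φ) {K : ℝ} (hK : ∀ x, ‖φ x‖ ≤ K) (x' x : X) :
    |evolOp U B f s' t φ x' - evolOp U B f s t φ x| ≤
      L * (‖meanM U f t s' x' - meanM U f t s x‖ +
        √(∑' i, ⟪covQ U B t s' (b i), b i⟫ - ∑' i, ⟪covQ U B t s (b i), b i⟫)) := by
  have hs0 : 0 ≤ s := hs'.trans hs
  have hsT : s ≤ T := hst.trans ht
  have hlaw := h.isGaussianLaw hs' hs hsT x'
  have := hlaw.isProbabilityMeasure
  have hLip : ∀ z w, ‖φ z - φ w‖ ≤ L * ‖z - w‖ ^ (1 : ℝ) := fun z w => by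
    simpa [dist_eq_norm] using hφ.dist_le_mul z w
  set m := meanM U f s s' x' with hm
  set V := U t s with hV
  have hpt : ∀ z, ‖evolOp U B f s t φ z - evolOp U B f s t φ x‖ ≤
      L * ‖V m - V x‖ + L * ‖V (z - m)‖ := by
    intro z
    have h1 := h.norm_evolOp_sub_le hs0 hst ht hφ.continuous hK hLip z x
    rw [Real.rpow_one, ← hV] at h1
    have h2 : V (z - x) = (V m - V x) + V (z - m) := by simp only [map_sub]; abel
    rw [h2] at h1
    refine h1.trans ?_
    rw [← mul_add]
    exact mul_le_mul_of_nonneg_left (norm_add_le _ _) L.2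
  have hmem : MemLp (fun z => V (z - m)) 2 (gaussianMeasure m (covQ U B s s')) :=
    V.comp_memLp' hlaw.memLp_sub
  have hint : Integrable (fun z => L * ‖V m - V x‖ + L * ‖V (z - m)‖)
      (gaussianMeasure m (covQ U B s s')) :=
    (integrable_const _).add ((hmem.integrable one_le_two).norm.const_mul _)
  have hcont := h.continuous_evolOp hs0 hst ht hφ.continuous hK
  have hi1 : Integrable (fun z => evolOp U B f s t φ z) (gaussianMeasure m (covQ U B s s')) :=
    (integrable_const K).mono' hcont.aestronglyMeasurable
      (ae_of_all _ fun z => h.norm_evolOp_le hs0 hst ht hK z)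
  have e1 : evolOp U B f s' t φ x' - evolOp U B f s t φ x =
      ∫ z, (evolOp U B f s t φ z - evolOp U B f s t φ x) ∂(gaussianMeasure m (covQ U B s s')) := by
    rw [integral_sub hi1 (integrable_const _), ← h.evolOp_evolOp hs' hs hst ht hφ.continuous hK]
    simp [evolOp, hm]
  rw [← Real.norm_eq_abs, e1]
  refine (norm_integral_le_of_norm_le hint (ae_of_all _ hpt)).trans ?_
  rw [integral_add (integrable_const _) ((hmem.integrable one_le_two).norm.const_mul _),
    integral_const, probReal_univ, one_smul, integral_const_mul, ← mul_add]
  refine mul_le_mul_of_nonneg_left (add_le_add (le_of_eq ?_) ?_) L.2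
  · rw [h.meanM_eq hs' hs hst ht x', meanM_eq_add U f t s x, add_sub_add_right_eq_sub]
  · refine (integral_norm_le_sqrt hmem).trans (Real.sqrt_le_sqrt (le_of_eq ?_))
    rw [← (hlaw.hasSum_integral_norm_sq V b).tsum_eq,
      ← ((h.traceClass s' t hs' (hs.trans hst) ht).summable b).tsum_sub
        ((h.traceClass s t hs0 hst ht).summable b)]
    refine tsum_congr fun i => ?_
    rw [h.covQ_eq_add hs' hs hst ht, add_apply, inner_add_left, add_sub_cancel_right,
      ContinuousLinearMap.comp_apply, ContinuousLinearMap.comp_apply,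
      ← ContinuousLinearMap.adjoint_inner_right (U t s)]

/-- Weak convergence of the Gaussian laws need only be tested on bounded Lipschitz functions, where
the preceding estimate applies; it then covers every bounded continuous `φ`. -/
theorem IsOUData.continuousOn_evolOp (h : IsOUData T U B f) {t : ℝ} (ht0 : 0 ≤ t) (ht : t ≤ T)
    {φ : X → ℝ} (hφ : Continuous φ) {K : ℝ} (hK : ∀ x, ‖φ x‖ ≤ K) :
    ContinuousOn (fun p : ℝ × X => evolOp U B f p.1 t φ p.2) (Icc 0 t ×ˢ univ) := by
  obtain ⟨w, b, -⟩ := exists_hilbertBasis ℝ X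
  rw [continuousOn_iff_continuous_domRestrict, continuous_iff_continuousAt]
  set S := (Icc (0 : ℝ) t ×ˢ (univ : Set X)) with hS
  intro p₀
  have hlaw : ∀ p : S, IsGaussianLaw (meanM U f t p.1.1 p.1.2) (covQ U B t p.1.1)
      (gaussianMeasure (meanM U f t p.1.1 p.1.2) (covQ U B t p.1.1)) := fun p =>
    h.isGaussianLaw p.2.1.1 p.2.1.2 ht p.1.2
  set μs : S → ProbabilityMeasure X := fun p => ⟨_, (hlaw p).isProbabilityMeasure⟩ with hμs
  have hconv : Tendsto μs (𝓝 p₀) (𝓝 (μs p₀)) := by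
    rw [tendsto_iff_forall_lipschitz_integral_tendsto]
    rintro φ ⟨C, hC⟩ ⟨L, hL⟩
    have hb : ∀ x, ‖φ x‖ ≤ ‖φ 0‖ + C := fun x => by
      have h1 := hC x 0
      rw [dist_eq_norm] at h1
      have h2 := norm_add_le (φ x - φ 0) (φ 0)
      rw [sub_add_cancel] at h2
      linarith
    have hm : Continuous fun p : S => meanM U f t p.1.1 p.1.2 :=
      continuousOn_iff_continuous_domRestrict.1 (h.continuousOn_meanM ht0 ht)
    have htr : Continuous fun p : S => ∑' i, ⟪covQ U B t p.1.1 (b i), b i⟫ :=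
      (h.continuousOn_trace ht0 ht b).comp_continuous (by fun_prop) fun p => p.2.1
    have hbound : ∀ p : S, |evolOp U B f p.1.1 t φ p.1.2 - evolOp U B f p₀.1.1 t φ p₀.1.2| ≤
        L * (‖meanM U f t p.1.1 p.1.2 - meanM U f t p₀.1.1 p₀.1.2‖ +
          √|∑' i, ⟪covQ U B t p.1.1 (b i), b i⟫ - ∑' i, ⟪covQ U B t p₀.1.1 (b i), b i⟫|) := by
      intro p
      rcases le_total p.1.1 p₀.1.1 with hle | hle
      · refine (h.abs_evolOp_sub_le p.2.1.1 hle p₀.2.1.2 ht b hL hb _ _).trans ?_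
        gcongr
        exact le_abs_self _
      · rw [abs_sub_comm, norm_sub_rev, abs_sub_comm (∑' i, ⟪covQ U B t p.1.1 (b i), b i⟫)]
        refine (h.abs_evolOp_sub_le p₀.2.1.1 hle p.2.1.2 ht b hL hb _ _).trans ?_
        gcongr
        exact le_abs_self _
    have hlim : Tendsto (fun p : S => L * (‖meanM U f t p.1.1 p.1.2 - meanM U f t p₀.1.1 p₀.1.2‖ +
          √|∑' i, ⟪covQ U B t p.1.1 (b i), b i⟫ - ∑' i, ⟪covQ U B t p₀.1.1 (b i), b i⟫|))
        (𝓝 p₀) (𝓝 0) := by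
      have hc : Continuous fun p : S =>
          (L : ℝ) * (‖meanM U f t p.1.1 p.1.2 - meanM U f t p₀.1.1 p₀.1.2‖ +
          √|∑' i, ⟪covQ U B t p.1.1 (b i), b i⟫ - ∑' i, ⟪covQ U B t p₀.1.1 (b i), b i⟫|) := by
        fun_prop
      have := hc.tendsto p₀
      simpa using this
    rw [tendsto_iff_norm_sub_tendsto_zero]
    exact squeeze_zero (fun _ => norm_nonneg _) hbound hlim
  have h1 := ProbabilityMeasure.tendsto_iff_forall_integral_tendsto.1 hconv
    (BoundedContinuousFunction.ofNormedAddCommGroup φ hφ K hK)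
  exact h1

/-- The function `(σ, y) ↦ P_{r,σ} ψ(σ,·) (y)` is measurable. -/
theorem IsOUData.aestronglyMeasurable_evolOp (h : IsOUData T U B f) {r t : ℝ} (hr : 0 ≤ r)
    (ht : t ≤ T) {ψ : ℝ → X → ℝ}
    (hψ : ContinuousOn (fun p : ℝ × X => ψ p.1 p.2) (Icc 0 t ×ˢ univ)) {K : ℝ}
    (hK : ∀ σ ∈ Icc 0 t, ∀ x, |ψ σ x| ≤ K) (ν : Measure X) [SFinite ν] :
    AEStronglyMeasurable (fun p : ℝ × X => evolOp U B f r p.1 (ψ p.1) p.2)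
      ((volume.restrict (Ioc r t)).prod ν) := by
  rcases lt_or_ge t r with hrt | hrt
  · rw [Ioc_eq_empty (by simpa using hrt.le)]; simp
  have ht0 : 0 ≤ t := hr.trans hrt
  -- Clamping the time to `[0,t]` extends `ψ` to a globally continuous function without changing it
  -- where it is used.
  have hcont : Continuous fun p : ℝ × X => ψ (clampTime t p.1) p.2 := by
    have := continuous_clampTime t
    exact hψ.comp_continuous (f := fun p : ℝ × X => (clampTime t p.1, p.2)) (by fun_prop)
      fun p => ⟨clampTime_mem ht0 _, mem_univ _⟩
  have hmem : ∀ᵐ p ∂((volume.restrict (Ioc r t)).prod ν), p.1 ∈ Ioc r t :=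
    Measure.quasiMeasurePreserving_fst.ae (ae_restrict_mem measurableSet_Ioc)
  obtain ⟨M, hM⟩ := h.exists_covQ_bound
  have h1 := aestronglyMeasurable_integral_gaussianMeasure hcont
    (fun p => hK _ (clampTime_mem ht0 _) _)
    (measurable_fst.aestronglyMeasurable (μ := (volume.restrict (Ioc r t)).prod ν))
    (h.aestronglyMeasurable_meanM hr ht ν) (Q := fun p => covQ U B p.1 r)
    (fun x => (h.aestronglyMeasurable_covQ hr ht x).comp_fst) (M := M) (by
      filter_upwards [hmem] with p hp
      exact ⟨h.traceClass r p.1 hr hp.1.le (hp.2.trans ht), hM r p.1 hr hp.1.le (hp.2.trans ht)⟩)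
  refine h1.congr ?_
  filter_upwards [hmem] with p hp
  rw [clampTime_of_mem ⟨hr.trans hp.1.le, hp.2⟩]
  rfl

end EvolutionOperators

end OrnsteinUhlenbeck

end

noncomputable section

namespace OrnsteinUhlenbeck

open Filter Topology

/-! ### First-order smoothing. -/

section Smoothing

variable {X : Type*} [NormedAddCommGroup X] [InnerProductSpace ℝ X] [CompleteSpace X]
  {T θ : ℝ} {U : ℝ → ℝ → X →L[ℝ] X} {B : ℝ → X →L[ℝ] X} {f : ℝ → X}
  {E : Type*} [NormedAddCommGroup E] [NormedSpace ℝ E] [CompleteSpace E]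

/-- Subtracting the projection onto the kernel turns any preimage into one orthogonal to the kernel.
-/
theorem apply_pseudoInverse {S : X →L[ℝ] X} {x : X} (hx : x ∈ range S) :
    S (pseudoInverse S x) = x := by
  obtain ⟨z, rfl⟩ := hx
  have h : ∃ y, y ∈ (LinearMap.ker (S : X →ₗ[ℝ] X))ᗮ ∧ S y = S z := by
    set N := LinearMap.ker (S : X →ₗ[ℝ] X) with hN
    have hclosed : IsClosed (N : Set X) := S.isClosed_ker
    have : CompleteSpace N := hclosed.completeSpace_coe
    refine ⟨z - N.starProjection z, Submodule.sub_starProjection_mem_orthogonal z, ?_⟩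
    have : S (N.starProjection z) = 0 := N.starProjection_apply_mem z
    rw [map_sub, this, sub_zero]
  unfold pseudoInverse
  rw [dif_pos h]
  exact h.choose_spec.2

/-- This packages all that is used of (H2) and (H3): a Cameron-Martin preimage of `U(t,s)h` with
controlled norm. Minimality of the preimage plays no role. -/
theorem PowerBlowUp.exists_opSqrt_apply_eq (hrange : RangeCondition T U B)
    (hblow : PowerBlowUp T θ U B) : ∃ c : ℝ, 1 ≤ c ∧ ∀ s t, 0 ≤ s → s < t → t ≤ T → ∀ h,
      ∃ w, opSqrt (covQ U B t s) w = U t s h ∧ ‖w‖ ≤ c * (t - s) ^ (-θ) * ‖h‖ := by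
  obtain ⟨c, hc⟩ := hblow
  refine ⟨max c 1, le_max_right _ _, fun s t hs hst ht h => ⟨Lam U B t s h, ?_, ?_⟩⟩
  · exact apply_pseudoInverse (hrange s t hs hst ht (mem_range_self h))
  · refine (hc s t hs hst ht h).trans ?_
    have : 0 ≤ (t - s) ^ (-θ) := Real.rpow_nonneg (by linarith) _
    gcongr
    exact le_max_left _ _

theorem lipschitz_of_hasLineDerivAt {F : Type*} [NormedAddCommGroup F] [NormedSpace ℝ F]
    {g : F → E} {d : F → F → E} {L : ℝ}
    (hd : ∀ x h, HasLineDerivAt ℝ g (d x h) x h) (hL : ∀ x h, ‖d x h‖ ≤ L * ‖h‖) (x y : F) :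
    ‖g x - g y‖ ≤ L * ‖x - y‖ := by
  have hderiv : ∀ t : ℝ, HasDerivAt (fun t : ℝ => g (y + t • (x - y))) (d (y + t • (x - y)) (x - y))
      t := by
    intro t
    have h1 := hd (y + t • (x - y)) (x - y)
    unfold HasLineDerivAt at h1
    have h2 : HasDerivAt (fun r : ℝ => r - t) 1 t := (hasDerivAt_id t).sub_const t
    rw [← sub_self t] at h1
    have h3 := HasDerivAt.scomp (h := fun r : ℝ => r - t) t h1 h2
    rw [one_smul] at h3
    refine h3.congr_of_eventuallyEq (Eventually.of_forall fun r => ?_)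
    simp only [Function.comp_apply]
    congr 1
    rw [sub_smul]
    abel
  have := norm_image_sub_le_of_norm_deriv_le_segment_01' (C := L * ‖x - y‖)
    (fun t _ => (hderiv t).hasDerivWithinAt) fun t _ => hL _ _
  simpa using this

variable [TopologicalSpace.SeparableSpace X] [MeasurableSpace X] [BorelSpace X]

/-- The operators `P_{s,t}` make bounded continuous functions differentiable along lines. -/
theorem IsOUData.exists_hasLineDerivAt_evolOp (h : IsOUData T U B f) (hrange : RangeCondition T U B)
    (hblow : PowerBlowUp T θ U B) : ∃ C : ℝ, 0 ≤ C ∧ ∀ s t, 0 ≤ s → s < t → t ≤ T →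
      ∀ (φ : X → E) (K A α : ℝ), Continuous φ → (∀ x, ‖φ x‖ ≤ K) → 0 ≤ α → α < 1 → 0 ≤ A →
      (∀ x y, ‖φ x - φ y‖ ≤ A * ‖x - y‖ ^ α) → ∀ x k, ∃ d : E,
        HasLineDerivAt ℝ (evolOp U B f s t φ) d x k ∧
          ‖d‖ ≤ C * A * (t - s) ^ (-((1 - α) * θ)) * ‖k‖ := by
  obtain ⟨c, hc1, hc⟩ := hblow.exists_opSqrt_apply_eq hrange
  obtain ⟨M, hM1, hM⟩ := h.evolution.exists_bound
  refine ⟨2 * (c * M), by positivity, ?_⟩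
  intro s t hs hst ht φ K A α hφ hK hα hα1 hA hosc x k
  -- Only `‖w‖` blows up, like `(t-s)^{-θ}`, while `‖Q^{1/2} w‖ = ‖U(t,s)k‖` stays bounded; hence
  -- the exponent `(1-α)θ`.
  obtain ⟨w, hw, hwn⟩ := hc s t hs hst ht k
  obtain ⟨d, hd, hdn⟩ := exists_hasDerivAt_integral_gaussianMeasure (h.traceClass s t hs hst.le ht)
    w (φ := fun y => φ (meanM U f t s x + y)) (by fun_prop) (fun x => hK _) hα hα1 hA
    (fun y z => (hosc _ _).trans (le_of_eq (by rw [add_sub_add_left_eq_sub])))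
  refine ⟨d, ?_, hdn.trans ?_⟩
  · refine hd.congr_of_eventuallyEq (Eventually.of_forall fun r => ?_)
    simp only
    rw [h.evolOp_eq_centered hs hst.le ht hφ, hw]
    refine integral_congr_ae (ae_of_all _ fun y => ?_)
    simp only [meanM_eq_add U f t s (x + r • k), meanM_eq_add U f t s x, map_add, map_smul]
    congr 1
    abel
  · have ht0 : 0 < t - s := sub_pos.2 hst
    have h1 : ‖w‖ ^ (1 - α) ≤ (c * (t - s) ^ (-θ) * ‖k‖) ^ (1 - α) :=
      Real.rpow_le_rpow (norm_nonneg _) hwn (by linarith)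
    have h2 : ‖opSqrt (covQ U B t s) w‖ ^ α ≤ (M * ‖k‖) ^ α := by
      rw [hw]
      exact Real.rpow_le_rpow (norm_nonneg _)
        (((U t s).le_opNorm k).trans (by gcongr; exact hM s t hs hst.le ht)) hα
    have h3 : (c * (t - s) ^ (-θ) * ‖k‖) ^ (1 - α) * (M * ‖k‖) ^ α ≤
        c * M * (t - s) ^ (-((1 - α) * θ)) * ‖k‖ := by
      have e1 : ((t - s) ^ (-θ)) ^ (1 - α) = (t - s) ^ (-((1 - α) * θ)) := by
        rw [← Real.rpow_mul ht0.le]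
        congr 1
        ring
      have e2 : ‖k‖ ^ (1 - α) * ‖k‖ ^ α = ‖k‖ := by
        rw [← Real.rpow_add_of_nonneg (norm_nonneg _) (by linarith) hα, sub_add_cancel,
          Real.rpow_one]
      have e3 : c ^ (1 - α) ≤ c := by
        simpa using Real.rpow_le_rpow_of_exponent_le hc1 (show 1 - α ≤ 1 by linarith)
      have e4 : M ^ α ≤ M := by
        simpa using Real.rpow_le_rpow_of_exponent_le hM1 hα1.le
      have hp : 0 ≤ (t - s) ^ (-θ) := Real.rpow_nonneg ht0.le _
      rw [Real.mul_rpow (by positivity) (norm_nonneg _), Real.mul_rpow (by positivity) hp, e1,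
        Real.mul_rpow (by positivity) (norm_nonneg _)]
      have hp' : 0 ≤ (t - s) ^ (-((1 - α) * θ)) := Real.rpow_nonneg ht0.le _
      calc c ^ (1 - α) * (t - s) ^ (-((1 - α) * θ)) * ‖k‖ ^ (1 - α) * (M ^ α * ‖k‖ ^ α)
          = c ^ (1 - α) * M ^ α * (t - s) ^ (-((1 - α) * θ)) * (‖k‖ ^ (1 - α) * ‖k‖ ^ α) := by ring
        _ ≤ c * M * (t - s) ^ (-((1 - α) * θ)) * ‖k‖ := by
          rw [e2]
          gcongr
    calc 2 * A * (‖w‖ ^ (1 - α) * ‖opSqrt (covQ U B t s) w‖ ^ α)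
        ≤ 2 * A * ((c * (t - s) ^ (-θ) * ‖k‖) ^ (1 - α) * (M * ‖k‖) ^ α) := by gcongr
      _ ≤ 2 * A * (c * M * (t - s) ^ (-((1 - α) * θ)) * ‖k‖) := by gcongr
      _ = _ := by ring

/-- The operators `P_{s,t}` map bounded continuous functions to `C¹` functions. -/
theorem IsOUData.exists_norm_fderiv_evolOp_le (h : IsOUData T U B f)
    (hrange : RangeCondition T U B) (hblow : PowerBlowUp T θ U B) :
    ∃ C : ℝ, 0 ≤ C ∧ ∀ s t, 0 ≤ s → s < t → t ≤ T →
      ∀ (φ : X → E) (K A α : ℝ), Continuous φ → (∀ x, ‖φ x‖ ≤ K) → 0 ≤ α → α < 1 → 0 ≤ A →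
      (∀ x y, ‖φ x - φ y‖ ≤ A * ‖x - y‖ ^ α) → ContDiff ℝ 1 (evolOp U B f s t φ) ∧
        ∀ x, ‖fderiv ℝ (evolOp U B f s t φ) x‖ ≤ C * A * (t - s) ^ (-((1 - α) * θ)) := by
  obtain ⟨C, hC0, hC⟩ := h.exists_hasLineDerivAt_evolOp (E := E) hrange hblow
  obtain ⟨M, hM1, hM⟩ := h.evolution.exists_bound
  -- Boundedness is recast as the oscillation condition with `α = 0` and constant `2K`.
  have hosc0 : ∀ {φ : X → E} {K : ℝ}, (∀ x, ‖φ x‖ ≤ K) →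
      ∀ x y, ‖φ x - φ y‖ ≤ 2 * K * ‖x - y‖ ^ (0 : ℝ) := by
    intro φ K hK x y
    rw [Real.rpow_zero, mul_one, two_mul]
    exact (norm_sub_le _ _).trans (add_le_add (hK x) (hK y))
  have hK0 : ∀ {φ : X → E} {K : ℝ}, (∀ x, ‖φ x‖ ≤ K) → 0 ≤ 2 * K := by
    intro φ K hK
    have := (norm_nonneg _).trans (hK 0)
    positivity
  have hlip : ∀ s t, 0 ≤ s → s < t → t ≤ T → ∀ (φ : X → E) (K L : ℝ), Continuous φ →
      (∀ x, ‖φ x‖ ≤ K) → 0 ≤ L → (∀ x y, ‖φ x - φ y‖ ≤ L * ‖x - y‖) →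
      ContDiff ℝ 1 (evolOp U B f s t φ) := by
    intro s t hs hst ht φ K L hφ hK hL hφL
    have hd := hC s t hs hst ht φ K _ 0 hφ hK le_rfl one_pos (hK0 hK) (hosc0 hK)
    choose d hd hdn using hd
    have hp : 0 ≤ (t - s) ^ (-((1 - 0) * θ)) := Real.rpow_nonneg (by linarith) _
    refine contDiff_one_of_hasLineDerivAt (d := d)
      (L := C * (2 * (L * M)) * (t - s) ^ (-((1 - 0) * θ))) (by positivity) hd ?_ hdn
    intro x y k
    -- The difference of the line derivatives at `x` and `y` is a line derivative of `P ψ` at `0`,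
    -- and `ψ` has sup norm at most `L M ‖x - y‖`.
    set ψ : X → E := fun z => φ (U t s x + z) - φ (U t s y + z) with hψ
    have hψK : ∀ z, ‖ψ z‖ ≤ L * M * ‖x - y‖ := by
      intro z
      refine (hφL _ _).trans ?_
      rw [add_sub_add_right_eq_sub, ← map_sub, mul_assoc]
      exact mul_le_mul_of_nonneg_left (((U t s).le_opNorm _).trans
        (mul_le_mul_of_nonneg_right (hM s t hs hst.le ht) (norm_nonneg _))) hL
    obtain ⟨e, he, hen⟩ := hC s t hs hst ht ψ _ _ 0 (by fun_prop) hψK le_rfl one_pos (hK0 hψK)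
      (hosc0 hψK) 0 k
    have h1 : d x k - d y k = e := by
      have hxy : HasLineDerivAt ℝ (evolOp U B f s t ψ) (d x k - d y k) 0 k := by
        have hxx := hd x k
        have hyy := hd y k
        unfold HasLineDerivAt at hxx hyy ⊢
        refine (hxx.sub hyy).congr_of_eventuallyEq (Eventually.of_forall fun r => ?_)
        simp only [Pi.sub_apply, hψ]
        rw [h.evolOp_sub hs hst.le ht (φ := fun z => φ (U t s x + z))
          (ψ := fun z => φ (U t s y + z)) (by fun_prop) (by fun_prop) (fun x => hK _)
          (fun x => hK _), ← h.evolOp_comp_add hs hst.le ht hφ,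
          ← h.evolOp_comp_add hs hst.le ht hφ, zero_add, add_comm _ x, add_comm _ y]
      exact hxy.unique he
    rw [h1]
    refine hen.trans (le_of_eq ?_)
    ring
  refine ⟨C, hC0, fun s t hs hst ht φ K A α hφ hK hα hα1 hA hosc => ?_⟩
  have hcd : ContDiff ℝ 1 (evolOp U B f s t φ) := by
    -- The later half of the time interval makes a merely continuous `φ` Lipschitz; the earlier half
    -- then makes it `C¹`.
    set r := (s + t) / 2 with hr
    have hsr : s < r := by rw [hr]; linarith
    have hrt : r < t := by rw [hr]; linarith
    have hr0 : 0 ≤ r := hs.trans hsr.le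
    rw [← h.evolOp_evolOp hs hsr.le hrt.le ht hφ hK]
    have hd := hC r t hr0 hrt ht φ K _ 0 hφ hK le_rfl one_pos (hK0 hK) (hosc0 hK)
    choose d hd hdn using hd
    have hp : 0 ≤ (t - r) ^ (-((1 - 0) * θ)) := Real.rpow_nonneg (by linarith) _
    have hk := hK0 hK
    exact hlip s r hs hsr (hrt.le.trans ht) _ K _ (h.continuous_evolOp hr0 hrt.le ht hφ hK)
      (h.norm_evolOp_le hr0 hrt.le ht hK) (by positivity) (lipschitz_of_hasLineDerivAt hd hdn)
  refine ⟨hcd, fun x => ?_⟩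
  have hp : 0 ≤ (t - s) ^ (-((1 - α) * θ)) := Real.rpow_nonneg (by linarith) _
  refine ContinuousLinearMap.opNorm_le_bound _ (by positivity) fun k => ?_
  obtain ⟨d, hd, hdn⟩ := hC s t hs hst ht φ K A α hφ hK hα hα1 hA hosc x k
  rw [((hcd.differentiable one_ne_zero x).hasFDerivAt.hasLineDerivAt k).unique hd]
  exact hdn

section

variable (h : IsOUData T U B f) {s t : ℝ} (hs : 0 ≤ s) (hst : s ≤ t) (ht : t ≤ T)
include h hs hst ht

/-- Differentiation under the integral sign. -/
theorem IsOUData.hasFDerivAt_evolOp {g : X → E} (hg : ContDiff ℝ 1 g) {K K' : ℝ}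
    (hK : ∀ x, ‖g x‖ ≤ K) (hK' : ∀ x, ‖fderiv ℝ g x‖ ≤ K') (x : X) :
    HasFDerivAt (evolOp U B f s t g) (evolOp U B f s t (fderiv ℝ g) x ∘L U t s) x := by
  have := h.isProbabilityMeasure_noiseLaw hs hst ht
  have hg' : Continuous (fderiv ℝ g) := hg.continuous_fderiv one_ne_zero
  have hgc : Continuous g := hg.continuous
  have h1 : HasFDerivAt (fun z => ∫ y, g (z + y) ∂(noiseLaw U B f s t))
      (∫ y, fderiv ℝ g (U t s x + y) ∂(noiseLaw U B f s t)) (U t s x) := by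
    refine hasFDerivAt_integral_of_dominated_of_fderiv_le (F' := fun z y => fderiv ℝ g (z + y))
      (bound := fun _ => K') univ_mem (Eventually.of_forall fun z => ?_)
      (h.integrable_noiseLaw hs hst ht hgc hK _) ?_ (ae_of_all _ fun y z _ => hK' _)
      (integrable_const _) (ae_of_all _ fun y z _ => ?_)
    · exact Continuous.aestronglyMeasurable (by fun_prop)
    · exact Continuous.aestronglyMeasurable (by fun_prop)
    · exact (hasFDerivAt_comp_add_right y).2 (hg.differentiable one_ne_zero _).hasFDerivAt
  rw [← h.evolOp_eq hs hst ht hg'] at h1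
  refine (h1.comp x (U t s).hasFDerivAt).congr_of_eventuallyEq (Eventually.of_forall fun z => ?_)
  exact h.evolOp_eq hs hst ht hgc z

/-- Composition with `U(t,s)` is written as one fixed continuous linear map applied to `P(Dg)`, so
bounds for `P(Dg)` transfer order by order. -/
theorem IsOUData.fderiv_evolOp {g : X → E} (hg : ContDiff ℝ 1 g) {K K' : ℝ}
    (hK : ∀ x, ‖g x‖ ≤ K) (hK' : ∀ x, ‖fderiv ℝ g x‖ ≤ K') :
    fderiv ℝ (evolOp U B f s t g) = fun x =>
      (ContinuousLinearMap.compL ℝ X X E).flip (U t s) (evolOp U B f s t (fderiv ℝ g) x) :=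
  funext fun x => (h.hasFDerivAt_evolOp hs hst ht hg hK hK' x).fderiv

end

end Smoothing

end OrnsteinUhlenbeck

end

noncomputable section

namespace OrnsteinUhlenbeck

open Filter Topology

-- Derivatives of every order.

universe u v

/-- `g` is `n` times continuously differentiable, with `‖D^j g‖ ≤ K j` for `j ≤ n`. -/
def DerivBound {V E : Type*} [NormedAddCommGroup V] [NormedSpace ℝ V] [NormedAddCommGroup E]
    [NormedSpace ℝ E] (n : ℕ) (K : ℕ → ℝ) (g : V → E) : Prop :=
  ContDiff ℝ n g ∧ ∀ j ≤ n, ∀ x, ‖iteratedFDeriv ℝ j g x‖ ≤ K j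

section

variable {V E : Type*} [NormedAddCommGroup V] [NormedSpace ℝ V] [NormedAddCommGroup E]
    [NormedSpace ℝ E] {n : ℕ} {K : ℕ → ℝ} {g : V → E}

theorem DerivBound.norm_le (h : DerivBound n K g) (x : V) : ‖g x‖ ≤ K 0 := by
  simpa using h.2 0 (Nat.zero_le _) x

theorem DerivBound.norm_fderiv_le (h : DerivBound (n + 1) K g) (x : V) : ‖fderiv ℝ g x‖ ≤ K 1 := by
  have := h.2 1 (by omega) x
  rwa [norm_iteratedFDeriv_one] at this

theorem DerivBound.fderiv (h : DerivBound (n + 1) K g) :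
    DerivBound n (fun j => K (j + 1)) (fderiv ℝ g) := by
  refine ⟨h.1.fderiv_right (by push_cast; rfl), fun j hj x => ?_⟩
  rw [norm_iteratedFDeriv_fderiv]
  exact h.2 (j + 1) (by omega) x

theorem DerivBound.of_fderiv (hd : Differentiable ℝ g) (h0 : ∀ x, ‖g x‖ ≤ K 0)
    (h : DerivBound n (fun j => K (j + 1)) (_root_.fderiv ℝ g)) : DerivBound (n + 1) K g := by
  refine ⟨?_, fun j hj x => ?_⟩
  · push_cast
    exact contDiff_succ_iff_fderiv.2 ⟨hd, by simp, h.1⟩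
  · cases j with
    | zero => simpa using h0 x
    | succ j =>
      rw [← norm_iteratedFDeriv_fderiv]
      exact h.2 j (by omega) x

theorem DerivBound.clm_comp {F : Type*} [NormedAddCommGroup F] [NormedSpace ℝ F]
    (h : DerivBound n K g) (L : E →L[ℝ] F) {M : ℝ} (hL : ‖L‖ ≤ M) :
    DerivBound n (fun j => M * K j) (fun x => L (g x)) := by
  refine ⟨L.contDiff.comp h.1, fun j hj x => ?_⟩
  refine (L.norm_iteratedFDeriv_comp_left (h.1.contDiffAt) (by exact_mod_cast hj)).trans ?_
  exact mul_le_mul hL (h.2 j hj x) (norm_nonneg _) ((norm_nonneg _).trans hL)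

theorem DerivBound.mono {K' : ℕ → ℝ} (h : DerivBound n K g) (hK : ∀ j ≤ n, K j ≤ K' j) :
    DerivBound n K' g :=
  ⟨h.1, fun j hj x => (h.2 j hj x).trans (hK j hj)⟩

end

section HigherDerivatives

theorem norm_compL_flip_le {X : Type*} [NormedAddCommGroup X] [NormedSpace ℝ X] {E : Type*}
    [NormedAddCommGroup E] [NormedSpace ℝ E] (V : X →L[ℝ] X) :
    ‖(ContinuousLinearMap.compL ℝ X X E).flip V‖ ≤ ‖V‖ := by
  refine ContinuousLinearMap.opNorm_le_bound _ (norm_nonneg _) fun L => ?_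
  rw [ContinuousLinearMap.flip_apply, ContinuousLinearMap.compL_apply, mul_comm]
  exact L.opNorm_comp_le V

variable {X : Type u} [NormedAddCommGroup X] [InnerProductSpace ℝ X] [CompleteSpace X]
  [TopologicalSpace.SeparableSpace X] [MeasurableSpace X] [BorelSpace X]
  {T θ : ℝ} {U : ℝ → ℝ → X →L[ℝ] X} {B : ℝ → X →L[ℝ] X} {f : ℝ → X}

/-- The operator `P_{s,t}` maps `C^n_b(X;E)` to itself, with explicit bounds. -/
def PreservesDerivBound (U : ℝ → ℝ → X →L[ℝ] X) (B : ℝ → X →L[ℝ] X) (f : ℝ → X) (s t M : ℝ) (n : ℕ)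
    (E : Type*) [NormedAddCommGroup E] [NormedSpace ℝ E] : Prop :=
  ∀ (g : X → E) (K : ℕ → ℝ), DerivBound n K g →
    DerivBound n (fun j => M ^ j * K j) (evolOp U B f s t g)

/-- The operators `P_{s,t}` map `C^α_b(X;E)` to `C^n_b(X;E)`, with the natural bounds. -/
def SmoothingBound (T θ : ℝ) (U : ℝ → ℝ → X →L[ℝ] X) (B : ℝ → X →L[ℝ] X) (f : ℝ → X) (n : ℕ)
    (E : Type*) [NormedAddCommGroup E] [NormedSpace ℝ E] : Prop :=
  ∃ C : ℝ, 0 ≤ C ∧ ∀ s t, 0 ≤ s → s < t → t ≤ T →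
    ∀ (φ : X → E) (K A α : ℝ), Continuous φ → (∀ x, ‖φ x‖ ≤ K) → 0 ≤ α → α < 1 → 0 ≤ A →
      (∀ x y, ‖φ x - φ y‖ ≤ A * ‖x - y‖ ^ α) → ContDiff ℝ n (evolOp U B f s t φ) ∧
        ∀ j < n, ∀ x, ‖iteratedFDeriv ℝ (j + 1) (evolOp U B f s t φ) x‖ ≤
          C * A * (t - s) ^ (-((j + 1 - α) * θ))

section

variable (h : IsOUData T U B f) {s t : ℝ} (hs : 0 ≤ s) (hst : s ≤ t) (ht : t ≤ T) {M : ℝ}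
  (hM : ‖U t s‖ ≤ M) {n : ℕ}
include h hs hst ht

theorem IsOUData.preservesDerivBound_zero (E : Type*) [NormedAddCommGroup E] [NormedSpace ℝ E]
    [CompleteSpace E] : PreservesDerivBound U B f s t M 0 E := by
  intro g K hg
  refine ⟨?_, fun j hj x => ?_⟩
  · exact contDiff_zero.2 (h.continuous_evolOp hs hst ht hg.1.continuous hg.norm_le)
  · obtain rfl : j = 0 := by omega
    simpa using h.norm_evolOp_le hs hst ht hg.norm_le x

include hM

/-- Each derivative costs one factor `‖U(t,s)‖` by the commutation formula. -/
theorem IsOUData.preservesDerivBound_succ (E : Type*) [NormedAddCommGroup E] [NormedSpace ℝ E]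
    [CompleteSpace E] (IH : PreservesDerivBound U B f s t M n (X →L[ℝ] E)) :
    PreservesDerivBound U B f s t M (n + 1) E := by
  intro g K hg
  have hg1 : ContDiff ℝ 1 g := hg.1.of_le (by exact_mod_cast Nat.le_add_left 1 n)
  refine DerivBound.of_fderiv
    (fun x => (h.hasFDerivAt_evolOp hs hst ht hg1 hg.norm_le hg.norm_fderiv_le x).differentiableAt)
    (by simpa using h.norm_evolOp_le hs hst ht hg.norm_le) ?_
  rw [h.fderiv_evolOp hs hst ht hg1 hg.norm_le hg.norm_fderiv_le]
  refine ((IH _ _ hg.fderiv).clm_comp _ ((norm_compL_flip_le (U t s)).trans hM)).mono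
    fun j _ => le_of_eq (by ring)

/-- The codomain changes from `E` to `X →L[ℝ] E` in the induction, so `E` is quantified inside and
lives in a universe that already contains that of `X`. -/
theorem IsOUData.preservesDerivBound_aux (n : ℕ) : ∀ (E : Type (max u v)) [NormedAddCommGroup E]
    [NormedSpace ℝ E] [CompleteSpace E], PreservesDerivBound U B f s t M n E := by
  induction n with
  | zero =>
    intro E _ _ _
    exact h.preservesDerivBound_zero hs hst ht E
  | succ n IH =>
    intro E _ _ _
    exact h.preservesDerivBound_succ hs hst ht hM E (IH (X →L[ℝ] E))

theorem IsOUData.preservesDerivBound (n : ℕ) (E : Type v) [NormedAddCommGroup E]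
    [NormedSpace ℝ E] [CompleteSpace E] : PreservesDerivBound U B f s t M n E := by
  cases n with
  | zero => exact h.preservesDerivBound_zero hs hst ht E
  | succ n =>
    exact h.preservesDerivBound_succ hs hst ht hM E
      (IsOUData.preservesDerivBound_aux.{u, v} h hs hst ht hM n (X →L[ℝ] E))

end

section

variable (h : IsOUData T U B f) (hθ : 0 < θ) (hrange : RangeCondition T U B)
  (hblow : PowerBlowUp T θ U B)
include h

theorem IsOUData.smoothingBound_zero (E : Type*) [NormedAddCommGroup E] [NormedSpace ℝ E]
    [CompleteSpace E] : SmoothingBound T θ U B f 0 E :=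
  ⟨0, le_rfl, fun s t hs hst ht φ K A α hφ hK _ _ _ _ =>
    ⟨contDiff_zero.2 (h.continuous_evolOp hs hst.le ht hφ hK), fun j hj => by omega⟩⟩

include hrange hblow hθ

/-- The later half of the time produces one derivative with cost `δ^{-(1-α)θ}`; the formula
`D(P_{s,r} g) = (P_{s,r} Dg) ∘ U(r,s)` leaves the remaining ones to the earlier half. -/
theorem IsOUData.smoothingBound_succ {n : ℕ} (E : Type*) [NormedAddCommGroup E] [NormedSpace ℝ E]
    [CompleteSpace E] (IH : SmoothingBound T θ U B f n (X →L[ℝ] E)) :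
    SmoothingBound T θ U B f (n + 1) E := by
  obtain ⟨C₁, hC₁0, hC₁⟩ := h.exists_norm_fderiv_evolOp_le (E := E) hrange hblow
  obtain ⟨C₂, hC₂0, hC₂⟩ := IH
  obtain ⟨M, hM1, hM⟩ := h.evolution.exists_bound
  refine ⟨M * (2 * C₂ + 1) * C₁ * 2 ^ ((n + 1) * θ), by positivity, ?_⟩
  intro s t hs hst ht φ K A α hφ hK hα hα1 hA hosc
  set r := (s + t) / 2 with hr
  have hsr : s < r := by rw [hr]; linarith
  have hrt : r < t := by rw [hr]; linarith
  have hr0 : 0 ≤ r := hs.trans hsr.le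
  have hrT : r ≤ T := hrt.le.trans ht
  have ht0 : 0 < t - s := sub_pos.2 hst
  set δ := (t - s) / 2 with hδ
  have hδ0 : 0 < δ := by positivity
  have hrs : r - s = δ := by rw [hr, hδ]; ring
  have htr : t - r = δ := by rw [hr, hδ]; ring
  set g := evolOp U B f r t φ with hg
  obtain ⟨hg1, hgK⟩ := hC₁ r t hr0 hrt ht φ K A α hφ hK hα hα1 hA hosc
  rw [← hg, htr] at hgK
  rw [← hg] at hg1
  set K₁ := C₁ * A * δ ^ (-((1 - α) * θ)) with hK₁
  have hK₁0 : 0 ≤ K₁ := by positivity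
  have hg'c : Continuous (_root_.fderiv ℝ g) := hg1.continuous_fderiv one_ne_zero
  -- Only boundedness of `Dg` is used, hence `α = 0` and constant `2 K₁`. In `2 C₂ + 1` below, the
  -- `1` covers order zero.
  obtain ⟨hD, hDj⟩ := hC₂ s r hs hsr hrT (_root_.fderiv ℝ g) K₁ (2 * K₁) 0 hg'c hgK le_rfl one_pos
    (by positivity) (fun x y => by
      rw [Real.rpow_zero, mul_one, two_mul]
      exact (norm_sub_le _ _).trans (add_le_add (hgK x) (hgK y)))
  have hgb : ∀ x, ‖g x‖ ≤ K := h.norm_evolOp_le hr0 hrt.le ht hK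
  have hfd := h.fderiv_evolOp hs hsr.le hrT hg1 hgb hgK
  have hdiff : Differentiable ℝ (evolOp U B f s r g) := fun x =>
    (h.hasFDerivAt_evolOp hs hsr.le hrT hg1 hgb hgK x).differentiableAt
  rw [← h.evolOp_evolOp hs hsr.le hrt.le ht hφ hK, ← hg]
  have hDB : DerivBound n (fun j : ℕ => (2 * C₂ + 1) * K₁ * δ ^ (-(j * θ)))
      (evolOp U B f s r (_root_.fderiv ℝ g)) := by
    refine ⟨hD, fun j hj x => ?_⟩
    cases j with
    | zero =>
      simp only [norm_iteratedFDeriv_zero, CharP.cast_eq_zero, zero_mul, neg_zero, Real.rpow_zero,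
        mul_one]
      refine (h.norm_evolOp_le hs hsr.le hrT hgK x).trans ?_
      nlinarith
    | succ j =>
      refine (hDj j (by omega) x).trans ?_
      rw [hrs, sub_zero]
      push_cast
      have : 0 ≤ δ ^ (-(((j : ℝ) + 1) * θ)) := by positivity
      calc C₂ * (2 * K₁) * δ ^ (-(((j : ℝ) + 1) * θ))
          ≤ C₂ * (2 * K₁) * δ ^ (-(((j : ℝ) + 1) * θ)) + K₁ * δ ^ (-(((j : ℝ) + 1) * θ)) :=
            le_add_of_nonneg_right (by positivity)
        _ = _ := by ring
  have hcomp := hDB.clm_comp _ ((norm_compL_flip_le (U r s)).trans (hM s r hs hsr.le hrT))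
  rw [← hfd] at hcomp
  refine ⟨by push_cast; exact contDiff_succ_iff_fderiv.2 ⟨hdiff, by simp, hcomp.1⟩,
    fun j hj x => ?_⟩
  rw [← norm_iteratedFDeriv_fderiv]
  refine (hcomp.2 j (by omega) x).trans ?_
  -- Halving the time costs `2^{(j+1-α)θ}`, at most `2^{(n+1)θ}` for all orders involved.
  have e1 : δ ^ (-((1 - α) * θ)) * δ ^ (-(j * θ)) ≤
      2 ^ ((n + 1) * θ) * (t - s) ^ (-((j + 1 - α) * θ)) := by
    rw [← Real.rpow_add hδ0, hδ, Real.div_rpow ht0.le zero_le_two, div_eq_mul_inv,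
      ← Real.rpow_neg zero_le_two, mul_comm]
    have e2 : -((1 - α) * θ) + -(j * θ) = -((j + 1 - α) * θ) := by ring
    rw [e2, neg_neg]
    refine mul_le_mul_of_nonneg_right (Real.rpow_le_rpow_of_exponent_le one_le_two ?_)
      (by positivity)
    have : (j : ℝ) ≤ n := by exact_mod_cast (by omega : j ≤ n)
    exact mul_le_mul_of_nonneg_right (by linarith) hθ.le
  calc M * ((2 * C₂ + 1) * K₁ * δ ^ (-(j * θ)))
      = M * (2 * C₂ + 1) * C₁ * A * (δ ^ (-((1 - α) * θ)) * δ ^ (-(j * θ))) := by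
        rw [hK₁]; ring
    _ ≤ M * (2 * C₂ + 1) * C₁ * A * (2 ^ ((n + 1) * θ) * (t - s) ^ (-((j + 1 - α) * θ))) := by
        gcongr
    _ = _ := by ring

theorem IsOUData.smoothingBound_aux (n : ℕ) : ∀ (E : Type (max u v)) [NormedAddCommGroup E]
    [NormedSpace ℝ E] [CompleteSpace E], SmoothingBound T θ U B f n E := by
  induction n with
  | zero =>
    intro E _ _ _
    exact h.smoothingBound_zero E
  | succ n IH =>
    intro E _ _ _
    exact h.smoothingBound_succ hθ hrange hblow E (IH (X →L[ℝ] E))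

theorem IsOUData.smoothingBound (n : ℕ) (E : Type v) [NormedAddCommGroup E]
    [NormedSpace ℝ E] [CompleteSpace E] : SmoothingBound T θ U B f n E := by
  cases n with
  | zero => exact h.smoothingBound_zero E
  | succ n =>
    exact h.smoothingBound_succ hθ hrange hblow E
      (IsOUData.smoothingBound_aux.{u, v} h hθ hrange hblow n (X →L[ℝ] E))

end

end HigherDerivatives

end OrnsteinUhlenbeck

end

noncomputable section

namespace OrnsteinUhlenbeck

open Filter Topology

/-! ### Hölder regularity of dyadic series. -/

section HolderSums

/-- Below `1` the first power decays geometrically, above `1` the second. The truncated powers `F`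
and `G` telescope, giving a bound independent of `x` and `N`. -/
theorem sum_range_min_rpow_le {κ p b : ℝ} (hκ0 : 0 < κ) (hκ1 : κ < 1) (hp : 0 < p) (hb : 0 < b)
    {x : ℝ} (hx : 0 < x) (N : ℕ) :
    ∑ j ∈ Finset.range N, min ((x * κ ^ j) ^ p) ((x * κ ^ j) ^ (-b)) ≤
      1 / (1 - κ ^ p) + κ ^ (-b) / (κ ^ (-b) - 1) := by
  have hκp : κ ^ p < 1 := Real.rpow_lt_one hκ0.le hκ1 hp
  have hκb : 1 < κ ^ (-b) := Real.one_lt_rpow_of_pos_of_lt_one_of_neg hκ0 hκ1 (by linarith)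
  have h1 : 0 < 1 - κ ^ p := by linarith
  have h2 : 0 < κ ^ (-b) - 1 := by linarith
  set F : ℝ → ℝ := fun y => min (y ^ p) 1 with hF
  set G : ℝ → ℝ := fun y => min (y ^ (-b)) (κ ^ (-b)) with hG
  have hstep : ∀ y : ℝ, 0 < y → min (y ^ p) (y ^ (-b)) ≤
      (F y - F (y * κ)) / (1 - κ ^ p) + (G (y * κ) - G y) / (κ ^ (-b) - 1) := by
    intro y hy
    have hle : y * κ ≤ y := by nlinarith
    have hF0 : 0 ≤ F y - F (y * κ) := sub_nonneg.2
      (min_le_min (Real.rpow_le_rpow (by positivity) hle hp.le) le_rfl)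
    have hG0 : 0 ≤ G (y * κ) - G y := sub_nonneg.2
      (min_le_min (Real.rpow_le_rpow_of_nonpos (by positivity) hle (by linarith)) le_rfl)
    rcases le_total y 1 with hy1 | hy1
    · have e1 : F y = y ^ p := min_eq_left (Real.rpow_le_one hy.le hy1 hp.le)
      have e2 : F (y * κ) = y ^ p * κ ^ p := by
        rw [← Real.mul_rpow hy.le hκ0.le]
        exact min_eq_left (Real.rpow_le_one (by positivity) (hle.trans hy1) hp.le)
      refine (min_le_left _ _).trans ?_
      have : (F y - F (y * κ)) / (1 - κ ^ p) = y ^ p := by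
        rw [e1, e2]
        field_simp
      rw [this]
      exact le_add_of_nonneg_right (by positivity)
    · have e1 : G y = y ^ (-b) := min_eq_left
        (((Real.rpow_le_one_of_one_le_of_nonpos hy1 (by linarith))).trans hκb.le)
      have e2 : G (y * κ) = y ^ (-b) * κ ^ (-b) := by
        rw [← Real.mul_rpow hy.le hκ0.le]
        exact min_eq_left (Real.rpow_le_rpow_of_nonpos hκ0 (by nlinarith) (by linarith))
      refine (min_le_right _ _).trans ?_
      have : (G (y * κ) - G y) / (κ ^ (-b) - 1) = y ^ (-b) := by
        rw [e1, e2]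
        field_simp
      rw [this]
      exact le_add_of_nonneg_left (by positivity)
  have hsum : ∑ j ∈ Finset.range N, min ((x * κ ^ j) ^ p) ((x * κ ^ j) ^ (-b)) ≤
      (F x - F (x * κ ^ N)) / (1 - κ ^ p) + (G (x * κ ^ N) - G x) / (κ ^ (-b) - 1) := by
    induction N with
    | zero => simp
    | succ N IH =>
      rw [Finset.sum_range_succ]
      have := hstep (x * κ ^ N) (by positivity)
      rw [mul_assoc, ← pow_succ] at this
      refine (add_le_add IH this).trans (le_of_eq ?_)
      ring
  refine hsum.trans (add_le_add ?_ ?_)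
  · gcongr
    have h3 : F x ≤ 1 := min_le_right _ _
    have h4 : 0 ≤ F (x * κ ^ N) := le_min (by positivity) zero_le_one
    linarith
  · gcongr
    have h3 : G (x * κ ^ N) ≤ κ ^ (-b) := min_le_right _ _
    have h4 : 0 ≤ G x := le_min (by positivity) (by positivity)
    linarith

variable {V E : Type*} [NormedAddCommGroup V] [NormedSpace ℝ V] [NormedAddCommGroup E]
    [NormedSpace ℝ E] [CompleteSpace E]

/-- `g ∈ C^{n+γ}_b`, with all the terms of the norm bounded by `K`. -/
def HolderBound (n : ℕ) (γ K : ℝ) (g : V → E) : Prop :=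
  DerivBound n (fun _ => K) g ∧
    ∀ x y, ‖iteratedFDeriv ℝ n g x - iteratedFDeriv ℝ n g y‖ ≤ K * ‖x - y‖ ^ γ

/-- Dividing the scales by `H` moves the crossover of the two bounds to `1`, where the preceding sum
applies. -/
theorem norm_tsum_le_of_le_min {κ p q γ : ℝ} (hκ0 : 0 < κ) (hκ1 : κ < 1) (hp : 0 < p)
    (hpq : p + q = γ) (hγ : γ < 1) {ρ : ℝ} (hρ : 0 < ρ) {A H : ℝ} (hA : 0 ≤ A) (hH : 0 < H)
    {F : Type*} [NormedAddCommGroup F] {d : ℕ → F}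
    (h1 : ∀ j, ‖d j‖ ≤ A * (ρ * κ ^ j) ^ p * H ^ q)
    (h2 : ∀ j, ‖d j‖ ≤ A * (ρ * κ ^ j) ^ (γ - 1) * H) :
    ‖∑' j, d j‖ ≤ A * (1 / (1 - κ ^ p) + κ ^ (γ - 1) / (κ ^ (γ - 1) - 1)) * H ^ γ := by
  set C := 1 / (1 - κ ^ p) + κ ^ (γ - 1) / (κ ^ (γ - 1) - 1) with hC
  set m : ℕ → ℝ := fun j => min ((ρ / H * κ ^ j) ^ p) ((ρ / H * κ ^ j) ^ (-(1 - γ))) with hm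
  have hb : ∀ N, ∑ j ∈ Finset.range N, m j ≤ C := by
    intro N
    have := sum_range_min_rpow_le hκ0 hκ1 hp (sub_pos.2 hγ) (div_pos hρ hH) N
    rw [neg_sub] at this
    simpa only [hm, hC, neg_sub] using this
  have hm0 : ∀ j, 0 ≤ m j := fun j => le_min (by positivity) (by positivity)
  have hsum : Summable m := summable_of_sum_range_le hm0 hb
  have hle : ∀ j, ‖d j‖ ≤ A * H ^ γ * m j := by
    intro j
    have e0 : ρ / H * κ ^ j = (ρ * κ ^ j) / H := by ring
    have hAH : 0 ≤ A * H ^ γ := by positivity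
    rw [hm]
    simp only
    rw [mul_min_of_nonneg _ _ hAH, e0, Real.div_rpow (by positivity) hH.le,
      Real.div_rpow (by positivity) hH.le, neg_sub]
    refine le_min ((h1 j).trans (le_of_eq ?_)) ((h2 j).trans (le_of_eq ?_))
    · rw [← hpq, Real.rpow_add hH]
      field_simp
    · have : H ^ γ = H ^ (γ - 1) * H := by
        rw [← Real.rpow_add_one hH.ne', sub_add_cancel]
      rw [this]
      field_simp
  have h3 := tsum_of_norm_bounded (hsum.hasSum.mul_left (A * H ^ γ)) hle
  refine h3.trans ?_
  have h4 : ∑' j, m j ≤ C := hsum.tsum_le_of_sum_range_le hb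
  calc A * H ^ γ * ∑' j, m j ≤ A * H ^ γ * C := by gcongr
    _ = _ := by ring

/-- A series of functions with the decay of a dyadic decomposition is Hölder continuous. -/
theorem exists_holderBound_tsum {n : ℕ} {p α β κ R : ℝ} (hp : 0 < p) (hβ : p + α = β)
    (hn : n < β) (hn1 : β < n + 1) (hκ0 : 0 < κ) (hκ1 : κ < 1) (hR : 0 < R) :
    ∃ C : ℝ, 0 ≤ C ∧ ∀ ρ : ℝ, 0 < ρ → ρ ≤ R → ∀ A : ℝ, 0 ≤ A → ∀ g : ℕ → V → E,
      (∀ j, ContDiff ℝ (n + 1 : ℕ) (g j)) →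
      (∀ j, ∀ k < n + 1, ∀ x,
        ‖iteratedFDeriv ℝ (k + 1) (g j) x‖ ≤ A * (ρ * κ ^ j) ^ (β - (k + 1))) →
      (∀ j x, ‖g j x‖ ≤ A * (ρ * κ ^ j) ^ p) →
      (∀ j x y, ‖g j x - g j y‖ ≤ A * (ρ * κ ^ j) ^ p * ‖x - y‖ ^ α) →
      HolderBound n (β - n) (C * A) fun x => ∑' j, g j x := by
  -- Order zero decays only with exponent `p`, not `β`; derivatives of order `k ≥ 1` have the full
  -- exponent `β - k`.
  set e : ℕ → ℝ := fun k => if k = 0 then p else β - k with he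
  have he0 : ∀ k ≤ n, 0 < e k := by
    intro k hk
    have : (k : ℝ) ≤ n := by exact_mod_cast hk
    simp only [he]
    split_ifs
    · exact hp
    · linarith
  have hgeom : ∀ k ≤ n, Summable fun j : ℕ => (R * κ ^ j) ^ e k := by
    intro k hk
    have h1 : Summable fun j : ℕ => R ^ e k * (κ ^ e k) ^ j :=
      (summable_geometric_of_lt_one (by positivity)
        (Real.rpow_lt_one hκ0.le hκ1 (he0 k hk))).mul_left _
    refine h1.congr fun j => ?_
    rw [Real.mul_rpow hR.le (by positivity), ← Real.rpow_natCast, ← Real.rpow_natCast,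
      ← Real.rpow_mul hκ0.le, ← Real.rpow_mul hκ0.le, mul_comm (e k)]
  set S : ℕ → ℝ := fun k => ∑' j : ℕ, (R * κ ^ j) ^ e k with hS
  have hS0 : ∀ k, 0 ≤ S k := fun k => tsum_nonneg fun j => by positivity
  -- At small scales `n > 0` uses the size of `D^n`, with the exponent `β - n > 0`. For `n = 0` the
  -- values decay too slowly, so the `α`-oscillation supplies the missing power of `‖x - y‖`.
  obtain ⟨p', q', hp', hpq', hdiff⟩ : ∃ p' q' : ℝ, 0 < p' ∧ p' + q' = β - n ∧
      ((n = 0 ∧ p' = p ∧ q' = α) ∨ (n ≠ 0 ∧ p' = β - n ∧ q' = 0)) := by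
    rcases eq_or_ne n 0 with rfl | hn0
    · exact ⟨p, α, hp, by simpa using hβ, Or.inl ⟨rfl, rfl, rfl⟩⟩
    · exact ⟨β - n, 0, by linarith, by simp, Or.inr ⟨hn0, rfl, rfl⟩⟩
  set D := 1 / (1 - κ ^ p') + κ ^ (β - n - 1) / (κ ^ (β - n - 1) - 1) with hD
  have hD0 : 0 ≤ D := by
    have h1 : κ ^ p' < 1 := Real.rpow_lt_one hκ0.le hκ1 hp'
    have h2 : 1 < κ ^ (β - n - 1) :=
      Real.one_lt_rpow_of_pos_of_lt_one_of_neg hκ0 hκ1 (by linarith)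
    have h3 : 0 < 1 - κ ^ p' := by linarith
    have h4 : 0 < κ ^ (β - n - 1) - 1 := by linarith
    positivity
  have hsumS : 0 ≤ ∑ k ∈ Finset.range (n + 1), S k := Finset.sum_nonneg fun k _ => hS0 k
  refine ⟨∑ k ∈ Finset.range (n + 1), S k + 2 * D, by positivity, ?_⟩
  intro ρ hρ hρR A hA g hg hgk hg0 hgα
  have hρj : ∀ j : ℕ, 0 < ρ * κ ^ j := fun j => by positivity
  have hv : ∀ k j x, k ≤ n → ‖iteratedFDeriv ℝ k (g j) x‖ ≤ A * (ρ * κ ^ j) ^ e k := by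
    intro k j x hk
    cases k with
    | zero => simpa [he] using hg0 j x
    | succ k => simpa [he] using hgk j k (by omega) x
  have hv' : ∀ k j x, k ≤ n → ‖iteratedFDeriv ℝ k (g j) x‖ ≤ A * (R * κ ^ j) ^ e k := by
    intro k j x hk
    refine (hv k j x hk).trans ?_
    have := (he0 k hk).le
    gcongr
  have hgn : ∀ j, ContDiff ℝ ((n : ℕ∞) : WithTop ℕ∞) (g j) := fun j =>
    (hg j).of_le (by exact_mod_cast Nat.le_succ n)
  have hsv : ∀ k : ℕ, (k : ℕ∞) ≤ (n : ℕ∞) → Summable fun j : ℕ => A * (R * κ ^ j) ^ e k :=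
    fun k hk => (hgeom k (by exact_mod_cast hk)).mul_left A
  have hcd := contDiff_tsum (N := (n : ℕ∞)) hgn hsv fun k j x hk => hv' k j x (by exact_mod_cast hk)
  have hit : ∀ k ≤ n, ∀ x, iteratedFDeriv ℝ k (fun y => ∑' j, g j y) x =
      ∑' j, iteratedFDeriv ℝ k (g j) x := fun k hk x =>
    iteratedFDeriv_tsum_apply (N := (n : ℕ∞)) hgn hsv
      (fun k j x hk => hv' k j x (by exact_mod_cast hk)) (by exact_mod_cast hk) x
  have hsn : ∀ x, Summable fun j => iteratedFDeriv ℝ n (g j) x := fun x =>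
    .of_norm_bounded (hsv n le_rfl) fun j => hv' n j x le_rfl
  refine ⟨⟨hcd, fun k hk x => ?_⟩, fun x y => ?_⟩
  · rw [hit k hk]
    refine (tsum_of_norm_bounded ((hgeom k hk).hasSum.mul_left A) fun j => hv' k j x hk).trans ?_
    rw [mul_comm]
    refine mul_le_mul_of_nonneg_right ?_ hA
    have : S k ≤ ∑ k ∈ Finset.range (n + 1), S k :=
      Finset.single_le_sum (fun k _ => hS0 k) (Finset.mem_range.2 (by omega))
    exact this.trans (le_add_of_nonneg_right (by positivity))
  · rcases eq_or_ne x y with rfl | hxy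
    · simp only [sub_self, norm_zero]
      positivity
    have hH : 0 < ‖x - y‖ := norm_pos_iff.2 (sub_ne_zero.2 hxy)
    rw [hit n le_rfl, hit n le_rfl, ← (hsn x).tsum_sub (hsn y)]
    -- The extra derivative `n + 1` controls large scales; its exponent `β - n - 1` is negative.
    have hlip : ∀ j, ‖iteratedFDeriv ℝ n (g j) x - iteratedFDeriv ℝ n (g j) y‖ ≤
        A * (ρ * κ ^ j) ^ (β - n - 1) * ‖x - y‖ := by
      intro j
      have hdf : Differentiable ℝ (iteratedFDeriv ℝ n (g j)) :=
        (hg j).differentiable_iteratedFDeriv (by exact_mod_cast Nat.lt_succ_self n)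
      refine (convex_univ (𝕜 := ℝ)).norm_image_sub_le_of_norm_fderiv_le (fun z _ => hdf z)
        (fun z _ => ?_) (mem_univ y) (mem_univ x)
      rw [norm_fderiv_iteratedFDeriv]
      refine (hgk j n (Nat.lt_succ_self n) z).trans (le_of_eq ?_)
      rw [sub_sub]
    refine (norm_tsum_le_of_le_min (A := 2 * A) (H := ‖x - y‖) hκ0 hκ1 hp' hpq' (by linarith) hρ
      (by positivity) hH (fun j => ?_) (fun j => (hlip j).trans ?_)).trans ?_
    · have hpos : ∀ r : ℝ, 0 ≤ A * (ρ * κ ^ j) ^ r := fun r => by positivity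
      rcases hdiff with ⟨rfl, rfl, rfl⟩ | ⟨hn0, rfl, rfl⟩
      · have h1 := hgα j x y
        have h2 : ‖iteratedFDeriv ℝ 0 (g j) x - iteratedFDeriv ℝ 0 (g j) y‖ = ‖g j x - g j y‖ := by
          simp only [iteratedFDeriv_zero_eq_comp, Function.comp_apply, ← map_sub,
            LinearIsometryEquiv.norm_map]
        rw [h2]
        refine h1.trans ?_
        gcongr
        linarith
      · rw [Real.rpow_zero, mul_one]
        have h1 := hv n j x le_rfl
        have h2 := hv n j y le_rfl
        simp only [he, if_neg hn0] at h1 h2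
        exact (norm_sub_le _ _).trans (by linarith)
    · have : 0 ≤ (ρ * κ ^ j) ^ (β - n - 1) := by positivity
      gcongr
      linarith
    · refine mul_le_mul_of_nonneg_right ?_ (by positivity)
      nlinarith

end HolderSums

/-! ### Boundedness of `P_{s,t}` on Hölder spaces. -/

section FinalDatum

universe u

variable {X : Type*} [NormedAddCommGroup X] [InnerProductSpace ℝ X] [CompleteSpace X]
  [TopologicalSpace.SeparableSpace X] [MeasurableSpace X] [BorelSpace X]
  {T θ : ℝ} {U : ℝ → ℝ → X →L[ℝ] X} {B : ℝ → X →L[ℝ] X} {f : ℝ → X}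
  {E : Type*} [NormedAddCommGroup E] [NormedSpace ℝ E] [CompleteSpace E]

theorem iteratedFDeriv_comp_const_add {V E : Type*} [NormedAddCommGroup V] [NormedSpace ℝ V]
    [NormedAddCommGroup E] [NormedSpace ℝ E] (k : ℕ) (g : V → E) (a x : V) :
    iteratedFDeriv ℝ k (fun z => g (a + z)) x = iteratedFDeriv ℝ k g (a + x) :=
  iteratedFDeriv_comp_add_left k a x

theorem HolderBound.nonneg {V E : Type*} [NormedAddCommGroup V] [NormedSpace ℝ V]
    [NormedAddCommGroup E] [NormedSpace ℝ E] {n : ℕ} {γ K : ℝ} {g : V → E}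
    (h : HolderBound n γ K g) : 0 ≤ K := (norm_nonneg _).trans (h.1.norm_le 0)

/-- The operators `P_{s,t}` are bounded in `C^{n+γ}_b`. -/
theorem IsOUData.exists_holderBound_evolOp (h : IsOUData T U B f) (n : ℕ) {γ : ℝ} (hγ0 : 0 ≤ γ)
    (hγ1 : γ ≤ 1) : ∃ C : ℝ, 0 ≤ C ∧ ∀ s t, 0 ≤ s → s ≤ t → t ≤ T → ∀ (g : X → E) (K : ℝ),
      HolderBound n γ K g → HolderBound n γ (C * K) (evolOp U B f s t g) := by
  obtain ⟨M, hM1, hM⟩ := h.evolution.exists_bound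
  refine ⟨M ^ (n + 1), by positivity, fun s t hs hst ht g K hg => ?_⟩
  have hK0 := hg.nonneg
  have hP := h.preservesDerivBound hs hst ht (hM s t hs hst ht) n E
  have hgc : Continuous g := hg.1.1.continuous
  have h1 := hP _ _ hg.1
  refine ⟨h1.mono fun j hj => ?_, fun x y => ?_⟩
  · gcongr
    omega
  -- The seminorm comes from the derivative bounds for an increment of `g`, evaluated at `0`. Only
  -- order `n` matters; `2K` for lower orders merely completes the hypothesis.
  · set ψ : X → E := fun z => g (U t s x + z) - g (U t s y + z) with hψ
    have hcx : ∀ a : X, ContDiff ℝ n fun z => g (a + z) := fun a =>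
      hg.1.1.comp (contDiff_const.add contDiff_id)
    have hψb : DerivBound n (fun j => if j = n then K * ‖U t s (x - y)‖ ^ γ else 2 * K) ψ := by
      refine ⟨(hcx _).sub (hcx _), fun j hj z => ?_⟩
      have e1 : iteratedFDeriv ℝ j ψ z = iteratedFDeriv ℝ j g (U t s x + z) -
          iteratedFDeriv ℝ j g (U t s y + z) := by
        have hjn : (j : WithTop ℕ∞) ≤ n := by exact_mod_cast hj
        rw [hψ, fun_iteratedFDeriv_sub_apply ((hcx _).of_le hjn).contDiffAt
          ((hcx _).of_le hjn).contDiffAt, iteratedFDeriv_comp_const_add,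
          iteratedFDeriv_comp_const_add]
      rw [e1]
      beta_reduce
      split_ifs with hjn
      · subst hjn
        refine (hg.2 _ _).trans (le_of_eq ?_)
        rw [add_sub_add_right_eq_sub, ← map_sub]
      · refine (norm_sub_le _ _).trans ?_
        rw [two_mul]
        exact add_le_add (hg.1.2 j hj _) (hg.1.2 j hj _)
    have h2 := (hP _ _ hψb).2 n le_rfl 0
    simp only [if_true] at h2
    have e2 : evolOp U B f s t ψ = fun z => evolOp U B f s t g (x + z) - evolOp U B f s t g (y + z) := by
      ext z
      rw [hψ, h.evolOp_sub hs hst ht (φ := fun z => g (U t s x + z)) (ψ := fun z => g (U t s y + z))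
        (by fun_prop) (by fun_prop) (fun x => hg.1.norm_le _) (fun x => hg.1.norm_le _),
        ← h.evolOp_comp_add hs hst ht hgc, ← h.evolOp_comp_add hs hst ht hgc, add_comm z, add_comm z]
    have hcx' : ∀ a : X, ContDiff ℝ n fun z => evolOp U B f s t g (a + z) := fun a =>
      h1.1.comp (contDiff_const.add contDiff_id)
    rw [e2, fun_iteratedFDeriv_sub_apply (hcx' _).contDiffAt (hcx' _).contDiffAt,
      iteratedFDeriv_comp_const_add, iteratedFDeriv_comp_const_add, add_zero, add_zero] at h2
    refine h2.trans ?_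
    have h3 : ‖U t s (x - y)‖ ^ γ ≤ M * ‖x - y‖ ^ γ := by
      calc ‖U t s (x - y)‖ ^ γ ≤ (M * ‖x - y‖) ^ γ := Real.rpow_le_rpow (norm_nonneg _)
            (((U t s).le_opNorm _).trans (by gcongr; exact hM s t hs hst ht)) hγ0
        _ = M ^ γ * ‖x - y‖ ^ γ := Real.mul_rpow (by positivity) (norm_nonneg _)
        _ ≤ M * ‖x - y‖ ^ γ := by
          gcongr
          simpa using Real.rpow_le_rpow_of_exponent_le hM1 hγ1
    calc M ^ n * (K * ‖U t s (x - y)‖ ^ γ) ≤ M ^ n * (K * (M * ‖x - y‖ ^ γ)) := by gcongr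
      _ = _ := by ring

end FinalDatum

end OrnsteinUhlenbeck

end

noncomputable section

namespace OrnsteinUhlenbeck

open Filter Topology

/-! ### Regularity of the integral term. -/

section Source

/-- The dyadic decomposition of an integral, accumulating at the left endpoint. -/
theorem integral_eq_tsum_dyadic {s t K : ℝ} (hst : s ≤ t) {g : ℝ → ℝ}
    (hg : IntervalIntegrable g volume s t) (hK : ∀ σ ∈ Ioc s t, ‖g σ‖ ≤ K) :
    ∫ σ in s..t, g σ =
      ∑' j : ℕ, ∫ σ in (s + (t - s) * (1 / 2) ^ (j + 1))..(s + (t - s) * (1 / 2) ^ j), g σ := by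
  set a : ℕ → ℝ := fun j => s + (t - s) * (1 / 2) ^ j with ha
  have hts : 0 ≤ t - s := sub_nonneg.2 hst
  have has : ∀ j, s ≤ a j := fun j => by
    have : 0 ≤ (t - s) * (1 / 2 : ℝ) ^ j := by positivity
    simp only [ha]
    linarith
  have hat : ∀ j, a j ≤ t := fun j => by
    simp only [ha]
    have : (t - s) * (1 / 2 : ℝ) ^ j ≤ t - s :=
      mul_le_of_le_one_right hts (pow_le_one₀ (by norm_num) (by norm_num))
    linarith
  have hstep : ∀ j, a j - a (j + 1) = (t - s) / 2 * (1 / 2) ^ j := fun j => by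
    simp only [ha, pow_succ]; ring
  have hanti : ∀ j, a (j + 1) ≤ a j := fun j => by
    have : 0 ≤ a j - a (j + 1) := by rw [hstep]; positivity
    linarith
  have hint : ∀ {b c}, s ≤ b → b ≤ c → c ≤ t → IntervalIntegrable g volume b c :=
    fun hb hbc hc => hg.mono_set (by
      rw [uIcc_of_le hbc, uIcc_of_le hst]
      exact Icc_subset_Icc hb hc)
  have hnorm : ∀ {b c}, s ≤ b → b ≤ c → c ≤ t → ‖∫ σ in b..c, g σ‖ ≤ K * (c - b) := by
    intro b c hb hbc hc
    have := intervalIntegral.norm_integral_le_of_norm_le_const (a := b) (b := c) (f := g) (C := K)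
      fun σ hσ => by
        rw [uIoc_of_le hbc] at hσ
        exact hK σ ⟨hb.trans_lt hσ.1, hσ.2.trans hc⟩
    rwa [abs_of_nonneg (sub_nonneg.2 hbc)] at this
  have hsumm : Summable fun j => ∫ σ in (a (j + 1))..(a j), g σ := by
    refine .of_norm_bounded (g := fun j => K * ((t - s) / 2 * (1 / 2 : ℝ) ^ j)) ?_ fun j => ?_
    · exact ((summable_geometric_of_lt_one (by norm_num) (by norm_num)).mul_left _).mul_left _
    · rw [← hstep]
      exact hnorm (has _) (hanti j) (hat j)
  have hpart : ∀ N, ∑ j ∈ Finset.range N, ∫ σ in (a (j + 1))..(a j), g σ = ∫ σ in (a N)..t, g σ := by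
    intro N
    induction N with
    | zero => simp [ha]
    | succ N IH =>
      rw [Finset.sum_range_succ, IH, add_comm, intervalIntegral.integral_add_adjacent_intervals
        (hint (has _) (hanti N) (hat N)) (hint (has _) (hat N) le_rfl)]
  have hlim : Tendsto (fun N => ∫ σ in (a N)..t, g σ) atTop (𝓝 (∫ σ in s..t, g σ)) := by
    rw [tendsto_iff_norm_sub_tendsto_zero]
    have hb : ∀ N, ‖(∫ σ in (a N)..t, g σ) - ∫ σ in s..t, g σ‖ ≤ K * ((t - s) * (1 / 2) ^ N) := by
      intro N
      rw [← intervalIntegral.integral_add_adjacent_intervals (hint le_rfl (has N) (hat N))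
        (hint (has N) (hat N) le_rfl), norm_sub_rev, add_sub_cancel_right]
      refine (hnorm le_rfl (has N) (hat N)).trans (le_of_eq ?_)
      simp only [ha]
      ring
    refine squeeze_zero (fun _ => norm_nonneg _) hb ?_
    have := (((tendsto_pow_atTop_nhds_zero_of_lt_one (r := (1 / 2 : ℝ)) (by norm_num)
      (by norm_num)).const_mul (t - s)).const_mul K)
    simpa using this
  refine tendsto_nhds_unique hlim ?_
  have := hsumm.hasSum.tendsto_sum_nat
  simp_rw [hpart] at this
  exact this

variable {X : Type*} [NormedAddCommGroup X] [InnerProductSpace ℝ X] [CompleteSpace X]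
  [TopologicalSpace.SeparableSpace X] [MeasurableSpace X] [BorelSpace X]
  {T θ : ℝ} {U : ℝ → ℝ → X →L[ℝ] X} {B : ℝ → X →L[ℝ] X} {f : ℝ → X}

section

variable (h : IsOUData T U B f) {t : ℝ} (ht : t ≤ T) {ψ : ℝ → X → ℝ}
  (hψ : ContinuousOn (fun p : ℝ × X => ψ p.1 p.2) (Icc 0 t ×ˢ univ)) {K : ℝ}
  (hK : ∀ σ ∈ Icc 0 t, ∀ x, |ψ σ x| ≤ K)

include hψ in
theorem continuous_slice {σ : ℝ} (hσ : σ ∈ Icc 0 t) : Continuous (ψ σ) :=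
  hψ.comp_continuous (f := fun x : X => (σ, x)) (by fun_prop) fun _ => ⟨hσ, mem_univ _⟩

include h ht hψ hK

theorem IsOUData.aestronglyMeasurable_evolOp_left {r : ℝ} (hr : 0 ≤ r) (y : X) :
    AEStronglyMeasurable (fun σ => evolOp U B f r σ (ψ σ) y) (volume.restrict (Ioc r t)) := by
  have h1 := h.aestronglyMeasurable_evolOp hr ht hψ hK (Measure.dirac y)
  rw [Measure.prod_dirac] at h1
  exact h1.comp_measurable (by fun_prop)

theorem IsOUData.intervalIntegrable_evolOp {r : ℝ} (hr : 0 ≤ r) (hrt : r ≤ t) (y : X) :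
    IntervalIntegrable (fun σ => evolOp U B f r σ (ψ σ) y) volume r t := by
  rw [intervalIntegrable_iff_integrableOn_Ioc_of_le hrt]
  refine Integrable.mono' (integrable_const K)
    (h.aestronglyMeasurable_evolOp_left ht hψ hK hr y) ?_
  filter_upwards [ae_restrict_mem measurableSet_Ioc] with σ hσ
  exact h.norm_evolOp_le hr hσ.1.le (hσ.2.trans ht) (hK σ ⟨hr.trans hσ.1.le, hσ.2⟩) y

theorem IsOUData.norm_integral_evolOp_le {r : ℝ} (hr : 0 ≤ r) (hrt : r ≤ t) (y : X) :
    ‖∫ σ in r..t, evolOp U B f r σ (ψ σ) y‖ ≤ K * (t - r) := by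
  have := intervalIntegral.norm_integral_le_of_norm_le_const (a := r) (b := t)
    (f := fun σ => evolOp U B f r σ (ψ σ) y) (C := K) fun σ hσ => by
      rw [uIoc_of_le hrt] at hσ
      exact h.norm_evolOp_le hr hσ.1.le (hσ.2.trans ht) (hK σ ⟨hr.trans hσ.1.le, hσ.2⟩) y
  rwa [abs_of_nonneg (sub_nonneg.2 hrt)] at this

theorem IsOUData.continuous_integral_evolOp {r : ℝ} (hr : 0 ≤ r) (hrt : r ≤ t) :
    Continuous fun y => ∫ σ in r..t, evolOp U B f r σ (ψ σ) y := by
  simp_rw [intervalIntegral.integral_of_le hrt]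
  refine continuous_of_dominated (bound := fun _ => K)
    (fun y => h.aestronglyMeasurable_evolOp_left ht hψ hK hr y) (fun y => ?_)
    (integrable_const K) ?_
  · filter_upwards [ae_restrict_mem measurableSet_Ioc] with σ hσ
    exact h.norm_evolOp_le hr hσ.1.le (hσ.2.trans ht) (hK σ ⟨hr.trans hσ.1.le, hσ.2⟩) y
  · filter_upwards [ae_restrict_mem measurableSet_Ioc] with σ hσ
    have hσ' : σ ∈ Icc 0 t := ⟨hr.trans hσ.1.le, hσ.2⟩
    exact h.continuous_evolOp hr hσ.1.le (hσ.2.trans ht) (continuous_slice hψ hσ') (hK σ hσ')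

theorem IsOUData.norm_integral_evolOp_sub_le {A α M : ℝ} (hA : 0 ≤ A) (hα : 0 ≤ α) (hM0 : 0 ≤ M)
    (hM : ∀ s t, 0 ≤ s → s ≤ t → t ≤ T → ‖U t s‖ ≤ M)
    (hosc : ∀ σ ∈ Icc 0 t, ∀ x y, |ψ σ x - ψ σ y| ≤ A * ‖x - y‖ ^ α)
    {r : ℝ} (hr : 0 ≤ r) (hrt : r ≤ t) (y z : X) :
    ‖(∫ σ in r..t, evolOp U B f r σ (ψ σ) y) - ∫ σ in r..t, evolOp U B f r σ (ψ σ) z‖ ≤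
      A * M ^ α * (t - r) * ‖y - z‖ ^ α := by
  rw [← intervalIntegral.integral_sub (h.intervalIntegrable_evolOp ht hψ hK hr hrt y)
    (h.intervalIntegrable_evolOp ht hψ hK hr hrt z)]
  have := intervalIntegral.norm_integral_le_of_norm_le_const (a := r) (b := t)
    (f := fun σ => evolOp U B f r σ (ψ σ) y - evolOp U B f r σ (ψ σ) z)
    (C := A * (M ^ α * ‖y - z‖ ^ α)) fun σ hσ => by
      rw [uIoc_of_le hrt] at hσ
      have hσ' : σ ∈ Icc 0 t := ⟨hr.trans hσ.1.le, hσ.2⟩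
      refine (h.norm_evolOp_sub_le hr hσ.1.le (hσ.2.trans ht) (continuous_slice hψ hσ') (hK σ hσ')
        (hosc σ hσ') y z).trans ?_
      rw [← Real.mul_rpow hM0 (norm_nonneg _)]
      refine mul_le_mul_of_nonneg_left (Real.rpow_le_rpow (norm_nonneg _)
        (((U σ r).le_opNorm _).trans ?_) hα) hA
      exact mul_le_mul_of_nonneg_right (hM r σ hr hσ.1.le (hσ.2.trans ht)) (norm_nonneg _)
  rw [abs_of_nonneg (sub_nonneg.2 hrt)] at this
  exact this.trans (le_of_eq (by ring))

/-- The integral of `P_{s,σ} ψ(σ,·)` over `σ ≥ r` factors through `P_{s,r}`. -/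
theorem IsOUData.integral_evolOp_eq {s r : ℝ} (hs : 0 ≤ s) (hsr : s ≤ r) (hrt : r ≤ t) (x : X) :
    ∫ σ in r..t, evolOp U B f s σ (ψ σ) x =
      evolOp U B f s r (fun y => ∫ σ in r..t, evolOp U B f r σ (ψ σ) y) x := by
  have hr : 0 ≤ r := hs.trans hsr
  have hlaw := h.isGaussianLaw hs hsr (hrt.trans ht) x
  have := hlaw.isProbabilityMeasure
  rw [evolOp]
  simp_rw [intervalIntegral.integral_of_le hrt]
  -- Fubini pulls the time integral outside; Chapman-Kolmogorov then holds for each `σ`.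
  rw [← integral_integral_swap]
  · refine setIntegral_congr_fun measurableSet_Ioc fun σ hσ => ?_
    have hσ' : σ ∈ Icc 0 t := ⟨hr.trans hσ.1.le, hσ.2⟩
    rw [← h.evolOp_evolOp hs hsr hσ.1.le (hσ.2.trans ht) (continuous_slice hψ hσ') (hK σ hσ')]
    rfl
  · refine (integrable_const K).mono' (h.aestronglyMeasurable_evolOp hr ht hψ hK _) ?_
    have hmem : ∀ᵐ p ∂((volume.restrict (Ioc r t)).prod
        (gaussianMeasure (meanM U f r s x) (covQ U B r s))), p.1 ∈ Ioc r t :=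
      Measure.quasiMeasurePreserving_fst.ae (ae_restrict_mem measurableSet_Ioc)
    filter_upwards [hmem] with p hσ
    exact h.norm_evolOp_le hr hσ.1.le (hσ.2.trans ht) (hK _ ⟨hr.trans hσ.1.le, hσ.2⟩) _

end

theorem holderBound_zero {V : Type*} [NormedAddCommGroup V] [NormedSpace ℝ V] {n : ℕ} {γ K : ℝ}
    (hK : 0 ≤ K) : HolderBound n γ K (fun _ : V => (0 : ℝ)) := by
  have h0 : ∀ k, iteratedFDeriv ℝ k (fun _ : V => (0 : ℝ)) = 0 := fun k =>
    iteratedFDeriv_fun_zero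
  refine ⟨⟨contDiff_const, fun j _ x => ?_⟩, fun x y => ?_⟩
  · simpa [h0] using hK
  · simp only [h0, Pi.zero_apply, sub_self, norm_zero]
    positivity

/-- The regularity of the integral term of the mild solution. -/
theorem IsOUData.exists_holderBound_integral (h : IsOUData T U B f) (hθ : 0 < θ)
    (hrange : RangeCondition T U B) (hblow : PowerBlowUp T θ U B) {α : ℝ} (hα : 0 ≤ α)
    (hα1 : α < 1) {n : ℕ} (hn : (n : ℝ) < α + 1 / θ) (hn1 : α + 1 / θ < n + 1) :
    ∃ C : ℝ, 0 ≤ C ∧ ∀ (t : ℝ), t ≤ T → ∀ (ψ : ℝ → X → ℝ) (K : ℝ),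
      ContinuousOn (fun p : ℝ × X => ψ p.1 p.2) (Icc 0 t ×ˢ univ) →
      (∀ σ ∈ Icc 0 t, ∀ x, |ψ σ x| ≤ K) →
      (∀ σ ∈ Icc 0 t, ∀ x y, |ψ σ x - ψ σ y| ≤ 2 * K * ‖x - y‖ ^ α) → ∀ s ∈ Icc 0 t,
      HolderBound n (α + 1 / θ - n) (C * K) fun x => ∫ σ in s..t, evolOp U B f s σ (ψ σ) x := by
  obtain ⟨C₁, hC₁0, hC₁⟩ := h.smoothingBound hθ hrange hblow (n + 1) ℝ
  obtain ⟨M, hM1, hM⟩ := h.evolution.exists_bound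
  have hM0 : 0 ≤ M := by linarith
  -- The scale is (block length)`^θ`, so the ratio is `(1/2)^θ` and `p = 1/θ` recovers the length;
  -- `R` bounds the initial scale uniformly in `s` and `t`.
  obtain ⟨C₂, hC₂0, hC₂⟩ := exists_holderBound_tsum (V := X) (E := ℝ) (n := n) (p := 1 / θ) (α := α)
    (κ := (1 / 2) ^ θ) (R := (max T 1) ^ θ) (by positivity) (add_comm _ _) hn hn1 (by positivity)
    (Real.rpow_lt_one (by norm_num) (by norm_num) hθ) (by positivity)
  set D := max C₁ 1 * (2 * M * M) with hD
  have hD0 : 0 ≤ D := by positivity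
  refine ⟨C₂ * D, by positivity, fun t htT ψ K hψ hK hosc s hs => ?_⟩
  have ht0 : 0 ≤ t := hs.1.trans hs.2
  have hK0 : 0 ≤ K := (abs_nonneg _).trans (hK s hs 0)
  rcases hs.2.eq_or_lt with rfl | hst
  · simp only [intervalIntegral.integral_same]
    exact holderBound_zero (by positivity)
  have hts : 0 < t - s := sub_pos.2 hst
  set a : ℕ → ℝ := fun j => s + (t - s) * (1 / 2) ^ j with ha
  set l : ℕ → ℝ := fun j => (t - s) / 2 * (1 / 2) ^ j with hl
  have hl0 : ∀ j, 0 < l j := fun j => by positivity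
  -- Each block is as long as its distance from `s`, so the smoothing time matches the size of the
  -- block integral.
  have hla : ∀ j, a (j + 1) - s = l j := fun j => by simp only [ha, hl, pow_succ]; ring
  have hla' : ∀ j, a j - a (j + 1) = l j := fun j => by simp only [ha, hl, pow_succ]; ring
  have hsa : ∀ j, s < a (j + 1) := fun j => by linarith [hla j, hl0 j]
  have haa : ∀ j, a (j + 1) < a j := fun j => by linarith [hla' j, hl0 j]
  have hat : ∀ j, a j ≤ t := fun j => by
    simp only [ha]
    have : (t - s) * (1 / 2 : ℝ) ^ j ≤ t - s :=
      mul_le_of_le_one_right hts.le (pow_le_one₀ (by norm_num) (by norm_num))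
    linarith
  set ρ := ((t - s) / 2) ^ θ with hρ
  have hρl : ∀ j, ρ * ((1 / 2) ^ θ) ^ j = l j ^ θ := by
    intro j
    simp only [hρ, hl]
    rw [Real.mul_rpow (by positivity) (by positivity), ← Real.rpow_natCast, ← Real.rpow_natCast,
      ← Real.rpow_mul (by norm_num), ← Real.rpow_mul (by norm_num), mul_comm θ]
  have hpow : ∀ j, (ρ * ((1 / 2) ^ θ) ^ j) ^ (1 / θ) = l j := by
    intro j
    rw [hρl, ← Real.rpow_mul (hl0 j).le, mul_one_div_cancel hθ.ne', Real.rpow_one]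
  set G : ℕ → X → ℝ := fun j y => ∫ σ in a (j + 1)..a j, evolOp U B f (a (j + 1)) σ (ψ σ) y with hG
  have hsub : ∀ j, Icc 0 (a j) ⊆ Icc 0 t := fun j => Icc_subset_Icc le_rfl (hat j)
  have hψj : ∀ j, ContinuousOn (fun p : ℝ × X => ψ p.1 p.2) (Icc 0 (a j) ×ˢ univ) := fun j =>
    hψ.mono (prod_mono (hsub j) le_rfl)
  have hKj : ∀ j, ∀ σ ∈ Icc 0 (a j), ∀ x, |ψ σ x| ≤ K := fun j σ hσ => hK σ (hsub j hσ)
  have haT : ∀ j, a j ≤ T := fun j => (hat j).trans htT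
  have ha0 : ∀ j, 0 ≤ a (j + 1) := fun j => hs.1.trans (hsa j).le
  have hGc : ∀ j, Continuous (G j) := fun j =>
    h.continuous_integral_evolOp (haT j) (hψj j) (hKj j) (ha0 j) (haa j).le
  have hGK : ∀ j y, ‖G j y‖ ≤ K * l j := fun j y => by
    rw [← hla']
    exact h.norm_integral_evolOp_le (haT j) (hψj j) (hKj j) (ha0 j) (haa j).le y
  have hMα : M ^ α ≤ M := by
    simpa using Real.rpow_le_rpow_of_exponent_le hM1 hα1.le
  have hGα : ∀ j y z, ‖G j y - G j z‖ ≤ 2 * K * M * l j * ‖y - z‖ ^ α := fun j y z => by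
    refine (h.norm_integral_evolOp_sub_le (haT j) (hψj j) (hKj j) (A := 2 * K) (by positivity) hα
      hM0 hM (fun σ hσ => hosc σ (hsub j hσ)) (ha0 j) (haa j).le y z).trans ?_
    rw [hla']
    have := (hl0 j).le
    gcongr
  -- The part of the source term over the `j`-th block, factored through the time `a (j + 1)`.
  set F : ℕ → X → ℝ := fun j => evolOp U B f s (a (j + 1)) (G j) with hF
  have hsum : (fun x => ∫ σ in s..t, evolOp U B f s σ (ψ σ) x) = fun x => ∑' j, F j x := by
    ext x
    rw [integral_eq_tsum_dyadic hs.2 (h.intervalIntegrable_evolOp htT hψ hK hs.1 hs.2 x) (K := K)]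
    · refine tsum_congr fun j => ?_
      exact h.integral_evolOp_eq (haT j) (hψj j) (hKj j) hs.1 (hsa j).le (haa j).le x
    · intro σ hσ
      exact h.norm_evolOp_le hs.1 hσ.1.le (hσ.2.trans htT) (hK σ ⟨hs.1.trans hσ.1.le, hσ.2⟩) x
  rw [hsum, mul_assoc]
  have hone : 1 ≤ max C₁ 1 := le_max_right _ _
  have hsm := fun j => hC₁ s (a (j + 1)) hs.1 (hsa j) (haT _) (G j) _ _ α (hGc j) (hGK j) hα hα1
    (by have := (hl0 j).le; positivity) (hGα j)
  refine hC₂ ρ (by positivity) ?_ (D * K) (by positivity) F (fun j => (hsm j).1) ?_ ?_ ?_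
  · refine Real.rpow_le_rpow (by positivity) ?_ hθ.le
    have := le_max_left T 1
    have := hs.1
    linarith
  · intro j k hk x
    refine ((hsm j).2 k hk x).trans ?_
    rw [hla, hρl, ← Real.rpow_mul (hl0 j).le]
    -- The size `l` times the smoothing factor `l^{-(k+1-α)θ}` is the scale `l^θ` raised to `β -
    -- (k+1)`.
    have e1 : θ * (α + 1 / θ - (k + 1)) = 1 + -((k + 1 - α) * θ) := by
      field_simp
      ring
    rw [e1, Real.rpow_add (hl0 j), Real.rpow_one]
    have hlp : 0 ≤ l j * l j ^ (-((k + 1 - α) * θ)) := by have := (hl0 j).le; positivity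
    calc C₁ * (2 * K * M * l j) * l j ^ (-((k + 1 - α) * θ))
        = C₁ * (2 * M) * K * (l j * l j ^ (-((k + 1 - α) * θ))) := by ring
      _ ≤ D * K * (l j * l j ^ (-((k + 1 - α) * θ))) := by
        rw [hD]
        gcongr
        · exact le_max_left _ _
        · nlinarith
  · intro j x
    rw [hpow]
    refine (h.norm_evolOp_le hs.1 (hsa j).le (haT _) (hGK j) x).trans ?_
    refine mul_le_mul_of_nonneg_right ?_ (hl0 j).le
    refine le_mul_of_one_le_left hK0 ?_
    rw [hD]
    nlinarith [mul_le_mul hM1 hM1 zero_le_one hM0]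
  · intro j x y
    rw [hpow]
    refine (h.norm_evolOp_sub_le hs.1 (hsa j).le (haT _) (hGc j) (hGK j) (hGα j) x y).trans ?_
    have hU : ‖U (a (j + 1)) s (x - y)‖ ^ α ≤ M * ‖x - y‖ ^ α := by
      calc ‖U (a (j + 1)) s (x - y)‖ ^ α ≤ (M * ‖x - y‖) ^ α := Real.rpow_le_rpow (norm_nonneg _)
            (((U _ s).le_opNorm _).trans (by gcongr; exact hM s _ hs.1 (hsa j).le (haT _))) hα
        _ = M ^ α * ‖x - y‖ ^ α := Real.mul_rpow (by positivity) (norm_nonneg _)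
        _ ≤ M * ‖x - y‖ ^ α := by gcongr
    have := (hl0 j).le
    calc 2 * K * M * l j * ‖U (a (j + 1)) s (x - y)‖ ^ α
        ≤ 2 * K * M * l j * (M * ‖x - y‖ ^ α) := by gcongr
      _ = 1 * (2 * M * M) * K * l j * ‖x - y‖ ^ α := by ring
      _ ≤ D * K * l j * ‖x - y‖ ^ α := by
        rw [hD]
        gcongr

end Source

end OrnsteinUhlenbeck

end

noncomputable section

namespace OrnsteinUhlenbeck

open Filter Topology

/-! ### Joint continuity of partial derivatives. -/

section JointContinuity

variable {V : Type*} [NormedAddCommGroup V] [NormedSpace ℝ V]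

/-- Directional derivatives with a uniform modulus of continuity depend continuously on
parameters. -/
theorem continuousOn_of_hasLineDerivAt {I : Set ℝ} {w d : ℝ → V → ℝ} {e : V} {L δ : ℝ}
    (hL : 0 ≤ L) (hδ : 0 < δ)
    (hw : ContinuousOn (fun p : ℝ × V => w p.1 p.2) (I ×ˢ univ))
    (hd : ∀ s ∈ I, ∀ x, HasLineDerivAt ℝ (w s) (d s x) x e)
    (hmod : ∀ s ∈ I, ∀ x y, |d s x - d s y| ≤ L * ‖x - y‖ ^ δ) :
    ContinuousOn (fun p : ℝ × V => d p.1 p.2) (I ×ˢ univ) := by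
  set q : ℝ → ℝ × V → ℝ := fun r p => r⁻¹ * (w p.1 (p.2 + r • e) - w p.1 p.2) with hq
  -- The modulus bounds the difference-quotient error uniformly in `(s,x)`, by the mean value
  -- inequality along `e`. Uniform limits then keep continuity.
  have hest : ∀ r : ℝ, r ≠ 0 → ∀ p ∈ I ×ˢ (univ : Set V),
      |d p.1 p.2 - q r p| ≤ L * (|r| * ‖e‖) ^ δ := by
    rintro r hr ⟨s, x⟩ ⟨hs, -⟩
    simp only at hs ⊢
    set g : ℝ → ℝ := fun τ => w s (x + (τ * r) • e) - (τ * r) * d s x with hg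
    have hderiv : ∀ τ : ℝ, HasDerivAt g (r * (d s (x + (τ * r) • e) - d s x)) τ := by
      intro τ
      have h1 := hd s hs (x + (τ * r) • e)
      unfold HasLineDerivAt at h1
      have h2 : HasDerivAt (fun τ' : ℝ => τ' * r - τ * r) r τ := by
        simpa using ((hasDerivAt_id τ).mul_const r).sub_const (τ * r)
      rw [← sub_self (τ * r)] at h1
      have h3 := HasDerivAt.scomp (h := fun τ' : ℝ => τ' * r - τ * r) τ h1 h2
      have h4 : HasDerivAt (fun τ' : ℝ => w s (x + (τ' * r) • e))
          (r * d s (x + (τ * r) • e)) τ := by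
        refine h3.congr_of_eventuallyEq (Eventually.of_forall fun τ' => ?_)
        simp only [Function.comp_apply]
        congr 1
        rw [sub_smul]
        abel
      have h5 : HasDerivAt (fun τ' : ℝ => (τ' * r) * d s x) (r * d s x) τ := by
        simpa using ((hasDerivAt_id τ).mul_const r).mul_const (d s x)
      rw [mul_sub]
      exact h4.sub h5
    have h6 := norm_image_sub_le_of_norm_deriv_le_segment_01' (f := g)
      (C := |r| * (L * (|r| * ‖e‖) ^ δ)) (fun τ _ => (hderiv τ).hasDerivWithinAt) fun τ hτ => by
        rw [Real.norm_eq_abs, abs_mul]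
        refine mul_le_mul_of_nonneg_left ((hmod s hs _ _).trans ?_) (abs_nonneg _)
        rw [add_sub_cancel_left, norm_smul, norm_mul]
        have h7 : ‖τ‖ ≤ 1 := by
          rw [Real.norm_eq_abs, abs_of_nonneg hτ.1]
          exact hτ.2.le
        refine mul_le_mul_of_nonneg_left (Real.rpow_le_rpow (by positivity) ?_ hδ.le) hL
        exact mul_le_mul_of_nonneg_right (mul_le_of_le_one_left (norm_nonneg _) h7) (norm_nonneg _)
    have h8 : d s x - q r (s, x) = -(r⁻¹ * (g 1 - g 0)) := by
      simp only [hq, hg, one_mul, zero_mul, zero_smul, add_zero, sub_zero]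
      field_simp
      ring
    rw [h8, abs_neg, abs_mul, abs_inv]
    rw [Real.norm_eq_abs] at h6
    calc |r|⁻¹ * |g 1 - g 0| ≤ |r|⁻¹ * (|r| * (L * (|r| * ‖e‖) ^ δ)) := by gcongr
      _ = _ := by
        have : |r| ≠ 0 := abs_ne_zero.2 hr
        field_simp
  have hunif : TendstoUniformlyOn q (fun p : ℝ × V => d p.1 p.2) (𝓝[≠] 0) (I ×ˢ univ) := by
    rw [Metric.tendstoUniformlyOn_iff]
    intro ε hε
    have hlim : Tendsto (fun r : ℝ => L * (|r| * ‖e‖) ^ δ) (𝓝[≠] 0) (𝓝 0) := by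
      have hc : Continuous fun r : ℝ => L * (|r| * ‖e‖) ^ δ :=
        continuous_const.mul ((continuous_abs.mul continuous_const).rpow_const
          fun _ => Or.inr hδ.le)
      have := hc.tendsto 0
      rw [abs_zero, zero_mul, Real.zero_rpow hδ.ne', mul_zero] at this
      exact this.mono_left nhdsWithin_le_nhds
    filter_upwards [hlim.eventually (gt_mem_nhds hε), self_mem_nhdsWithin] with r hr hr0 p hp
    rw [Real.dist_eq]
    exact (hest r hr0 p hp).trans_lt hr
  refine hunif.continuousOn (Eventually.of_forall fun r => ?_).frequently
  refine continuousOn_const.mul (ContinuousOn.sub ?_ hw)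
  exact hw.comp (f := fun p : ℝ × V => (p.1, p.2 + r • e)) (by fun_prop)
    fun p hp => ⟨hp.1, mem_univ _⟩

/-- The top derivative has its Hölder modulus; a lower one is Lipschitz since the next derivative is
bounded. -/
theorem HolderBound.exists_modulus {n : ℕ} {γ K : ℝ} (hγ : 0 < γ) {k : ℕ} (hk : k ≤ n) :
    ∃ δ : ℝ, 0 < δ ∧ ∀ g : V → ℝ, HolderBound n γ K g → ∀ x y,
      ‖iteratedFDeriv ℝ k g x - iteratedFDeriv ℝ k g y‖ ≤ K * ‖x - y‖ ^ δ := by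
  rcases hk.eq_or_lt with rfl | hlt
  · exact ⟨γ, hγ, fun g hg => hg.2⟩
  · refine ⟨1, one_pos, fun g hg x y => ?_⟩
    rw [Real.rpow_one]
    have hdf : Differentiable ℝ (iteratedFDeriv ℝ k g) :=
      hg.1.1.differentiable_iteratedFDeriv (by exact_mod_cast hlt)
    refine (convex_univ (𝕜 := ℝ)).norm_image_sub_le_of_norm_fderiv_le (fun z _ => hdf z)
      (fun z _ => ?_) (mem_univ y) (mem_univ x)
    rw [norm_fderiv_iteratedFDeriv]
    exact hg.1.2 (k + 1) hlt z

/-- Partial derivatives of a continuous function with uniformly bounded Hölder norms are jointly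
continuous. -/
theorem continuousOn_iteratedFDeriv {I : Set ℝ} {v : ℝ → V → ℝ} {n : ℕ} {γ K : ℝ} (hγ : 0 < γ)
    (hK : 0 ≤ K) (hv : ContinuousOn (fun p : ℝ × V => v p.1 p.2) (I ×ˢ univ))
    (hb : ∀ s ∈ I, HolderBound n γ K (v s)) {k : ℕ} (hk : k ≤ n) (m : Fin k → V) :
    ContinuousOn (fun p : ℝ × V => iteratedFDeriv ℝ k (v p.1) p.2 m) (I ×ˢ univ) := by
  induction k with
  | zero => simpa using hv
  | succ k IH =>
    obtain ⟨δ, hδ, hmod⟩ := HolderBound.exists_modulus (V := V) (K := K) hγ hk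
    refine continuousOn_of_hasLineDerivAt (e := m 0) (L := K * ∏ i, ‖m i‖) (by positivity) hδ
      (w := fun s x => iteratedFDeriv ℝ k (v s) x (Fin.tail m)) (IH (by omega) _)
      (d := fun s x => iteratedFDeriv ℝ (k + 1) (v s) x m) (fun s hs x => ?_) fun s hs x y => ?_
    · have hdf : DifferentiableAt ℝ (iteratedFDeriv ℝ k (v s)) x :=
        (hb s hs).1.1.differentiable_iteratedFDeriv (by exact_mod_cast hk) x
      have h1 := ((ContinuousMultilinearMap.apply ℝ (fun _ : Fin k => V) ℝ
        (Fin.tail m)).hasFDerivAt.comp x hdf.hasFDerivAt).hasLineDerivAt (m 0)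
      rw [iteratedFDeriv_succ_apply_left]
      exact h1
    · have h1 := hmod (v s) (hb s hs) x y
      rw [← sub_apply, ← Real.norm_eq_abs]
      refine (ContinuousMultilinearMap.le_opNorm _ m).trans ?_
      calc _ ≤ K * ‖x - y‖ ^ δ * ∏ i, ‖m i‖ := by gcongr
        _ = _ := by ring

theorem HolderBound.sub {n : ℕ} {γ K K' : ℝ} {g g' : V → ℝ} (hg : HolderBound n γ K g)
    (hg' : HolderBound n γ K' g') : HolderBound n γ (K + K') fun x => g x - g' x := by
  have hsub : ∀ j ≤ n, ∀ x, iteratedFDeriv ℝ j (fun x => g x - g' x) x =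
      iteratedFDeriv ℝ j g x - iteratedFDeriv ℝ j g' x := fun j hj x => by
    have hjn : (j : WithTop ℕ∞) ≤ n := by exact_mod_cast hj
    exact fun_iteratedFDeriv_sub_apply (hg.1.1.of_le hjn).contDiffAt
      (hg'.1.1.of_le hjn).contDiffAt
  refine ⟨⟨hg.1.1.sub hg'.1.1, fun j hj x => ?_⟩, fun x y => ?_⟩
  · rw [hsub j hj]
    exact (norm_sub_le _ _).trans (add_le_add (hg.1.2 j hj x) (hg'.1.2 j hj x))
  · rw [hsub n le_rfl, hsub n le_rfl, sub_sub_sub_comm, add_mul]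
    exact (norm_sub_le _ _).trans (add_le_add (hg.2 x y) (hg'.2 x y))

end JointContinuity

/-! ### Joint continuity of the integral term. -/

section MildSolution

variable {X : Type*} [NormedAddCommGroup X] [InnerProductSpace ℝ X] [CompleteSpace X]
  [TopologicalSpace.SeparableSpace X] [MeasurableSpace X] [BorelSpace X]
  {T θ : ℝ} {U : ℝ → ℝ → X →L[ℝ] X} {B : ℝ → X →L[ℝ] X} {f : ℝ → X}

/-- The integral term of the mild solution is jointly continuous. -/
theorem IsOUData.continuousOn_integral_evolOp (h : IsOUData T U B f) {t : ℝ} (ht : t ≤ T)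
    {ψ : ℝ → X → ℝ} (hψ : ContinuousOn (fun p : ℝ × X => ψ p.1 p.2) (Icc 0 t ×ˢ univ)) {K : ℝ}
    (hK : ∀ σ ∈ Icc 0 t, ∀ x, |ψ σ x| ≤ K) :
    ContinuousOn (fun p : ℝ × X => ∫ σ in p.1..t, evolOp U B f p.1 σ (ψ σ) p.2)
      (Icc 0 t ×ˢ univ) := by
  -- An indicator fixes the domain to `(0,t]`, so dominated convergence applies. It jumps only at `σ
  -- = p.1`, a null set.
  set F : ℝ × X → ℝ → ℝ := fun p => (Ioi p.1).indicator fun σ => evolOp U B f p.1 σ (ψ σ) p.2 with hF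
  have hinter : ∀ {s}, 0 ≤ s → Ioc 0 t ∩ Ioi s = Ioc s t := fun {s} hs => by
    rw [Ioc_inter_Ioi, max_eq_right hs]
  have hEq : ∀ p ∈ Icc 0 t ×ˢ (univ : Set X),
      ∫ σ in p.1..t, evolOp U B f p.1 σ (ψ σ) p.2 = ∫ σ in Ioc 0 t, F p σ := by
    intro p hp
    rw [intervalIntegral.integral_of_le hp.1.2, setIntegral_indicator measurableSet_Ioi,
      hinter hp.1.1]
  refine ContinuousOn.congr ?_ hEq
  intro p₀ hp₀
  have hmem : ∀ᶠ p in 𝓝[Icc 0 t ×ˢ univ] p₀, p ∈ Icc 0 t ×ˢ (univ : Set X) := self_mem_nhdsWithin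
  have hfst : Tendsto (fun p : ℝ × X => p.1) (𝓝[Icc 0 t ×ˢ univ] p₀) (𝓝 p₀.1) :=
    (continuous_fst.tendsto p₀).mono_left nhdsWithin_le_nhds
  refine continuousWithinAt_of_dominated (bound := fun _ => K) ?_ ?_ (integrable_const K) ?_
  · filter_upwards [hmem] with p hp
    rw [aestronglyMeasurable_indicator_iff measurableSet_Ioi,
      Measure.restrict_restrict measurableSet_Ioi, inter_comm, hinter hp.1.1]
    exact h.aestronglyMeasurable_evolOp_left ht hψ hK hp.1.1 p.2
  · filter_upwards [hmem] with p hp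
    filter_upwards [ae_restrict_mem measurableSet_Ioc] with σ hσ
    have hσ' : σ ∈ Icc 0 t := ⟨hσ.1.le, hσ.2⟩
    have hK0 : 0 ≤ K := (abs_nonneg _).trans (hK σ hσ' 0)
    simp only [hF]
    by_cases hσp : σ ∈ Ioi p.1
    · rw [indicator_of_mem hσp]
      exact h.norm_evolOp_le hp.1.1 (le_of_lt hσp) (hσ.2.trans ht) (hK σ hσ') _
    · rw [indicator_of_notMem hσp]
      simpa using hK0
  · have hne : ∀ᵐ σ ∂(volume.restrict (Ioc 0 t)), σ ≠ p₀.1 :=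
      ae_restrict_of_ae (by simp [ae_iff])
    filter_upwards [ae_restrict_mem measurableSet_Ioc, hne] with σ hσ hσne
    have hσ' : σ ∈ Icc 0 t := ⟨hσ.1.le, hσ.2⟩
    rcases lt_or_gt_of_ne hσne with hlt | hgt
    · have h0 : ∀ᶠ p in 𝓝[Icc 0 t ×ˢ univ] p₀, F p σ = 0 := by
        filter_upwards [hfst.eventually (lt_mem_nhds hlt)] with p hp
        exact indicator_of_notMem (by simpa using hp.le) _
      exact continuousWithinAt_const.congr_of_eventuallyEq h0
        (indicator_of_notMem (by simpa using hlt.le) _)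
    · have h1 : ∀ᶠ p in 𝓝[Icc 0 t ×ˢ univ] p₀, F p σ = evolOp U B f p.1 σ (ψ σ) p.2 := by
        filter_upwards [hfst.eventually (gt_mem_nhds hgt)] with p hp
        exact indicator_of_mem (show σ ∈ Ioi p.1 from hp) _
      have h2 : ContinuousWithinAt (fun p : ℝ × X => evolOp U B f p.1 σ (ψ σ) p.2)
          (Icc 0 t ×ˢ univ) p₀ := by
        refine (h.continuousOn_evolOp hσ.1.le (hσ.2.trans ht) (continuous_slice hψ hσ')
          (hK σ hσ') p₀ ⟨⟨hp₀.1.1, hgt.le⟩, mem_univ _⟩).mono_of_mem_nhdsWithin ?_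
        filter_upwards [hmem, hfst.eventually (gt_mem_nhds hgt)] with p hp hpσ
        exact ⟨⟨hp.1.1, hpσ.le⟩, mem_univ _⟩
      exact h2.congr_of_eventuallyEq h1 (indicator_of_mem (show σ ∈ Ioi p₀.1 from hgt) _)

end MildSolution

/-! ### Comparison with the extended-valued norms. -/

section Norms

variable {V : Type*} [NormedAddCommGroup V] [NormedSpace ℝ V]

/-- The norm has `n + 2` terms: the supremum, `n` derivatives and the seminorm, each at most `K`. -/
theorem HolderBound.holderNorm_le {β K : ℝ} {g : V → ℝ}
    (hg : HolderBound ⌊β⌋₊ (β - ⌊β⌋₊) K g) (hβ : (⌊β⌋₊ : ℝ) ≤ β) :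
    holderNorm β g ≤ ENNReal.ofReal ((⌊β⌋₊ + 2) * K) := by
  have hK := hg.nonneg
  set n := ⌊β⌋₊ with hn
  have h1 : ∀ j ≤ n, ⨆ x, ‖iteratedFDeriv ℝ j g x‖ₑ ≤ ENNReal.ofReal K := fun j hj =>
    iSup_le fun x => by
      rw [← ofReal_norm]
      exact ENNReal.ofReal_le_ofReal (hg.1.2 j hj x)
  have h0 : ⨆ x, ‖g x‖ₑ ≤ ENNReal.ofReal K := iSup_le fun x => by
    rw [← ofReal_norm]
    exact ENNReal.ofReal_le_ofReal (hg.1.norm_le x)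
  have h2 : ∑ k ∈ Finset.Icc 1 n, ⨆ x, ‖iteratedFDeriv ℝ k g x‖ₑ ≤ n * ENNReal.ofReal K := by
    refine (Finset.sum_le_card_nsmul _ _ _ fun k hk => h1 k (Finset.mem_Icc.1 hk).2).trans ?_
    simp
  have h3 : eHolderNorm (β - n).toNNReal (iteratedFDeriv ℝ n g) ≤ ENNReal.ofReal K := by
    refine HolderWith.eHolderNorm_le (C := K.toNNReal) fun x y => ?_
    rw [edist_eq_enorm_sub, edist_eq_enorm_sub, ← ofReal_norm, ← ofReal_norm,
      Real.coe_toNNReal _ (sub_nonneg.2 hβ),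
      ENNReal.ofReal_rpow_of_nonneg (norm_nonneg _) (sub_nonneg.2 hβ),
      show ((K.toNNReal : ℝ≥0) : ℝ≥0∞) = ENNReal.ofReal K from rfl, ← ENNReal.ofReal_mul hK]
    exact ENNReal.ofReal_le_ofReal (hg.2 x y)
  calc holderNorm β g ≤ ENNReal.ofReal K + n * ENNReal.ofReal K + ENNReal.ofReal K :=
        add_le_add (add_le_add h0 h2) h3
    _ = ENNReal.ofReal ((n + 2) * K) := by
      rw [← ENNReal.ofReal_natCast n, ← ENNReal.ofReal_mul (by positivity),
        ← ENNReal.ofReal_add hK (by positivity), ← ENNReal.ofReal_add (by positivity) hK]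
      congr 1
      ring

theorem MemHolderSpace.holderBound {β : ℝ} {g : V → ℝ} (hg : MemHolderSpace β g)
    (hβ : (⌊β⌋₊ : ℝ) ≤ β) : HolderBound ⌊β⌋₊ (β - ⌊β⌋₊) (holderNorm β g).toReal g := by
  set n := ⌊β⌋₊ with hn
  have key : ∀ {a : ℝ≥0∞}, a ≤ holderNorm β g → a.toReal ≤ (holderNorm β g).toReal := fun ha =>
    ENNReal.toReal_mono hg.2.ne ha
  refine ⟨⟨hg.1, fun j hj x => ?_⟩, fun x y => ?_⟩
  · have : ‖iteratedFDeriv ℝ j g x‖ₑ ≤ holderNorm β g := by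
      rcases Nat.eq_zero_or_pos j with rfl | hj0
      · have : ‖iteratedFDeriv ℝ 0 g x‖ₑ = ‖g x‖ₑ := by
          rw [← ofReal_norm, ← ofReal_norm, norm_iteratedFDeriv_zero]
        rw [this]
        exact (le_iSup (fun x => ‖g x‖ₑ) x).trans (le_add_right (le_add_right le_rfl))
      · refine (le_iSup (fun x => ‖iteratedFDeriv ℝ j g x‖ₑ) x).trans ?_
        refine le_add_right (le_add_left ?_)
        exact Finset.single_le_sum (f := fun k => ⨆ x, ‖iteratedFDeriv ℝ k g x‖ₑ)
          (fun _ _ => zero_le) (Finset.mem_Icc.2 ⟨hj0, hj⟩)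
    simpa using key this
  · have hle : eHolderNorm (β - n).toNNReal (iteratedFDeriv ℝ n g) ≤ holderNorm β g :=
      le_add_left le_rfl
    have hmem : MemHolder (β - n).toNNReal (iteratedFDeriv ℝ n g) :=
      eHolderNorm_lt_top.1 (hle.trans_lt hg.2)
    have h1 := hmem.holderWith.dist_le x y
    rw [dist_eq_norm, dist_eq_norm, Real.coe_toNNReal _ (sub_nonneg.2 hβ)] at h1
    refine h1.trans (mul_le_mul_of_nonneg_right ?_ (by positivity))
    exact key hle

theorem abs_le_supNorm {t : ℝ} {ψ : ℝ → V → ℝ} (hψ : supNorm t ψ < ∞) {s : ℝ} (hs : s ∈ Icc 0 t)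
    (x : V) : |ψ s x| ≤ (supNorm t ψ).toReal := by
  have h1 : ‖ψ s x‖ₑ ≤ supNorm t ψ :=
    (le_iSup (fun x => ‖ψ s x‖ₑ) x).trans (le_iSup₂ (f := fun s _ => ⨆ x, ‖ψ s x‖ₑ) s hs)
  simpa using ENNReal.toReal_mono hψ.ne h1

end Norms

/-! ### The Schauder estimates. -/

section Schauder

variable {X : Type*} [NormedAddCommGroup X] [InnerProductSpace ℝ X] [CompleteSpace X]
  [TopologicalSpace.SeparableSpace X] [MeasurableSpace X] [BorelSpace X]
  {T θ : ℝ} {U : ℝ → ℝ → X →L[ℝ] X} {B : ℝ → X →L[ℝ] X} {f : ℝ → X}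

/-- Both parts of the theorem are covered: `N` is the norm of `ψ`, and the factor `2` makes the
oscillation hypothesis automatic for bounded `ψ` when `α = 0`. -/
theorem IsOUData.exists_schauder_estimate (h : IsOUData T U B f) (hθ : 0 < θ)
    (hrange : RangeCondition T U B) (hblow : PowerBlowUp T θ U B) {α : ℝ} (hα : 0 ≤ α)
    (hα1 : α < 1) (hnat : ∀ n : ℕ, α + 1 / θ ≠ n) :
    ∃ C : ℝ, 0 < C ∧ ∀ t ∈ Icc 0 T, ∀ (φ : X → ℝ) (ψ : ℝ → X → ℝ) (N : ℝ≥0∞), N < ∞ →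
      MemHolderSpace (α + 1 / θ) φ →
      ContinuousOn (fun p : ℝ × X => ψ p.1 p.2) (Icc 0 t ×ˢ univ) →
      (∀ σ ∈ Icc 0 t, ∀ x, |ψ σ x| ≤ N.toReal) →
      (∀ σ ∈ Icc 0 t, ∀ x y, |ψ σ x - ψ σ y| ≤ 2 * N.toReal * ‖x - y‖ ^ α) →
        (∀ s ∈ Icc 0 t, ∀ x,
          IntervalIntegrable (fun σ => evolP U B f s σ (ψ σ) x) volume s t) ∧
        MemSpaceHolder (α + 1 / θ) t (mildSolution U B f t φ ψ) ∧
        spaceHolderNorm (α + 1 / θ) t (mildSolution U B f t φ ψ) ≤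
          ENNReal.ofReal C * (holderNorm (α + 1 / θ) φ + N) := by
  set β := α + 1 / θ with hβ
  set n := ⌊β⌋₊ with hn
  have hβ0 : 0 ≤ β := by positivity
  -- Non-integrality of `β` enters here: it makes the Hölder exponent `β - n` strictly positive.
  have hnβ : (n : ℝ) < β := lt_of_le_of_ne (Nat.floor_le hβ0) (hnat n).symm
  have hβn : β < n + 1 := Nat.lt_floor_add_one β
  have hγ : 0 < β - n := sub_pos.2 hnβ
  obtain ⟨C₁, hC₁0, hC₁⟩ := h.exists_holderBound_evolOp (E := ℝ) n hγ.le (by linarith)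
  obtain ⟨C₂, hC₂0, hC₂⟩ := h.exists_holderBound_integral hθ hrange hblow hα hα1 hnβ hβn
  set C := max (max C₁ C₂) 1 with hC
  have hCpos : 0 < C := lt_of_lt_of_le one_pos (le_max_right _ _)
  refine ⟨(n + 2) * C, by positivity, fun t ht φ ψ N hN hφ hψ hK hosc => ?_⟩
  have hφb := hφ.holderBound hnβ.le
  set K₁ := (holderNorm β φ).toReal with hK₁
  set K₂ := N.toReal with hK₂
  have hub : ∀ s ∈ Icc 0 t, HolderBound n (β - n) (C₁ * K₁ + C₂ * K₂)
      (mildSolution U B f t φ ψ s) := fun s hs =>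
    (hC₁ s t hs.1 hs.2 ht.2 φ K₁ hφb).sub (hC₂ t ht.2 ψ K₂ hψ hK hosc s hs)
  set K := C₁ * K₁ + C₂ * K₂ with hKdef
  have hK0 : 0 ≤ K := (hub t ⟨ht.1, le_rfl⟩).nonneg
  have hcont : ContinuousOn (fun p : ℝ × X => mildSolution U B f t φ ψ p.1 p.2)
      (Icc 0 t ×ˢ univ) :=
    (h.continuousOn_evolOp ht.1 ht.2 hφ.1.continuous hφb.1.norm_le).sub
      (h.continuousOn_integral_evolOp ht.2 hψ hK)
  have hnorm : ∀ s ∈ Icc 0 t, holderNorm β (mildSolution U B f t φ ψ s) ≤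
      ENNReal.ofReal ((n + 2) * K) := fun s hs => (hub s hs).holderNorm_le hnβ.le
  have hspace : spaceHolderNorm β t (mildSolution U B f t φ ψ) ≤ ENNReal.ofReal ((n + 2) * K) :=
    iSup₂_le hnorm
  refine ⟨fun s hs x => h.intervalIntegrable_evolOp ht.2 hψ hK hs.1 hs.2 x,
    ⟨⟨hcont, ?_⟩, fun s hs => ⟨(hub s hs).1.1, (hnorm s hs).trans_lt ENNReal.ofReal_lt_top⟩,
      hspace.trans_lt ENNReal.ofReal_lt_top,
      fun k hk m => continuousOn_iteratedFDeriv hγ hK0 hcont hub hk m⟩, hspace.trans ?_⟩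
  · refine lt_of_le_of_lt (iSup₂_le fun s hs => iSup_le fun x => ?_)
      (ENNReal.ofReal_lt_top (r := K))
    rw [← ofReal_norm]
    exact ENNReal.ofReal_le_ofReal ((hub s hs).1.norm_le x)
  · rw [← ENNReal.ofReal_toReal hφ.2.ne, ← ENNReal.ofReal_toReal hN.ne, ← hK₁, ← hK₂,
      ← ENNReal.ofReal_add ENNReal.toReal_nonneg ENNReal.toReal_nonneg,
      ← ENNReal.ofReal_mul (by positivity)]
    refine ENNReal.ofReal_le_ofReal ?_
    rw [mul_assoc]
    refine mul_le_mul_of_nonneg_left ?_ (by positivity)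
    rw [mul_add]
    exact add_le_add
      (mul_le_mul_of_nonneg_right ((le_max_left _ _).trans (le_max_left _ _))
        ENNReal.toReal_nonneg)
      (mul_le_mul_of_nonneg_right ((le_max_right _ _).trans (le_max_left _ _))
        ENNReal.toReal_nonneg)

end Schauder

end OrnsteinUhlenbeck

end

open OrnsteinUhlenbeck in
theorem mainTheorem1 {X : Type*} [NormedAddCommGroup X] [InnerProductSpace ℝ X] [CompleteSpace X]
    [TopologicalSpace.SeparableSpace X] [MeasurableSpace X] [BorelSpace X]
    (T θ : ℝ) (hT : 0 < T) (hθ : 0 < θ)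
    (U : ℝ → ℝ → X →L[ℝ] X) (B : ℝ → X →L[ℝ] X) (f : ℝ → X)
    (hdata : IsOUData T U B f) (hrange : RangeCondition T U B) (hblow : PowerBlowUp T θ U B) :
    ((∀ n : ℕ, 1 / θ ≠ n) →
      ∃ C : ℝ, 0 < C ∧ ∀ t ∈ Icc 0 T, ∀ (φ : X → ℝ) (ψ : ℝ → X → ℝ),
        MemHolderSpace (1 / θ) φ → MemCb t ψ →
          (∀ s ∈ Icc 0 t, ∀ x,
            IntervalIntegrable (fun σ => evolP U B f s σ (ψ σ) x) volume s t) ∧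
          MemSpaceHolder (1 / θ) t (mildSolution U B f t φ ψ) ∧
          spaceHolderNorm (1 / θ) t (mildSolution U B f t φ ψ) ≤
            ENNReal.ofReal C * (holderNorm (1 / θ) φ + supNorm t ψ)) ∧
    (∀ α : ℝ, 0 < α → α < 1 → (∀ n : ℕ, α + 1 / θ ≠ n) →
      ∃ C : ℝ, 0 < C ∧ ∀ t ∈ Icc 0 T, ∀ (φ : X → ℝ) (ψ : ℝ → X → ℝ),
        MemHolderSpace (α + 1 / θ) φ → MemSpaceHolder α t ψ →
          (∀ s ∈ Icc 0 t, ∀ x,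
            IntervalIntegrable (fun σ => evolP U B f s σ (ψ σ) x) volume s t) ∧
          MemSpaceHolder (α + 1 / θ) t (mildSolution U B f t φ ψ) ∧
          spaceHolderNorm (α + 1 / θ) t (mildSolution U B f t φ ψ) ≤
            ENNReal.ofReal C * (holderNorm (α + 1 / θ) φ + spaceHolderNorm α t ψ)) := by
  refine ⟨fun hnat => ?_, fun α hα hα1 hnat => ?_⟩
  · have h0 : (0 : ℝ) + 1 / θ = 1 / θ := zero_add _
    obtain ⟨C, hC, hest⟩ := hdata.exists_schauder_estimate hθ hrange hblow le_rfl one_pos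
      (by rwa [h0])
    rw [h0] at hest
    refine ⟨C, hC, fun t ht φ ψ hφ hψ => hest t ht φ ψ _ hψ.2 hφ hψ.1
      (fun σ hσ => abs_le_supNorm hψ.2 hσ) fun σ hσ x y => ?_⟩
    rw [Real.rpow_zero, mul_one, two_mul]
    exact (abs_sub _ _).trans
      (add_le_add (abs_le_supNorm hψ.2 hσ x) (abs_le_supNorm hψ.2 hσ y))
  · obtain ⟨C, hC, hest⟩ := hdata.exists_schauder_estimate hθ hrange hblow hα.le hα1 hnat
    refine ⟨C, hC, fun t ht φ ψ hφ hψ => ?_⟩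
    -- For `α < 1` the space `C^α_b` involves no derivatives, so its seminorm is the oscillation of
    -- `ψ σ` itself.
    have hfloor : ⌊α⌋₊ = 0 := Nat.floor_eq_zero.2 hα1
    have hb : ∀ σ ∈ Icc 0 t, HolderBound 0 α (holderNorm α (ψ σ)).toReal (ψ σ) := fun σ hσ => by
      have := (hψ.2.1 σ hσ).holderBound (Nat.floor_le hα.le)
      rw [hfloor] at this
      simpa using this
    have hle : ∀ σ ∈ Icc 0 t,
        (holderNorm α (ψ σ)).toReal ≤ (spaceHolderNorm α t ψ).toReal := fun σ hσ =>
      ENNReal.toReal_mono hψ.2.2.1.ne (le_iSup₂ (f := fun s _ => holderNorm α (ψ s)) σ hσ)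
    refine hest t ht φ ψ _ hψ.2.2.1 hφ hψ.1.1 (fun σ hσ x => ((hb σ hσ).1.norm_le x).trans
      (hle σ hσ)) fun σ hσ x y => ?_
    have h1 := (hb σ hσ).2 x y
    simp only [iteratedFDeriv_zero_eq_comp, Function.comp_apply, ← map_sub,
      LinearIsometryEquiv.norm_map, Real.norm_eq_abs] at h1
    refine h1.trans (mul_le_mul_of_nonneg_right ?_ (by positivity))
    have := hle σ hσ
    have := (ENNReal.toReal_nonneg (a := spaceHolderNorm α t ψ))
    linarith
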